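/- Let $K$ be a field, let $\Lambda$ be a nonzero finite-dimensional $K$-algebra, and let $\Lambda^e=\Lambda\otimes_K\Lambda^{op}$; bimodules are $\Lambda^e$-modules. Let $\Omega^n(\Lambda)$ denote the $n$-th syzygy in a minimal projective resolution of $\Lambda$ as a bimodule, and let $HH^*(\Lambda)=\bigoplus_{n\ge 0}\mathrm{Ext}^n_{\Lambda^e}(\Lambda,\Lambda)$ with the Yoneda product, over which $HH^*(\Lambda,M)=\bigoplus_{n\ge0}\mathrm{Ext}^n_{\Lambda^e}(\Lambda,M)$ is a graded right module for every bimodule $M$. A complete projective resolution of $\Lambda$ is an acyclic complex $P=(\cdots\to P^{-1}\to P^0\to P^1\to\cdots)$ of projective bimodules with $\ker(P^1\to P^2)\cong\Lambda$. For such a $P$, the stable Hochschild cohomology algebra is $\underline{HH}^*(\Lambda)=\bigoplus_{n\in\mathbb Z}\mathrm{Hom}_{\mathcal H}(P,P[n])$, where $\mathcal H$ is the homotopy category of complexes of bimodules (in degree $n$ this is the $n$-th cohomology of $\mathrm{Hom}_{\Lambda^e}(P,\Lambda)$); over it $\underline{HH}^*(\Lambda,M)=\bigoplus_{n\in\mathbb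 Z}H^n(\mathrm{Hom}_{\Lambda^e}(P,M))$ is a graded right module. Stable Hochschild homology $\underline{HH}_{-*}(\Lambda,M)$ has $H^n(M\otimes_{\Lambda^e}P)$ in degree $n$; the chain maps $P\to P[j]$ make it a graded left $\underline{HH}^*(\Lambda)$-module, viewed as a right module by $vb=(-1)^{\deg b\deg v}\,bv$. For a graded module $V$, $V[s]^n=V^{n+s}$. Suppose that $\Lambda$ is periodic of period $s$, that is, $s$ is the least positive integer with $\Omega^s(\Lambda)\cong\Lambda$ as bimodules, and let $h\in HH^s(\Lambda)$ be represented by an isomorphism $\Omega^s(\Lambda)\to\Lambda$, that is, $h$ is the class of a cocycle $P_s\to\Omega^s(\Lambda)\xrightarrow{\ \sim\ }\Lambda$ where $P_\bullet\to\Lambda$ is a minimal projective resolution. Then $\Lambda$ has a complete projective resolution as a bimodule and, for every such resolution $P$: 1. For every bimodule $M$, $\underline{HH}^*(\Lambda,M)\cong\underline{HH}^*(\Lambda,M)[s]$ and $\underline{HH}_{-*}(\Lambda,M)\cong\underline{HH}_{-*}(\Lambda,M)[s]$ as graded right $\underline{HH}^*(\Lambda)$-modules. 2. $h$ is not nilpotent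 in $HH^*(\Lambda)$ and is central there, and $\underline{HH}^*(\Lambda)$ is isomorphic, as a graded $K$-algebra, to the localization $HH^*(\Lambda)_{(h)}$ at $\{1,h,h^2,\dots\}$, graded by $\deg(a/h^n)=\deg a-ns$. 3. For every bimodule $M$, $\underline{HH}^*(\Lambda,M)$ is isomorphic to the localization $HH^*(\Lambda,M)_{(h)}$ at $\{1,h,h^2,\dots\}$ as a graded right $\underline{HH}^*(\Lambda)$-module, where $\underline{HH}^*(\Lambda)$ acts on $HH^*(\Lambda,M)_{(h)}$ through one isomorphism as in 2, the same for all $M$. -/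

import Mathlib

open CategoryTheory DirectSum TensorProduct

universe u

namespace HochschildLocalization

noncomputable section

/-! ### Graded right modules over a direct sum ring -/

lemma of_eq_of_sigma_eq {ι : Type*} [DecidableEq ι] (V : ι → Type*) [∀ i, AddCommGroup (V i)]
    {i j : ι} {x : V i} {y : V j} (h : (⟨i, x⟩ : Σ i, V i) = ⟨j, y⟩) :
    DirectSum.of V i x = DirectSum.of V j y := by
  cases h
  rfl

section GradedRight

variable {ι : Type*} [AddMonoid ι] [DecidableEq ι]
  (A : ι → Type*) [∀ i, AddCommGroup (A i)] [DirectSum.GRing A]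
  (V : ι → Type*) [∀ i, AddCommGroup (V i)]

/-- A right action of a graded ring `A` on a graded abelian group `V`. -/
class GRightModule where
  act : ∀ {i j : ι}, V i →+ A j →+ V (i + j)
  act_one : ∀ {i : ι} (x : V i),
    (⟨i + 0, act x GradedMonoid.GOne.one⟩ : Σ i, V i) = ⟨i, x⟩
  act_mul : ∀ {i j k : ι} (x : V i) (a : A j) (b : A k),
    (⟨i + (j + k), act x (GradedMonoid.GMul.mul a b)⟩ : Σ i, V i) =
      ⟨i + j + k, act (act x a) b⟩

variable [GRightModule A V]

/-- The right action of `⨁ A i` on `⨁ V i`, as a biadditive map. -/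
def rightAct : (⨁ i, V i) →+ (⨁ i, A i) →+ ⨁ i, V i :=
  DirectSum.toAddMonoid fun i => AddMonoidHom.flip <|
    DirectSum.toAddMonoid fun j => AddMonoidHom.flip <|
      ((DirectSum.of V (i + j)).compHom).comp (GRightModule.act (A := A) (V := V))

lemma rightAct_of_of {i j : ι} (x : V i) (a : A j) :
    rightAct A V (DirectSum.of V i x) (DirectSum.of A j a) =
      DirectSum.of V (i + j) (GRightModule.act x a) := by
  simp [rightAct]

lemma rightAct_one (x : ⨁ i, V i) : rightAct A V x 1 = x := by
  induction x using DirectSum.induction_on with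
  | zero => simp
  | of i x =>
    rw [show (1 : ⨁ i, A i) = DirectSum.of A 0 GradedMonoid.GOne.one from rfl, rightAct_of_of]
    exact of_eq_of_sigma_eq V (GRightModule.act_one x)
  | add x y hx hy => simp [hx, hy]

lemma rightAct_mul (x : ⨁ i, V i) (a b : ⨁ i, A i) :
    rightAct A V x (a * b) = rightAct A V (rightAct A V x a) b := by
  induction x using DirectSum.induction_on with
  | zero => simp
  | add x y hx hy => simp [hx, hy]
  | of i x =>
    induction a using DirectSum.induction_on with
    | zero => simp
    | add a a' ha ha' => simp [add_mul, ha, ha']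
    | of j a =>
      induction b using DirectSum.induction_on with
      | zero => simp
      | add b b' hb hb' => simp only [mul_add, map_add, hb, hb']
      | of k b =>
        rw [DirectSum.of_mul_of, rightAct_of_of, rightAct_of_of, rightAct_of_of]
        exact of_eq_of_sigma_eq V (GRightModule.act_mul x a b)

/-- The right module structure on a direct sum, as a left module over the opposite ring. -/
@[reducible]
def rightModule : Module (⨁ i, A i)ᵐᵒᵖ (⨁ i, V i) where
  smul a x := rightAct A V x a.unop
  one_smul x := rightAct_one A V x
  mul_smul a b x := rightAct_mul A V x b.unop a.unop
  smul_zero a := by change rightAct A V 0 a.unop = 0; simp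
  smul_add a x y := by
    change rightAct A V (x + y) a.unop = rightAct A V x a.unop + rightAct A V y a.unop
    simp
  add_smul a b x := by
    change rightAct A V x (a.unop + b.unop) = rightAct A V x a.unop + rightAct A V x b.unop
    simp
  zero_smul x := by change rightAct A V x 0 = 0; simp

end GradedRight

/-! ### Localization at the powers of a central element -/

section Localization

variable {R : Type*} [Ring R]

/-- The powers of a central element form an Ore set. -/
@[reducible]
def orePowers (h : R) (hc : ∀ a, Commute h a) : OreLocalization.OreSet (Submonoid.powers h) where
  ore_right_cancel r₁ r₂ s hs := ⟨s, by
    obtain ⟨_, n, rfl⟩ := s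
    have e : ∀ a : R, h ^ n * a = a * h ^ n := fun a => (hc a).pow_left n
    simpa [e] using hs⟩
  oreNum r _ := r
  oreDenom _ s := s
  ore_eq r s := by
    obtain ⟨_, n, rfl⟩ := s
    exact (hc r).pow_left n

lemma commute_op {h : R} (hc : ∀ a, Commute h a) (a : Rᵐᵒᵖ) : Commute (MulOpposite.op h) a :=
  (hc a.unop).op

variable (h : R) (hc : ∀ a, Commute h a)

/-- The localization `R_(h)` of the ring `R` at the powers of the central element `h`. -/
abbrev LocRing : Type _ :=
  @OreLocalization R _ (Submonoid.powers h) (orePowers h hc) R _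

variable {h} in
/-- The fraction `a / h ^ n` in `R_(h)`. -/
def LocRing.frac (a : R) (n : ℕ) : LocRing h hc :=
  letI := orePowers h hc
  OreLocalization.oreDiv a (⟨h ^ n, n, rfl⟩ : Submonoid.powers h)

variable (N : Type*) [AddCommGroup N] [Module Rᵐᵒᵖ N]

/-- The localization `N_(h)` of the right `R`-module `N` at the powers of the central
element `h`. -/
abbrev LocModule : Type _ :=
  @OreLocalization Rᵐᵒᵖ _ (Submonoid.powers (MulOpposite.op h))
    (orePowers (MulOpposite.op h) (commute_op hc)) N _

variable {h N} in
/-- The fraction `x / h ^ n` in `N_(h)`. -/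
def LocModule.frac (x : N) (n : ℕ) : LocModule h hc N :=
  letI := orePowers (MulOpposite.op h) (commute_op hc)
  OreLocalization.oreDiv x
    (⟨MulOpposite.op h ^ n, n, rfl⟩ : Submonoid.powers (MulOpposite.op h))

end Localization

/-! ### Bimodules, syzygies and periodic algebras -/

section Bimodules

variable (K Λ : Type u) [Field K] [Ring Λ] [Algebra K Λ]

/-- The enveloping algebra `Λ ⊗ Λᵒᵖ`; bimodules are left modules over it, with
`(a ⊗ b) • m = a m b`. -/
abbrev Env : Type u := Λ ⊗[K] Λᵐᵒᵖ

/-- The category of `Λ`-bimodules on which `K` acts centrally. -/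
abbrev Bimod := ModuleCat.{u} (Env K Λ)

/-- `Λ` as a bimodule over itself. -/
def reg : Bimod K Λ :=
  letI : Module (Env K Λ) Λ := TensorProduct.Algebra.module
  ModuleCat.of (Env K Λ) Λ

variable {K Λ}

/-- A submodule `N` of `X` is superfluous if `N + L = X` implies `L = X`. -/
def IsSuperfluous {A X : Type*} [Ring A] [AddCommGroup X] [Module A X]
    (N : Submodule A X) : Prop :=
  ∀ L : Submodule A X, N ⊔ L = ⊤ → L = ⊤

/-- A projective resolution `⋯ → R₁ → R₀ → X → 0` is minimal if, for every `n`, the map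
`Rₙ → coker (Rₙ₊₁ → Rₙ)` is a projective cover. By exactness, this cokernel is `X` for `n = 0` and
the image of `Rₙ → Rₙ₋₁` for `n ≥ 1`. -/
def IsMinimal {X : Bimod K Λ} (R : ProjectiveResolution X) : Prop :=
  ∀ n, IsSuperfluous (LinearMap.ker (R.complex.pOpcycles n).hom)

/-- The `n`-th syzygy `Ωⁿ(X) = coker (Rₙ₊₁ → Rₙ)` of `X` computed by the resolution `R`
(the genuine syzygy, without superfluous projective summands, when `R` is minimal). -/
abbrev syzygy {X : Bimod K Λ} (R : ProjectiveResolution X) (n : ℕ) : Bimod K Λ :=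
  R.complex.opcycles n

variable (K Λ) in
/-- `Λ` is periodic of period `s`: `s` is the least positive integer with `Ωˢ(Λ) ≅ Λ` as
bimodules. -/
def IsPeriodicOfPeriod (s : ℕ) : Prop :=
  IsLeast {m : ℕ | 0 < m ∧ ∃ R : ProjectiveResolution (reg K Λ), IsMinimal R ∧
    Nonempty (syzygy R m ≅ reg K Λ)} s

/-! ### Hochschild cohomology -/

/-- The Hochschild cohomology space `HHⁿ(Λ, M)`, the `Ext` group over the enveloping algebra. -/
abbrev HHn (M : Bimod K Λ) (n : ℕ) : Type u := Abelian.Ext (reg K Λ) M n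

/-- The class `h ∈ HHˢ(Λ)` is represented by an isomorphism `Ωˢ(Λ) ≅ Λ`: it is the class of the
cocycle `Rₛ → Ωˢ(Λ) ≅ Λ` for a minimal projective resolution `R`. -/
def IsRepresentedByIso {s : ℕ} (h : HHn (reg K Λ) s) : Prop :=
  ∃ (R : ProjectiveResolution (reg K Λ)) (_ : IsMinimal R) (φ : syzygy R s ≅ reg K Λ),
    h = R.extMk (R.complex.pOpcycles s ≫ φ.hom) (s + 1) rfl (by simp)

lemma ext_comp_sigma {X Y Z : Bimod K Λ} {i j : ℕ} (a : Abelian.Ext X Y i) (b : Abelian.Ext Y Z j)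
    {k k' : ℕ} (hk : i + j = k) (hk' : i + j = k') :
    (⟨k, a.comp b hk⟩ : Σ n, Abelian.Ext X Z n) = ⟨k', a.comp b hk'⟩ := by
  subst hk
  subst hk'
  rfl

lemma ext_assoc_sigma {X Y Z T : Bimod K Λ} {i j k p q r r' : ℕ} (a : Abelian.Ext X Y i)
    (b : Abelian.Ext Y Z j) (c : Abelian.Ext Z T k) (hp : i + j = p) (hq : j + k = q)
    (hr : p + k = r) (hr' : i + q = r') :
    (⟨r, (a.comp b hp).comp c hr⟩ : Σ n, Abelian.Ext X T n) =
      ⟨r', a.comp (b.comp c hq) hr'⟩ := by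
  obtain rfl : r = r' := by lia
  rw [Abelian.Ext.comp_assoc a b c hp hq (by lia)]

/-- The Yoneda product on `HH^*(Λ)`: the product `a * b` is "first `b`, then `a`". -/
instance : GradedMonoid.GMul (fun n => HHn (reg K Λ) n) where
  mul {i j} a b := b.comp a (Nat.add_comm j i)

instance : GradedMonoid.GOne (fun n => HHn (reg K Λ) n) where
  one := Abelian.Ext.mk₀ (𝟙 _)

instance : GradedMonoid.GMonoid (fun n => HHn (reg K Λ) n) where
  one_mul := fun ⟨i, x⟩ =>
    (ext_comp_sigma x (Abelian.Ext.mk₀ (𝟙 (reg K Λ))) _ (add_zero i)).trans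
      (by rw [Abelian.Ext.comp_mk₀_id])
  mul_one := fun ⟨i, x⟩ =>
    (ext_comp_sigma (Abelian.Ext.mk₀ (𝟙 (reg K Λ))) x _ (zero_add i)).trans
      (by rw [Abelian.Ext.mk₀_id_comp])
  mul_assoc := fun ⟨i, x⟩ ⟨j, y⟩ ⟨k, z⟩ =>
    (ext_assoc_sigma z y x (Nat.add_comm k j) (Nat.add_comm j i) (Nat.add_comm _ _)
      (Nat.add_comm _ _)).symm

lemma HHn_mul {i j : ℕ} (a : HHn (reg K Λ) i) (b : HHn (reg K Λ) j) :
    (GradedMonoid.GMul.mul a b : HHn (reg K Λ) (i + j)) = b.comp a (Nat.add_comm j i) := rfl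

lemma HHn_one : (GradedMonoid.GOne.one : HHn (reg K Λ) 0) = Abelian.Ext.mk₀ (𝟙 _) := rfl

instance : DirectSum.GRing (fun n => HHn (reg K Λ) n) where
  mul_zero a := by simp [HHn_mul]
  zero_mul b := by simp [HHn_mul]
  mul_add a b c := by simp [HHn_mul]
  add_mul a b c := by simp [HHn_mul]
  natCast n := n • (GradedMonoid.GOne.one : HHn (reg K Λ) 0)
  natCast_zero := zero_smul _ _
  natCast_succ n := succ_nsmul _ _
  intCast n := n • (GradedMonoid.GOne.one : HHn (reg K Λ) 0)
  intCast_ofNat n := natCast_zsmul _ _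
  intCast_negSucc_ofNat n := negSucc_zsmul _ _

variable (K Λ) in
/-- The scalars in `HH⁰(Λ)`. -/
def scalarHH : K →+ HHn (reg K Λ) 0 :=
  AddMonoidHom.mk' (fun r => r • Abelian.Ext.mk₀ (𝟙 _)) (fun _ _ => add_smul _ _ _)

lemma scalarHH_apply (r : K) : scalarHH K Λ r = r • Abelian.Ext.mk₀ (𝟙 _) := rfl

lemma scalar_mul_sigma (r : K) {i : ℕ} (x : HHn (reg K Λ) i) :
    (⟨0 + i, GradedMonoid.GMul.mul (scalarHH K Λ r) x⟩ : Σ n, HHn (reg K Λ) n) = ⟨i, r • x⟩ := by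
  rw [HHn_mul, scalarHH_apply]
  refine (ext_comp_sigma _ _ _ (add_zero i)).trans ?_
  rw [Abelian.Ext.comp_smul, Abelian.Ext.comp_mk₀_id]

lemma mul_scalar_sigma (r : K) {i : ℕ} (x : HHn (reg K Λ) i) :
    (⟨i + 0, GradedMonoid.GMul.mul x (scalarHH K Λ r)⟩ : Σ n, HHn (reg K Λ) n) = ⟨i, r • x⟩ := by
  rw [HHn_mul, scalarHH_apply]
  refine (ext_comp_sigma _ _ _ (zero_add i)).trans ?_
  rw [Abelian.Ext.smul_comp, Abelian.Ext.mk₀_id_comp]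

instance : DirectSum.GAlgebra K (fun n => HHn (reg K Λ) n) where
  toFun := scalarHH K Λ
  map_one := one_smul K _
  map_mul r t := ((scalar_mul_sigma r (scalarHH K Λ t)).trans
    (by rw [scalarHH_apply, scalarHH_apply, smul_smul]; rfl)).symm
  commutes := fun r ⟨_, x⟩ => (scalar_mul_sigma r x).trans (mul_scalar_sigma r x).symm
  smul_def := fun r ⟨_, x⟩ => (scalar_mul_sigma r x).symm

variable (K Λ) in
/-- The Hochschild cohomology algebra `HH^*(Λ) = ⨁ₙ HHⁿ(Λ)`. -/
abbrev HH : Type u := ⨁ n : ℕ, HHn (reg K Λ) n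

/-- The right action of `HH^*(Λ)` on `HH^*(Λ, M)` through the Yoneda product: `x a` is
"first `a`, then `x`". -/
instance (M : Bimod K Λ) : GRightModule (fun n => HHn (reg K Λ) n) (fun n => HHn M n) where
  act {i j} := (Abelian.Ext.bilinearComp (reg K Λ) (reg K Λ) M j i (i + j)
    (Nat.add_comm j i)).flip
  act_one {i} x := by
    refine (ext_comp_sigma (Abelian.Ext.mk₀ (𝟙 (reg K Λ))) x (Nat.add_comm 0 i)
      (zero_add i)).trans ?_
    rw [Abelian.Ext.mk₀_id_comp]
  act_mul {i j k} x a b := ext_assoc_sigma b a x (Nat.add_comm k j) (Nat.add_comm j i)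
    (Nat.add_comm _ _) (Nat.add_comm _ _)

/-- The graded space `HH^*(Λ, M) = ⨁ₙ HHⁿ(Λ, M)`. -/
def HHCoef (M : Bimod K Λ) : Type u := ⨁ n : ℕ, HHn M n

instance (M : Bimod K Λ) : AddCommGroup (HHCoef M) :=
  inferInstanceAs (AddCommGroup (⨁ n : ℕ, HHn M n))

/-- `HH^*(Λ, M)` is a right module over `HH^*(Λ)` through the Yoneda product. -/
instance (M : Bimod K Λ) : Module (HH K Λ)ᵐᵒᵖ (HHCoef M) :=
  rightModule (fun n => HHn (reg K Λ) n) (fun n => HHn M n)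

/-- The homogeneous element of degree `n` of `HH^*(Λ, M)` given by `x ∈ HHⁿ(Λ, M)`. -/
def HHCoef.of {M : Bimod K Λ} {n : ℕ} (x : HHn M n) : HHCoef M :=
  DirectSum.of (fun n => HHn M n) n x

/-! ### Stable Hochschild cohomology -/

/-- A complete projective resolution of `X`: an acyclic complex of projectives
`⋯ → P⁻¹ → P⁰ → P¹ → ⋯` together with an isomorphism `Z¹ = ker (P¹ → P²) ≅ X`. -/
structure CompleteResolution (X : Bimod K Λ) where
  complex : CochainComplex (Bimod K Λ) ℤ
  projective : ∀ n, Projective (complex.X n)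
  acyclic : ∀ n, complex.ExactAt n
  iso : complex.cycles 1 ≅ X

variable (P : CompleteResolution (reg K Λ))

/-- The complete resolution as an object of the homotopy category. -/
abbrev CompleteResolution.toHo {X : Bimod K Λ} (P : CompleteResolution X) :
    HomotopyCategory (Bimod K Λ) (ComplexShape.up ℤ) :=
  (HomotopyCategory.quotient _ _).obj P.complex

/-- The stable Hochschild cohomology space of `Λ` in degree `n`, as the `n`-th cohomology of the
endomorphism complex of `P`: homotopy classes of chain maps `P → P[n]`. Composing with the
augmentation `P⁰ → Z¹ ≅ Λ` identifies it with the `n`-th cohomology of `Hom(P, Λ)`; on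
`P → P[n]` the product is visible as composition. -/
abbrev StableHHn (n : ℤ) : Type u := ShiftedHom P.toHo P.toHo n

/-- The stable Hochschild cohomology space in degree `n` with coefficients in `M`: the `n`-th
cohomology of `Hom(P, M)`, i.e. homotopy classes of chain maps from `P` to `M[n]`, where `M` is
viewed as a complex concentrated in degree `0`. -/
abbrev StableHHCoefn (M : Bimod K Λ) (n : ℤ) : Type u :=
  ShiftedHom P.toHo ((HomotopyCategory.singleFunctor (Bimod K Λ) 0).obj M) n

section

variable {X Y Z T : HomotopyCategory (Bimod K Λ) (ComplexShape.up ℤ)}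

lemma ho_comp_sigma {i j : ℤ} (a : ShiftedHom X Y i) (b : ShiftedHom Y Z j)
    {k k' : ℤ} (hk : j + i = k) (hk' : j + i = k') :
    (⟨k, a.comp b hk⟩ : Σ n, ShiftedHom X Z n) = ⟨k', a.comp b hk'⟩ := by
  subst hk
  subst hk'
  rfl

lemma ho_assoc_sigma {i j k p q r r' : ℤ} (a : ShiftedHom X Y i)
    (b : ShiftedHom Y Z j) (c : ShiftedHom Z T k) (hp : j + i = p) (hq : k + j = q)
    (hr : k + p = r) (hr' : q + i = r') :
    (⟨r, (a.comp b hp).comp c hr⟩ : Σ n, ShiftedHom X T n) =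
      ⟨r', a.comp (b.comp c hq) hr'⟩ := by
  obtain rfl : r = r' := by lia
  rw [ShiftedHom.comp_assoc a b c hp hq (by lia)]

end

/-- The product of stable Hochschild cohomology: `a * b` is "first `b`, then `a`". -/
instance : GradedMonoid.GMul (fun n => StableHHn P n) where
  mul a b := ShiftedHom.comp b a rfl

instance : GradedMonoid.GOne (fun n => StableHHn P n) where
  one := ShiftedHom.mk₀ 0 rfl (𝟙 _)

instance : GradedMonoid.GMonoid (fun n => StableHHn P n) where
  one_mul := fun ⟨i, x⟩ =>
    (ho_comp_sigma x (ShiftedHom.mk₀ (0 : ℤ) rfl (𝟙 _)) _ (zero_add i)).trans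
      (by rw [ShiftedHom.comp_mk₀_id])
  mul_one := fun ⟨i, x⟩ =>
    (ho_comp_sigma (ShiftedHom.mk₀ (0 : ℤ) rfl (𝟙 _)) x _ (add_zero i)).trans
      (by rw [ShiftedHom.mk₀_id_comp])
  mul_assoc := fun ⟨_, x⟩ ⟨_, y⟩ ⟨_, z⟩ => (ho_assoc_sigma z y x _ _ _ _).symm

instance : DirectSum.GRing (fun n => StableHHn P n) where
  mul_zero _ := ShiftedHom.zero_comp _ _ _ _
  zero_mul _ := ShiftedHom.comp_zero _ _ _
  mul_add _ _ _ := ShiftedHom.add_comp _ _ _ _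
  add_mul _ _ _ := ShiftedHom.comp_add _ _ _ _
  natCast n := n • (GradedMonoid.GOne.one : StableHHn P 0)
  natCast_zero := zero_smul _ _
  natCast_succ _ := succ_nsmul _ _
  intCast n := n • (GradedMonoid.GOne.one : StableHHn P 0)
  intCast_ofNat _ := natCast_zsmul _ _
  intCast_negSucc_ofNat _ := negSucc_zsmul _ _

/-- The scalars in stable Hochschild cohomology of degree `0`. -/
def scalarStable : K →+ StableHHn P 0 :=
  AddMonoidHom.mk' (fun r => r • ShiftedHom.mk₀ (0 : ℤ) rfl (𝟙 P.toHo)) (fun _ _ => add_smul _ _ _)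

lemma scalarStable_apply (r : K) :
    scalarStable P r = r • ShiftedHom.mk₀ (0 : ℤ) rfl (𝟙 P.toHo) := rfl

lemma scalar_mul_stable_sigma (r : K) {i : ℤ} (x : StableHHn P i) :
    (⟨0 + i, GradedMonoid.GMul.mul (scalarStable P r) x⟩ : Σ n, StableHHn P n) = ⟨i, r • x⟩ := by
  refine (ho_comp_sigma x (scalarStable P r) _ (zero_add i)).trans ?_
  rw [scalarStable_apply, ShiftedHom.comp_smul, ShiftedHom.comp_mk₀_id]

lemma mul_scalar_stable_sigma (r : K) {i : ℤ} (x : StableHHn P i) :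
    (⟨i + 0, GradedMonoid.GMul.mul x (scalarStable P r)⟩ : Σ n, StableHHn P n) = ⟨i, r • x⟩ := by
  refine (ho_comp_sigma (scalarStable P r) x _ (add_zero i)).trans ?_
  rw [scalarStable_apply, ShiftedHom.smul_comp, ShiftedHom.mk₀_id_comp]

instance : DirectSum.GAlgebra K (fun n => StableHHn P n) where
  toFun := scalarStable P
  map_one := one_smul K _
  map_mul r t := ((scalar_mul_stable_sigma P r (scalarStable P t)).trans
    (by rw [scalarStable_apply, scalarStable_apply, smul_smul]; rfl)).symm
  commutes := fun r ⟨_, x⟩ =>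
    (scalar_mul_stable_sigma P r x).trans (mul_scalar_stable_sigma P r x).symm
  smul_def := fun r ⟨_, x⟩ => (scalar_mul_stable_sigma P r x).symm

/-- The stable Hochschild cohomology algebra of `Λ`. -/
abbrev StableHH : Type u := ⨁ n : ℤ, StableHHn P n

/-- Composition `(x, a) ↦ x a` as a biadditive map. -/
def stableAct (M : Bimod K Λ) (i j : ℤ) :
    StableHHCoefn P M i →+ StableHHn P j →+ StableHHCoefn P M (i + j) :=
  AddMonoidHom.flip <| AddMonoidHom.mk' (fun a => AddMonoidHom.mk' (fun x => ShiftedHom.comp a x rfl)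
    (fun _ _ => ShiftedHom.comp_add _ _ _ _))
    (fun a b => AddMonoidHom.ext fun x => ShiftedHom.add_comp a b x rfl)

/-- The right action by composition: `x a` is "first `a`, then `x`". -/
instance (M : Bimod K Λ) : GRightModule (fun n => StableHHn P n)
    (fun n => StableHHCoefn P M n) where
  act {i j} := stableAct P M i j
  act_one {i} x := by
    refine (ho_comp_sigma (ShiftedHom.mk₀ (0 : ℤ) rfl (𝟙 P.toHo)) x _ (add_zero i)).trans ?_
    rw [ShiftedHom.mk₀_id_comp]
  act_mul x a b := ho_assoc_sigma b a x rfl rfl rfl rfl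

/-- The stable Hochschild cohomology of `Λ` with coefficients in `M`. -/
def StableHHCoef (M : Bimod K Λ) : Type u := ⨁ n : ℤ, StableHHCoefn P M n

instance (M : Bimod K Λ) : AddCommGroup (StableHHCoef P M) :=
  inferInstanceAs (AddCommGroup (⨁ n : ℤ, StableHHCoefn P M n))

/-- Stable Hochschild cohomology with coefficients is a right module over the stable Hochschild
cohomology algebra. -/
instance (M : Bimod K Λ) : Module (StableHH P)ᵐᵒᵖ (StableHHCoef P M) :=
  rightModule (fun n => StableHHn P n) (fun n => StableHHCoefn P M n)

/-- The homogeneous element of degree `n` given by `x`. -/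
def StableHHCoef.of {P : CompleteResolution (reg K Λ)} {M : Bimod K Λ} {n : ℤ}
    (x : StableHHCoefn P M n) : StableHHCoef P M :=
  DirectSum.of (fun n => StableHHCoefn P M n) n x

/-! ### Stable Hochschild homology -/

open scoped ModuleCat in
/-- The relations `m (a ⊗ b) ⊗ x = m ⊗ (a ⊗ b) x` defining `M ⊗ X` over the enveloping algebra,
where the bimodule `M` is a right module through `m (a ⊗ b) = b m a`. -/
def balancedRel (M X : Bimod K Λ) : Submodule K (M ⊗[K] X) :=
  Submodule.span K {t | ∃ (a b : Λ) (m : M) (x : X),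
    t = (((b ⊗ₜ MulOpposite.op a : Env K Λ) • m) ⊗ₜ[K] x) -
      m ⊗ₜ[K] ((a ⊗ₜ MulOpposite.op b : Env K Λ) • x)}

open scoped ModuleCat in
lemma balancedRel_le (M : Bimod K Λ) {X Y : Bimod K Λ} (f : X ⟶ Y) :
    balancedRel M X ≤ (balancedRel M Y).comap (LinearMap.lTensor M (f.hom.restrictScalars K)) := by
  refine Submodule.span_le.2 ?_
  rintro _ ⟨a, b, m, x, rfl⟩
  refine Submodule.subset_span ⟨a, b, m, f.hom x, ?_⟩
  simp

open scoped ModuleCat in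
/-- The map `M ⊗ X → M ⊗ Y` over the enveloping algebra induced by `f : X → Y`. -/
def balancedMap (M : Bimod K Λ) {X Y : Bimod K Λ} (f : X ⟶ Y) :
    ((M ⊗[K] X) ⧸ balancedRel M X) →ₗ[K] ((M ⊗[K] Y) ⧸ balancedRel M Y) :=
  Submodule.mapQ _ _ _ (balancedRel_le M f)

open scoped ModuleCat in
/-- The functor `M ⊗ -` over the enveloping algebra, from bimodules to vector spaces. -/
def tensorFunctor (M : Bimod K Λ) : Bimod K Λ ⥤ ModuleCat.{u} K where
  obj X := ModuleCat.of K ((M ⊗[K] X) ⧸ balancedRel M X)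
  map f := ModuleCat.ofHom (balancedMap M f)
  map_id X := by
    refine ModuleCat.hom_ext (Submodule.linearMap_qext _ (TensorProduct.ext' fun m x => ?_))
    rfl
  map_comp f g := by
    refine ModuleCat.hom_ext (Submodule.linearMap_qext _ (TensorProduct.ext' fun m x => ?_))
    rfl

open scoped ModuleCat in
instance (M : Bimod K Λ) : (tensorFunctor M).Additive where
  map_add {X Y f g} := by
    refine ModuleCat.hom_ext (Submodule.linearMap_qext _ (TensorProduct.ext' fun m x => ?_))
    exact congrArg (Submodule.Quotient.mk (p := balancedRel M Y))
      (TensorProduct.tmul_add m (f.hom x) (g.hom x))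

/-- The complex `M ⊗ P` in the homotopy category of vector spaces. -/
abbrev tensorHo (M : Bimod K Λ) : HomotopyCategory (ModuleCat.{u} K) (ComplexShape.up ℤ) :=
  ((tensorFunctor M).mapHomotopyCategory (ComplexShape.up ℤ)).obj P.toHo

/-- The component of degree `n` of the graded space of stable Hochschild homology of `Λ` with
coefficients in `M`: the cohomology `Hⁿ(M ⊗ P)`, i.e. stable Hochschild homology in degree `-n`. -/
abbrev StableHomologyn (M : Bimod K Λ) (n : ℤ) : ModuleCat.{u} K :=
  (HomotopyCategory.homologyFunctor (ModuleCat.{u} K) (ComplexShape.up ℤ) n).obj (tensorHo P M)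

/-- The left action of stable Hochschild cohomology on stable Hochschild homology: a chain map
`b : P → P[j]` induces `Hⁱ(M ⊗ P) → Hⁱ(M ⊗ P[j]) = Hⁱ⁺ʲ(M ⊗ P)`. -/
def homologyLeftAct (M : Bimod K Λ) {i j k : ℤ} (b : StableHHn P j) (v : StableHomologyn P M i)
    (h : j + i = k) : StableHomologyn P M k :=
  ((HomotopyCategory.homologyFunctor (ModuleCat.{u} K) (ComplexShape.up ℤ) 0).shiftMap
    (ShiftedHom.map b ((tensorFunctor M).mapHomotopyCategory (ComplexShape.up ℤ))) i k h).hom v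

/-- The associated right action `v b = (-1) ^ (deg b * deg v) b v`. -/
def homologyRightAct (M : Bimod K Λ) {i j k : ℤ} (v : StableHomologyn P M i) (b : StableHHn P j)
    (h : i + j = k) : StableHomologyn P M k :=
  ((j * i).negOnePow : ℤ) • homologyLeftAct P M b v (by lia)

/-- The right action of stable Hochschild cohomology on stable Hochschild cohomology with
coefficients, by composition. -/
def cohomologyRightAct (M : Bimod K Λ) {i j k : ℤ} (x : StableHHCoefn P M i) (b : StableHHn P j)
    (h : i + j = k) : StableHHCoefn P M k :=
  ShiftedHom.comp b x h

/-! ### Graded isomorphisms -/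

/-- Stable Hochschild cohomology with coefficients in `M` is isomorphic to its shift by `s`, as a
graded right module over stable Hochschild cohomology. -/
def CohomologyShiftIso (M : Bimod K Λ) (s : ℕ) : Prop :=
  ∃ e : ∀ n : ℤ, StableHHCoefn P M n ≃ₗ[K] StableHHCoefn P M (n + s),
    ∀ (i j k : ℤ) (h : i + j = k) (x : StableHHCoefn P M i) (b : StableHHn P j),
      e k (cohomologyRightAct P M x b h) =
        cohomologyRightAct P M (e i x) b (show i + s + j = k + s by lia)

/-- Stable Hochschild homology with coefficients in `M` (with homological degree `-n` placed in
degree `n`) is isomorphic to its shift by `s`, as a graded right module over stable Hochschild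
cohomology. -/
def HomologyShiftIso (M : Bimod K Λ) (s : ℕ) : Prop :=
  ∃ e : ∀ n : ℤ, StableHomologyn P M n ≃ₗ[K] StableHomologyn P M (n + s),
    ∀ (i j k : ℤ) (h : i + j = k) (v : StableHomologyn P M i) (b : StableHHn P j),
      e k (homologyRightAct P M v b h) =
        homologyRightAct P M (e i v) b (show i + s + j = k + s by lia)

variable {s : ℕ} (h : HHn (reg K Λ) s)

/-- The class `h` as a homogeneous element of the ring `HH^*(Λ)`. -/
abbrev homog : HH K Λ := DirectSum.of (fun n => HHn (reg K Λ) n) s h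

variable {h} (hc : ∀ a, Commute (homog h) a)

/-- The homogeneous elements of degree `d` of `HH^*(Λ)_(h)`, with
`deg (a / h ^ n) = deg a - n s`. -/
def locRingDegree (d : ℤ) : Set (LocRing (homog h) hc) :=
  {y | ∃ (i n : ℕ) (a : HHn (reg K Λ) i), (i : ℤ) - n * s = d ∧ y = LocRing.frac hc (homog a) n}

/-- The homogeneous elements of degree `d` of `HH^*(Λ, M)_(h)`, with
`deg (x / h ^ n) = deg x - n s`. -/
def locModuleDegree (M : Bimod K Λ) (d : ℤ) : Set (LocModule (homog h) hc (HHCoef M)) :=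
  {y | ∃ (i n : ℕ) (x : HHn M i), (i : ℤ) - n * s = d ∧
    y = LocModule.frac hc (HHCoef.of x) n}

/-- An algebra isomorphism from `HH^*(Λ)_(h)` to stable Hochschild cohomology is graded. -/
def IsGradedRingIso (Φ : LocRing (homog h) hc ≃ₐ[K] StableHH P) : Prop :=
  ∀ d : ℤ, Φ '' locRingDegree hc d = Set.range (DirectSum.of (fun n => StableHHn P n) d)

/-- An additive bijection from `HH^*(Λ, M)_(h)` to stable Hochschild cohomology with coefficients
in `M` is an isomorphism of graded modules over stable Hochschild cohomology, which acts on
`HH^*(Λ, M)_(h)` through `Φ`. The right action of `HH^*(Λ)_(h)` is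
`(x / h ^ m) (a / h ^ n) = x a / h ^ (m + n)`. -/
def IsGradedModuleIso (Φ : LocRing (homog h) hc ≃ₐ[K] StableHH P) (M : Bimod K Λ)
    (Ψ : LocModule (homog h) hc (HHCoef M) ≃+ StableHHCoef P M) : Prop :=
  (∀ (x : HHCoef M) (a : HH K Λ) (m n : ℕ),
    Ψ (LocModule.frac hc (MulOpposite.op a • x) (m + n)) =
      MulOpposite.op (Φ (LocRing.frac hc a n)) • Ψ (LocModule.frac hc x m)) ∧
  ∀ d : ℤ, Ψ '' locModuleDegree hc M d =
    Set.range (StableHHCoef.of : StableHHCoefn P M d → StableHHCoef P M)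

end Bimodules

end

end HochschildLocalization

/-! Periodicity is used twice. First, it makes every projective bimodule injective. The isomorphism
Ωˢ(Λ) ≅ Λ embeds Λ into the projective bimodule R of degree s - 1 of a resolution, and this
embedding splits over left modules and over right modules, because all syzygies of Λ are projective
on either side. A dual basis of R then turns the image of 1 into Casimir elements for Λ and for Λᵒᵖ.
Their products are Casimir elements for Λᵉ, and averaging over them makes each projective bimodule a
retract of one coinduced from K, hence injective (`HasCasimirSplitting.injective`,
`injective_of_projective_of_iso`). The same isomorphism lets a resolution of Λ be continued to the
right, which gives a complete resolution.

Let P be a complete resolution and let P → P≤0 be the projection onto its part in degrees ≤ 0, a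
projective resolution of Λ. Its fibre is a bounded below complex of injectives, so it receives no
nonzero map from the acyclic complex P. A class in Extⁿ, seen as a map P≤0 → P≤0[n], therefore lifts
uniquely to P → P[n]. This is an algebra map from HH to stable HH, bijective in degrees ≥ 1
(`bijective_stableMap`). With coefficients in M one just precomposes with the projection.

Second, h is, up to isomorphisms, the projection of a projective resolution onto its part in degrees
≤ -s (`trW_extEquivHo`). The fibre is again K-injective, so h becomes a unit in stable HH. An
element of the kernel of the comparison sits in degree 0 and is killed by h; an element of any
degree reaches the bijective range after multiplication by a power of h. These two facts identify
stable HH with the localization, with or without coefficients.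

If h were nilpotent, stable HH would vanish and h with it, but h ≠ 0 by minimality
(`ne_zero_of_isRepresentedByIso`). Centrality follows from graded commutativity
(`graded_commutative`): for odd s one has 2h² = 0, so non-nilpotence forces characteristic 2 and the
signs disappear. The shift isomorphisms are multiplication by this central unit. -/

namespace HochschildLocalization

noncomputable section

/-! ### Brutal truncations and their distinguished triangles -/

section BrutalTruncation

open Limits Pretriangulated ZeroObject

universe w v

variable {C : Type w} [Category.{v} C] [Abelian C]

namespace BrutalTrunc

variable (K : CochainComplex C ℤ) (p : ℤ → Prop) [DecidablePred p]

/-- The objects of a brutal truncation: those of `K` in the degrees satisfying `p`. -/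
def objX (i : ℤ) : C := if p i then K.X i else 0

variable {K p} in
lemma objX_of {i : ℤ} (h : p i) : objX K p i = K.X i := if_pos h

variable {K p} in
lemma isZero_objX {i : ℤ} (h : ¬ p i) : IsZero (objX K p i) := by
  rw [objX, if_neg h]
  exact isZero_zero C

/-- The componentwise inclusion. -/
def inc (i : ℤ) : objX K p i ⟶ K.X i := if h : p i then eqToHom (objX_of h) else 0

/-- The componentwise projection. -/
def prj (i : ℤ) : K.X i ⟶ objX K p i := if h : p i then eqToHom (objX_of h).symm else 0

@[simp]
lemma inc_prj (i : ℤ) : inc K p i ≫ prj K p i = 𝟙 _ := by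
  by_cases h : p i
  · simp [inc, prj, h]
  · exact (isZero_objX h).eq_of_src _ _

variable {K p} in
lemma prj_inc {i : ℤ} (h : p i) : prj K p i ≫ inc K p i = 𝟙 _ := by
  simp [inc, prj, h]

variable {K p} in
lemma prj_inc_assoc {i : ℤ} (h : p i) {Z : C} (f : K.X i ⟶ Z) : prj K p i ≫ inc K p i ≫ f = f := by
  rw [← Category.assoc, prj_inc h, Category.id_comp]

variable {K p} in
lemma inc_of_not {i : ℤ} (h : ¬ p i) : inc K p i = 0 := by simp [inc, h]

variable {K p} in
lemma prj_of_not {i : ℤ} (h : ¬ p i) : prj K p i = 0 := by simp [prj, h]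

/-- The brutal truncation of a cochain complex to the degrees satisfying `p`. -/
def trunc : CochainComplex C ℤ where
  X := objX K p
  d i j := inc K p i ≫ K.d i j ≫ prj K p j
  shape i j h := by rw [K.shape i j h]; simp
  d_comp_d' i j k _ _ := by
    by_cases h : p j
    · simp [prj_inc_assoc h]
    · simp [prj_of_not h]

variable {p}

lemma prj_comp_d (hp : ∀ i, p (i + 1) → p i) (i : ℤ) :
    prj K p i ≫ inc K p i ≫ K.d i (i + 1) ≫ prj K p (i + 1) =
      K.d i (i + 1) ≫ prj K p (i + 1) := by
  by_cases h : p i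
  · rw [prj_inc_assoc h]
  · simp [prj_of_not h, prj_of_not (mt (hp i) h)]

lemma d_comp_inc (hp : ∀ i, p i → p (i + 1)) (i : ℤ) :
    inc K p i ≫ K.d i (i + 1) =
      (inc K p i ≫ K.d i (i + 1) ≫ prj K p (i + 1)) ≫ inc K p (i + 1) := by
  by_cases h : p i
  · simp [prj_inc (hp i h)]
  · simp [inc_of_not h]

/-- The projection onto a brutal truncation to a downward closed set of degrees. -/
def toTrunc (hp : ∀ i, p (i + 1) → p i) : K ⟶ trunc K p where
  f := prj K p
  comm' i j h := by
    obtain rfl : i + 1 = j := h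
    exact prj_comp_d K hp i

/-- The inclusion of a brutal truncation to an upward closed set of degrees. -/
def fromTrunc (hp : ∀ i, p i → p (i + 1)) : trunc K p ⟶ K where
  f := inc K p
  comm' i j h := by
    obtain rfl : i + 1 = j := h
    exact d_comp_inc K hp i

variable (n : ℤ)

/-- The part of `K` in degrees `≤ n`. -/
abbrev le : CochainComplex C ℤ := trunc K (· ≤ n)

/-- The part of `K` in degrees `> n`. -/
abbrev gt : CochainComplex C ℤ := trunc K (fun i => ¬ i ≤ n)

/-- The projection `K ⟶ le K n`. -/
abbrev toLE : K ⟶ le K n := toTrunc K (fun i h => by lia)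

/-- The inclusion `gt K n ⟶ K`. -/
abbrev fromGT : gt K n ⟶ K := fromTrunc K (fun i h => by lia)

instance : (le K n).IsStrictlyLE n := by
  rw [CochainComplex.isStrictlyLE_iff]
  exact fun i hi => isZero_objX (K := K) (p := fun i => i ≤ n) (by lia)

instance : (gt K n).IsStrictlyGE (n + 1) := by
  rw [CochainComplex.isStrictlyGE_iff]
  exact fun i hi => isZero_objX (K := K) (p := fun i => ¬ i ≤ n) (by lia)

lemma injective_trunc_X (p : ℤ → Prop) [DecidablePred p] [∀ i, Injective (K.X i)] (i : ℤ) :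
    Injective ((trunc K p).X i) :=
  Retract.injective (Y := K.X i) ⟨inc K p i, prj K p i, inc_prj K p i⟩

lemma projective_trunc_X (p : ℤ → Prop) [DecidablePred p] [∀ i, Projective (K.X i)] (i : ℤ) :
    Projective ((trunc K p).X i) :=
  Retract.projective (Y := K.X i) ⟨inc K p i, prj K p i, inc_prj K p i⟩

/-- The short complex `gt K n ⟶ K ⟶ le K n`. -/
def shortComplex : ShortComplex (CochainComplex C ℤ) where
  f := fromGT K n
  g := toLE K n
  zero := by
    ext i
    by_cases h : i ≤ n
    · exact (isZero_objX (p := fun i => ¬ i ≤ n) (by simpa using h)).eq_of_src _ _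
    · exact (isZero_objX (p := fun i => i ≤ n) h).eq_of_tgt _ _

/-- The short complex `gt K n ⟶ K ⟶ le K n` is degreewise split. -/
def splitting (i : ℤ) :
    ((shortComplex K n).map (HomologicalComplex.eval C _ i)).Splitting where
  r := prj K (fun i => ¬ i ≤ n) i
  s := inc K (fun i => i ≤ n) i
  f_r := inc_prj K (fun i => ¬ i ≤ n) i
  s_g := inc_prj K (fun i => i ≤ n) i
  id := by
    change prj K (fun i => ¬ i ≤ n) i ≫ inc K (fun i => ¬ i ≤ n) i +
      prj K (fun i => i ≤ n) i ≫ inc K (fun i => i ≤ n) i = 𝟙 _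
    by_cases h : i ≤ n
    · rw [prj_inc (p := fun i => i ≤ n) h, prj_of_not (p := fun i => ¬ i ≤ n) (by simpa using h),
        zero_comp, zero_add]
    · rw [prj_inc (p := fun i => ¬ i ≤ n) h, prj_of_not (p := fun i => i ≤ n) h,
        zero_comp, add_zero]

/-- The distinguished triangle in the homotopy category given by a brutal truncation. -/
abbrev triangle : Triangle (HomotopyCategory C (ComplexShape.up ℤ)) :=
  CochainComplex.trianglehOfDegreewiseSplit (shortComplex K n) (splitting K n)

lemma triangle_distinguished : triangle K n ∈ distTriang _ :=
  (HomotopyCategory.distinguished_iff_iso_trianglehOfDegreewiseSplit _).2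
    ⟨_, _, ⟨Iso.refl _⟩⟩

end BrutalTrunc

end BrutalTruncation

end

end HochschildLocalization

namespace HochschildLocalization

noncomputable section

/-! ### Maps out of acyclic complexes and vanishing for degree reasons -/

section BrutalTruncation

open Limits Pretriangulated ZeroObject

universe w v

variable {C : Type w} [Category.{v} C] [Abelian C]

namespace BrutalTrunc

variable (K : CochainComplex C ℤ) (n : ℤ)

/-- The objects of the homotopy category receiving no nonzero morphism from acyclic complexes. -/
abbrev acyclicOrthogonal (C : Type w) [Category.{v} C] [Abelian C] :
    ObjectProperty (HomotopyCategory C (ComplexShape.up ℤ)) :=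
  (HomotopyCategory.subcategoryAcyclic C).rightOrthogonal

/-- The fibre `gt K n` is a bounded below complex of injectives, hence K-injective. This and the
periodicity class are the two sources of maps inverted by all acyclic complexes. -/
lemma trW_toLE [∀ i, Injective (K.X i)] :
    (acyclicOrthogonal C).trW ((HomotopyCategory.quotient _ _).map (toLE K n)) := by
  rw [ObjectProperty.trW_iff']
  refine ⟨_, _, _, triangle_distinguished K n, ?_⟩
  have := fun i => injective_trunc_X K (fun i => ¬ i ≤ n) i
  have := CochainComplex.isKInjective_of_injective (gt K n) (n + 1)
  exact CochainComplex.IsKInjective.rightOrthogonal (gt K n)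

/-- An acyclic complex is left orthogonal to the right orthogonal of the acyclics, so it sees
neither the fibre nor the shifted fibre of `f`. -/
lemma bijective_comp_of_trW {A : HomotopyCategory C (ComplexShape.up ℤ)}
    (hA : HomotopyCategory.subcategoryAcyclic C A)
    {X Y : HomotopyCategory C (ComplexShape.up ℤ)} {f : X ⟶ Y}
    (hf : (acyclicOrthogonal C).trW f) :
    Function.Bijective (fun g : A ⟶ X => g ≫ f) := by
  have h : (acyclicOrthogonal C).leftOrthogonal A := fun Y g hY => hY g hA
  rw [← ObjectProperty.isColocal_trW] at h
  exact h _ hf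

lemma bijective_comp_shift_toLE [∀ i, Injective (K.X i)]
    {A : HomotopyCategory C (ComplexShape.up ℤ)}
    (hA : HomotopyCategory.subcategoryAcyclic C A) (m : ℤ) :
    Function.Bijective (fun g : ShiftedHom A ((HomotopyCategory.quotient _ _).obj K) m =>
      (g ≫ ((HomotopyCategory.quotient _ _).map (toLE K n))⟦m⟧' :
        ShiftedHom A ((HomotopyCategory.quotient _ _).obj (le K n)) m)) :=
  bijective_comp_of_trW hA ((acyclicOrthogonal C).trW.shift (trW_toLE K n) m)

lemma hom_eq_zero_of_strictly {L M : CochainComplex C ℤ} {a b : ℤ} [L.IsStrictlyGE a]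
    [M.IsStrictlyLE b] (hab : b < a)
    (f : (HomotopyCategory.quotient _ _).obj L ⟶ (HomotopyCategory.quotient _ _).obj M) :
    f = 0 := by
  obtain ⟨f, rfl⟩ := (HomotopyCategory.quotient _ _).map_surjective f
  have : f = 0 := by
    ext i
    by_cases hi : i < a
    · exact (L.isZero_of_isStrictlyGE a i hi).eq_of_src _ _
    · exact (M.isZero_of_isStrictlyLE b i (by lia)).eq_of_tgt _ _
  rw [this, Functor.map_zero]

lemma shiftedHom_eq_zero_of_strictly {L M : CochainComplex C ℤ} {a b m : ℤ} [L.IsStrictlyGE a]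
    [M.IsStrictlyLE b] (hab : b < a + m)
    (f : ShiftedHom ((HomotopyCategory.quotient _ _).obj L)
      ((HomotopyCategory.quotient _ _).obj M) m) :
    f = 0 := by
  have := M.isStrictlyLE_shift b m (b - m) (by lia)
  have h := hom_eq_zero_of_strictly (L := L) (M := M⟦m⟧) (a := a) (b := b - m) (by lia)
    (f ≫ ((HomotopyCategory.quotient C (.up ℤ)).commShiftIso m).inv.app M)
  rw [← cancel_mono (((HomotopyCategory.quotient C (.up ℤ)).commShiftIso m).inv.app M), zero_comp]
  exact h

variable {K n} in
-- `gt K n` lives in degrees ≥ n + 1 and M[m] in degrees ≤ n - m, so the obstruction to factoring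
-- vanishes as soon as m ≥ 0.
lemma exists_toLE_comp_eq {M : CochainComplex C ℤ} {m : ℤ} [M.IsStrictlyLE n] (hm : 0 ≤ m)
    (f : ShiftedHom ((HomotopyCategory.quotient _ _).obj K)
      ((HomotopyCategory.quotient _ _).obj M) m) :
    ∃ g : ShiftedHom ((HomotopyCategory.quotient _ _).obj (le K n))
      ((HomotopyCategory.quotient _ _).obj M) m,
      f = (HomotopyCategory.quotient _ _).map (toLE K n) ≫ g :=
  Triangle.yoneda_exact₂ _ (triangle_distinguished K n) f
    (shiftedHom_eq_zero_of_strictly (L := gt K n) (a := n + 1) (b := n) (by lia) _)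

variable {K n} in
-- The ambiguity comes from the shifted fibre, which already starts in degree n; it vanishes only
-- for m ≥ 1. This is why the comparison with stable cohomology may fail to be injective in degree
-- 0.
lemma toLE_comp_injective {M : CochainComplex C ℤ} {m : ℤ} [M.IsStrictlyLE n] (hm : 1 ≤ m)
    (f g : ShiftedHom ((HomotopyCategory.quotient _ _).obj (le K n))
      ((HomotopyCategory.quotient _ _).obj M) m)
    (h : (HomotopyCategory.quotient _ _).map (toLE K n) ≫ f =
      (HomotopyCategory.quotient _ _).map (toLE K n) ≫ g) : f = g := by
  rw [← sub_eq_zero]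
  obtain ⟨x, hx⟩ := Triangle.yoneda_exact₃ _ (triangle_distinguished K n) (f - g)
    (by
      change (HomotopyCategory.quotient _ _).map (toLE K n) ≫ (f - g) = 0
      rw [Preadditive.comp_sub, h, sub_self])
  have := (gt K n).isStrictlyGE_shift (n + 1) 1 n (by lia)
  have hx0 := shiftedHom_eq_zero_of_strictly (L := (gt K n)⟦(1 : ℤ)⟧) (M := M) (a := n) (b := n)
    (m := m) (by lia) (((HomotopyCategory.quotient C (.up ℤ)).commShiftIso (1 : ℤ)).hom.app _ ≫ x)
  rw [hx, (cancel_epi (((HomotopyCategory.quotient C (.up ℤ)).commShiftIso (1 : ℤ)).hom.app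
    (gt K n))).1 (hx0.trans comp_zero.symm)]
  exact comp_zero

/-- A morphism to a complex concentrated in degree `k` is a quasi-isomorphism if it is an
augmented resolution. -/
lemma quasiIso_of_augmentation {L T : CochainComplex C ℤ} (c : L ⟶ T) (k : ℤ)
    [L.IsStrictlyLE k] (hT : ∀ i, i ≠ k → IsZero (T.X i)) (hL : ∀ i, i < k → L.ExactAt i)
    [Epi (c.f k)] (h0 : L.d (k - 1) k ≫ c.f k = 0)
    (hex : (ShortComplex.mk (L.d (k - 1) k) (c.f k) h0).Exact) : QuasiIso c := by
  rw [quasiIso_iff]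
  intro i
  by_cases hi : i = k
  · subst hi
    rw [quasiIsoAt_iff' _ (i - 1) i (i + 1) (by simp) (by simp),
      ShortComplex.quasiIso_iff_of_zeros']
    · exact ⟨hex, inferInstanceAs (Epi (c.f i))⟩
    · exact (L.isZero_of_isStrictlyLE i (i + 1) (by lia)).eq_of_tgt _ _
    · exact (hT _ (by lia)).eq_of_src _ _
    · exact (hT _ (by lia)).eq_of_tgt _ _
  · have h2 : T.ExactAt i := by
      rw [HomologicalComplex.exactAt_iff]
      exact ShortComplex.exact_of_isZero_X₂ _ (hT i hi)
    rw [quasiIsoAt_iff_exactAt' _ _ h2]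
    rcases lt_or_gt_of_ne hi with hi | hi
    · exact hL i hi
    · rw [HomologicalComplex.exactAt_iff]
      exact ShortComplex.exact_of_isZero_X₂ _ (L.isZero_of_isStrictlyLE k i hi)

/-- In the degrees that are kept, the projection is an isomorphism. -/
def prjIso {p : ℤ → Prop} [DecidablePred p] {i : ℤ} (h : p i) : K.X i ≅ objX K p i where
  hom := prj K p i
  inv := inc K p i
  hom_inv_id := prj_inc h

lemma exactAt_le {i : ℤ} (hi : i < n) (h : K.ExactAt i) : (le K n).ExactAt i := by
  rw [HomologicalComplex.exactAt_iff' _ (i - 1) i (i + 1) (by simp) (by simp)] at h ⊢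
  refine ShortComplex.exact_of_iso ?_ h
  exact ShortComplex.isoMk (prjIso K (p := fun i => i ≤ n) (by lia))
    (prjIso K (p := fun i => i ≤ n) (by lia)) (prjIso K (p := fun i => i ≤ n) (by lia))
    ((toLE K n).comm (i - 1) i) ((toLE K n).comm i (i + 1))

/-- A morphism to a complex concentrated in degree `n` which is an augmented resolution of the
part of `K` in degrees `≤ n`. -/
lemma quasiIso_le_of_augmentation {T : CochainComplex C ℤ} (c : le K n ⟶ T)
    (hT : ∀ i, i ≠ n → IsZero (T.X i)) (hK : ∀ i, i < n → K.ExactAt i)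
    (g : K.X n ⟶ T.X n) (hg : (toLE K n).f n ≫ c.f n = g)
    [Epi g] (h0 : K.d (n - 1) n ≫ g = 0)
    (hex : (ShortComplex.mk (K.d (n - 1) n) g h0).Exact) : QuasiIso c := by
  subst hg
  have : Epi (c.f n) := epi_of_epi ((toLE K n).f n) (c.f n)
  have h1 : (le K n).d (n - 1) n ≫ c.f n = 0 := by
    refine (cancel_epi (prjIso K (p := fun i => i ≤ n) (i := n - 1) (by lia)).hom).1 ?_
    exact ((toLE K n).comm_assoc (n - 1) n (c.f n)).trans (h0.trans comp_zero.symm)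
  refine quasiIso_of_augmentation c n hT (fun i hi => exactAt_le K n hi (hK i hi)) h1 ?_
  refine ShortComplex.exact_of_iso ?_ hex
  exact ShortComplex.isoMk (prjIso K (p := fun i => i ≤ n) (by lia))
    (prjIso K (p := fun i => i ≤ n) (by lia)) (Iso.refl _)
    ((toLE K n).comm (n - 1) n) (Category.comp_id _).symm

end BrutalTrunc

end BrutalTruncation

end

end HochschildLocalization

namespace HochschildLocalization

noncomputable section

/-! ### Ext groups as maps in the homotopy category -/

section ExtHomotopyCategory

open Limits Pretriangulated Abelian

universe w v t t'

variable {C : Type w} [Category.{v} C] [Abelian C]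

/-- The objects of the homotopy category admitting no nonzero morphism to acyclic complexes. -/
abbrev IsKProj (A : HomotopyCategory C (ComplexShape.up ℤ)) : Prop :=
  (HomotopyCategory.subcategoryAcyclic C).leftOrthogonal A

variable {A A' N : HomotopyCategory C (ComplexShape.up ℤ)}

lemma IsKProj.shift (hA : IsKProj A) (n : ℤ) : IsKProj (A⟦n⟧) :=
  (HomotopyCategory.subcategoryAcyclic C).leftOrthogonal.le_shift n _ hA

variable [HasDerivedCategory.{t} C]

lemma IsKProj.bijective_Qh_map (hA : IsKProj A) :
    Function.Bijective (DerivedCategory.Qh.map : (A ⟶ N) → _) :=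
  hA.map_bijective_of_isTriangulated _ _

lemma IsKProj.bijective_shiftedHom_map (hA : IsKProj A) (n : ℤ) :
    Function.Bijective (fun f : ShiftedHom A N n => f.map DerivedCategory.Qh) := by
  have h : Function.Bijective
      (fun f : DerivedCategory.Qh.obj A ⟶ DerivedCategory.Qh.obj (N⟦n⟧) =>
        f ≫ (DerivedCategory.Qh.commShiftIso n).hom.app N) :=
    ⟨fun f g h => (cancel_mono _).1 h,
      fun f => ⟨f ≫ (DerivedCategory.Qh.commShiftIso n).inv.app N, by simp⟩⟩
  exact h.comp (hA.bijective_Qh_map (N := N⟦n⟧))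

/-- Shifted morphisms out of a K-projective complex are the same in the homotopy and in the
derived category. -/
def IsKProj.shiftedHomEquiv (hA : IsKProj A) (n : ℤ) :
    ShiftedHom A N n ≃+
      ShiftedHom (DerivedCategory.Qh.obj A) (DerivedCategory.Qh.obj N) n :=
  AddEquiv.ofBijective (AddMonoidHom.mk' (fun f => f.map DerivedCategory.Qh)
    (fun f g => ShiftedHom.map_add f g _)) (hA.bijective_shiftedHom_map n)

/-- The derived and the homotopy category have the same complexes concentrated in degree `0`. -/
def singleIso (M : C) :
    DerivedCategory.Qh.obj ((HomotopyCategory.singleFunctor C 0).obj M) ≅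
      (DerivedCategory.singleFunctor C 0).obj M := Iso.refl _

variable [HasExt.{t'} C]

section

variable {X Y Z : C} (hA : IsKProj A) (hA' : IsKProj A')
  (d : DerivedCategory.Qh.obj A ≅ (DerivedCategory.singleFunctor C 0).obj X)
  (d' : DerivedCategory.Qh.obj A' ≅ (DerivedCategory.singleFunctor C 0).obj Y)
  (e : DerivedCategory.Qh.obj N ≅ (DerivedCategory.singleFunctor C 0).obj Z)

/-- Conjugation of shifted morphisms by isomorphisms. -/
def conjEquiv {D : Type*} [Category* D] [Preadditive D] [HasShift D ℤ]
    [∀ n : ℤ, (shiftFunctor D n).Additive] {X X' Y Y' : D}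
    (d : X ≅ X') (e : Y ≅ Y') (n : ℤ) : ShiftedHom X' Y' n ≃+ ShiftedHom X Y n where
  toFun x := d.hom ≫ x ≫ e.inv⟦n⟧'
  invFun x := d.inv ≫ x ≫ e.hom⟦n⟧'
  left_inv x := by simp [← Functor.map_comp]
  right_inv x := by simp [← Functor.map_comp]
  map_add' x y := by simp

lemma conjEquiv_apply {D : Type*} [Category* D] [Preadditive D] [HasShift D ℤ]
    [∀ n : ℤ, (shiftFunctor D n).Additive] {X X' Y Y' : D}
    (d : X ≅ X') (e : Y ≅ Y') (n : ℤ) (x : ShiftedHom X' Y' n) :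
    conjEquiv d e n x = d.hom ≫ x ≫ e.inv⟦n⟧' := rfl

lemma conjEquiv_comp {D : Type*} [Category* D] [Preadditive D] [HasShift D ℤ]
    [∀ n : ℤ, (shiftFunctor D n).Additive] {X X' Y Y' Z Z' : D}
    (d : X ≅ X') (d' : Y ≅ Y') (e : Z ≅ Z') {i j k : ℤ} (a : ShiftedHom X' Y' i)
    (b : ShiftedHom Y' Z' j) (h : j + i = k) :
    conjEquiv d e k (a.comp b h) = (conjEquiv d d' i a).comp (conjEquiv d' e j b) h := by
  simp only [conjEquiv_apply, ShiftedHom.comp, Category.assoc, Functor.map_comp]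
  rw [← Functor.map_comp_assoc _ d'.inv, Iso.inv_hom_id, CategoryTheory.Functor.map_id,
    Category.id_comp, ← NatTrans.naturality]
  rfl

lemma conjEquiv_mk₀ {D : Type*} [Category* D] [Preadditive D] [HasShift D ℤ]
    [∀ n : ℤ, (shiftFunctor D n).Additive] {X X' Y Y' : D}
    (d : X ≅ X') (e : Y ≅ Y') (m : ℤ) (hm : m = 0) (f : X' ⟶ Y') :
    conjEquiv d e m (ShiftedHom.mk₀ m hm f) = ShiftedHom.mk₀ m hm (d.hom ≫ f ≫ e.inv) := by
  rw [conjEquiv_apply, ShiftedHom.mk₀, ShiftedHom.mk₀, Category.assoc, Category.assoc,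
    Category.assoc, ← NatTrans.naturality]
  rfl

/-- `Ext` groups as shifted morphisms in the homotopy category. -/
def extEquivHo (n : ℕ) : Ext X Z n ≃+ ShiftedHom A N (n : ℤ) :=
  Ext.homAddEquiv.trans ((conjEquiv d e n).trans (hA.shiftedHomEquiv n).symm)

lemma extEquivHo_map {n : ℕ} (x : Ext X Z n) :
    (extEquivHo hA d e n x).map DerivedCategory.Qh = conjEquiv d e n x.hom :=
  (hA.shiftedHomEquiv n).apply_symm_apply _

/-- Only the sources A and A' must be K-projective: equality of maps out of A may be tested in the
derived category, where both sides are Yoneda products. -/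
lemma extEquivHo_comp {i j k : ℕ} (a : Ext X Y i) (b : Ext Y Z j) (h : i + j = k)
    (h' : (j : ℤ) + i = k) :
    extEquivHo hA d e k (a.comp b h) =
      (extEquivHo hA d d' i a).comp (extEquivHo hA' d' e j b) h' := by
  apply (hA.bijective_shiftedHom_map _).1
  simp only [extEquivHo_map, ShiftedHom.map_comp, Ext.comp_hom]
  exact conjEquiv_comp d d' e _ _ h'

lemma extEquivHo_mk₀ (f : X ⟶ Z) (g : A ⟶ N)
    (hg : DerivedCategory.Qh.map g =
      d.hom ≫ (DerivedCategory.singleFunctor C 0).map f ≫ e.inv) :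
    extEquivHo hA d e 0 (Ext.mk₀ f) = ShiftedHom.mk₀ ((0 : ℕ) : ℤ) rfl g := by
  apply (hA.bijective_shiftedHom_map _).1
  simp only [extEquivHo_map, Ext.mk₀_hom]
  rw [ShiftedHom.map_mk₀, hg]
  exact conjEquiv_mk₀ _ _ _ _ _

end

end ExtHomotopyCategory

end

end HochschildLocalization

namespace HochschildLocalization

noncomputable section

/-! ### The comparison map from Hochschild to stable Hochschild cohomology -/

section StableComparison

open Limits Pretriangulated Abelian BrutalTrunc

universe t

variable {K Λ : Type u} [Field K] [Ring Λ] [Algebra K Λ]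

namespace CompleteResolution

section

variable {X : Bimod K Λ} (P : CompleteResolution X)

/-- The projective resolution given by the part of a complete resolution in degrees `≤ 0`. -/
abbrev res : HomotopyCategory (Bimod K Λ) (ComplexShape.up ℤ) :=
  (HomotopyCategory.quotient _ _).obj (le P.complex 0)

/-- The projection from a complete resolution to a projective resolution. -/
abbrev toRes : P.toHo ⟶ P.res :=
  (HomotopyCategory.quotient _ _).map (toLE P.complex 0)

lemma toHo_acyclic : HomotopyCategory.subcategoryAcyclic _ P.toHo := by
  rw [HomotopyCategory.quotient_obj_mem_subcategoryAcyclic_iff_acyclic]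
  exact P.acyclic

lemma isKProj_res : IsKProj P.res := by
  have := P.projective
  have := fun i => projective_trunc_X P.complex (fun i => i ≤ 0) i
  have := CochainComplex.isKProjective_of_projective (le P.complex 0) 0
  exact CochainComplex.IsKProjective.leftOrthogonal _

/-- The augmentation `P⁰ ⟶ X`. -/
def aug : P.complex.X 0 ⟶ X := P.complex.toCycles 0 1 ≫ P.iso.hom

lemma epi_toCycles : Epi (P.complex.toCycles 0 1) := by
  have h := P.acyclic 1
  rw [HomologicalComplex.exactAt_iff_isZero_homology] at h
  exact Preadditive.epi_of_isZero_cokernel' _ (P.complex.homologyIsCokernel 0 1 (by simp)) h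

instance : Epi P.aug :=
  have := P.epi_toCycles
  epi_comp _ _

@[simp]
lemma d_aug (i : ℤ) : P.complex.d i 0 ≫ P.aug = 0 := by
  simp [aug]

/-- X ≅ Z¹ embeds into P¹, so the augmentation has the same kernel as P⁰ → P¹. -/
lemma exact_aug : (ShortComplex.mk (P.complex.d (0 - 1) 0) P.aug (P.d_aug _)).Exact := by
  have := P.acyclic 0
  rw [HomologicalComplex.exactAt_iff' _ (0 - 1) 0 1 (by simp) (by simp)] at this
  let φ : ShortComplex.mk (P.complex.d (0 - 1) 0) P.aug (P.d_aug _) ⟶ P.complex.sc' (0 - 1) 0 1 :=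
    { τ₁ := 𝟙 _
      τ₂ := 𝟙 _
      τ₃ := P.iso.inv ≫ P.complex.iCycles 1
      comm₂₃ := by
        change 𝟙 _ ≫ P.complex.d 0 1 = P.aug ≫ P.iso.inv ≫ P.complex.iCycles 1
        simp [aug] }
  have : Epi φ.τ₁ := inferInstanceAs (Epi (𝟙 _))
  have : IsIso φ.τ₂ := inferInstanceAs (IsIso (𝟙 _))
  have : Mono φ.τ₃ := inferInstanceAs (Mono (P.iso.inv ≫ P.complex.iCycles 1))
  rwa [ShortComplex.exact_iff_of_epi_of_isIso_of_mono φ]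

/-- The augmentation of the projective resolution `P.res`, as a morphism of complexes. -/
def augHom : le P.complex 0 ⟶ (CochainComplex.singleFunctor (Bimod K Λ) 0).obj X :=
  HomologicalComplex.mkHomToSingle
    (show (le P.complex 0).X 0 ⟶ X from inc P.complex (fun i => i ≤ 0) 0 ≫ P.aug) (fun i hi => by
    obtain rfl : i = -1 := by
      have : i + 1 = 0 := hi
      lia
    change (inc P.complex (fun i => i ≤ 0) (-1) ≫ P.complex.d (-1) 0 ≫
      prj P.complex (fun i => i ≤ 0) 0) ≫ inc P.complex (fun i => i ≤ 0) 0 ≫ P.aug = 0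
    simp [prj_inc_assoc])

/-- The component of degree `0` of a complex concentrated in degree `0`. -/
def singleX (X : Bimod K Λ) : X ≅ ((CochainComplex.singleFunctor (Bimod K Λ) 0).obj X).X 0 :=
  (HomologicalComplex.singleObjXSelf (ComplexShape.up ℤ) 0 X).symm

/-- The augmentation, with values in the complex concentrated in degree `0`. -/
def augX : P.complex.X 0 ⟶ ((CochainComplex.singleFunctor (Bimod K Λ) 0).obj X).X 0 :=
  P.aug ≫ (singleX X).hom

instance : Epi P.augX := epi_comp _ _

lemma augHom_f : (toLE P.complex 0).f 0 ≫ P.augHom.f 0 = P.augX := by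
  rw [augHom, HomologicalComplex.mkHomToSingle_f]
  exact prj_inc_assoc (K := P.complex) (p := fun i => i ≤ 0) le_rfl (P.aug ≫ (singleX X).hom)

lemma d_augX : P.complex.d (0 - 1) 0 ≫ P.augX = 0 := by
  rw [augX, reassoc_of% P.d_aug, zero_comp]

instance : QuasiIso P.augHom := by
  refine quasiIso_le_of_augmentation P.complex 0 P.augHom
    (fun i hi => HomologicalComplex.isZero_single_obj_X _ _ _ _ hi) (fun i _ => P.acyclic i)
    P.augX P.augHom_f P.d_augX ?_
  refine ShortComplex.exact_of_iso ?_ P.exact_aug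
  exact ShortComplex.isoMk (Iso.refl _) (Iso.refl _) (singleX X) (by simp)
    (Category.id_comp _)

variable [HasDerivedCategory.{t} (Bimod K Λ)]

/-- In the derived category, `P.res` is isomorphic to `X`. -/
def resIso : DerivedCategory.Qh.obj P.res ≅
    (DerivedCategory.singleFunctor (Bimod K Λ) 0).obj X :=
  (DerivedCategory.quotientCompQhIso _).app _ ≪≫ asIso (DerivedCategory.Q.map P.augHom) ≪≫
    ((DerivedCategory.singleFunctorIsoCompQ _ 0).symm.app X)

end

variable (P : CompleteResolution (reg K Λ)) 

/-- Postcomposition with `P.toRes`. -/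
def postRes (m : ℤ) : StableHHn P m →+ ShiftedHom P.toHo P.res m :=
  AddMonoidHom.mk' (fun f : StableHHn P m => ShiftedHom.comp f (ShiftedHom.mk₀ (0 : ℤ) rfl P.toRes) (zero_add m))
    (fun _ _ => ShiftedHom.add_comp _ _ _ _)

/-- P is acyclic and the fibre of `toRes` is K-injective. Lifts along `toRes` thus exist and are
unique, which defines `stableMap`. -/
lemma bijective_postRes [∀ i, Injective (P.complex.X i)] (m : ℤ) :
    Function.Bijective (P.postRes m) := by
  convert! bijective_comp_shift_toLE P.complex 0 P.toHo_acyclic m using 2 with f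
  exact ShiftedHom.comp_mk₀ (f : ShiftedHom P.toHo P.toHo m) 0 rfl P.toRes

variable [HasDerivedCategory.{t} (Bimod K Λ)]

/-- The comparison map from Hochschild cohomology to stable Hochschild cohomology. -/
def stableMap [∀ i, Injective (P.complex.X i)] (n : ℕ) : HHn (reg K Λ) n →+ StableHHn P n :=
  ((AddEquiv.ofBijective _ (P.bijective_postRes n)).symm : _ →+ _).comp
    (AddMonoidHom.mk' (fun x => (ShiftedHom.mk₀ 0 rfl P.toRes).comp
        (extEquivHo P.isKProj_res P.resIso P.resIso n x) (add_zero _))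
      (fun x y => by rw [map_add, ShiftedHom.comp_add]))

/-- The commutative square with `toRes` on both sides that characterizes `stableMap`. -/
lemma postRes_stableMap [∀ i, Injective (P.complex.X i)] {n : ℕ} (x : HHn (reg K Λ) n) :
    (P.stableMap n x).comp (ShiftedHom.mk₀ 0 rfl P.toRes) (zero_add _) =
      (ShiftedHom.mk₀ 0 rfl P.toRes).comp
        (extEquivHo P.isKProj_res P.resIso P.resIso n x) (add_zero _) :=
  (AddEquiv.ofBijective _ (P.bijective_postRes n)).apply_symm_apply _

/-- The comparison map with coefficients. -/
def stableCoefMap (M : Bimod K Λ) (n : ℕ) : HHn M n →+ StableHHCoefn P M n :=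
  AddMonoidHom.mk' (fun x => (ShiftedHom.mk₀ 0 rfl P.toRes).comp
        (extEquivHo P.isKProj_res P.resIso (singleIso M) n x) (add_zero _))
      (fun x y => by rw [map_add, ShiftedHom.comp_add])

lemma stableCoefMap_apply {M : Bimod K Λ} {n : ℕ} (x : HHn M n) :
    P.stableCoefMap M n x = (ShiftedHom.mk₀ 0 rfl P.toRes).comp
        (extEquivHo P.isKProj_res P.resIso (singleIso M) n x) (add_zero _) := rfl

section

variable [∀ i, Injective (P.complex.X i)]

/-- Paste the two defining squares and use uniqueness of the lift. -/
lemma stableMap_comp {i j k : ℕ} (a : HHn (reg K Λ) i) (b : HHn (reg K Λ) j) (h : i + j = k)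
    (h' : (j : ℤ) + i = k) :
    P.stableMap k (a.comp b h) = (P.stableMap i a).comp (P.stableMap j b) h' := by
  apply (P.bijective_postRes k).1
  change (P.stableMap k (a.comp b h)).comp (ShiftedHom.mk₀ 0 rfl P.toRes) (zero_add _) =
    ((P.stableMap i a).comp (P.stableMap j b) h').comp (ShiftedHom.mk₀ 0 rfl P.toRes) (zero_add _)
  rw [postRes_stableMap, ShiftedHom.comp_assoc _ _ _ h' (zero_add _) (by lia), postRes_stableMap,
    ← ShiftedHom.comp_assoc _ _ _ (zero_add _) (add_zero _) (by lia), postRes_stableMap,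
    ShiftedHom.comp_assoc _ _ _ (add_zero _) h' (by lia),
    extEquivHo_comp _ P.isKProj_res _ P.resIso _ _ _ h h']

lemma stableCoefMap_comp {M : Bimod K Λ} {i j k : ℕ} (a : HHn (reg K Λ) i) (b : HHn M j)
    (h : i + j = k) (h' : (j : ℤ) + i = k) :
    P.stableCoefMap M k (a.comp b h) = (P.stableMap i a).comp (P.stableCoefMap M j b) h' := by
  rw [stableCoefMap_apply, stableCoefMap_apply,
    ← ShiftedHom.comp_assoc _ _ _ (zero_add _) (add_zero _) (by lia), postRes_stableMap,
    ShiftedHom.comp_assoc _ _ _ (add_zero _) h' (by lia),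
    extEquivHo_comp _ P.isKProj_res _ P.resIso _ _ _ h h']

lemma stableMap_smul_one (r : K) :
    P.stableMap 0 (r • Ext.mk₀ (𝟙 _)) =
      r • (ShiftedHom.mk₀ ((0 : ℕ) : ℤ) rfl (𝟙 P.toHo) : StableHHn P _) := by
  apply (P.bijective_postRes _).1
  refine (P.postRes_stableMap _).trans ?_
  change _ = (r • (ShiftedHom.mk₀ ((0 : ℕ) : ℤ) rfl (𝟙 P.toHo) : StableHHn P _)).comp
    (ShiftedHom.mk₀ 0 rfl P.toRes) (zero_add _)
  rw [ShiftedHom.smul_comp, ShiftedHom.mk₀_comp_mk₀, ← Ext.mk₀_smul,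
    extEquivHo_mk₀ _ _ _ _ (r • 𝟙 _), ShiftedHom.mk₀_comp_mk₀]
  · simp
  · rw [Functor.map_smul, Functor.map_smul]
    simp

end

omit [HasDerivedCategory.{t} (Bimod K Λ)] in
-- The fibre of `toRes` lies in degrees ≥ 1 and its shift in degrees ≥ 0, above M[m] when m ≥ 1.
lemma bijective_toRes_comp {M : CochainComplex (Bimod K Λ) ℤ} [M.IsStrictlyLE 0] {m : ℤ}
    (hm : 1 ≤ m) : Function.Bijective
      (fun f : ShiftedHom P.res ((HomotopyCategory.quotient _ _).obj M) m =>
        (ShiftedHom.mk₀ 0 rfl P.toRes).comp f (add_zero m)) := by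
  simp only [ShiftedHom.mk₀_comp]
  refine ⟨fun f g h => toLE_comp_injective hm f g h, fun f => ?_⟩
  obtain ⟨g, hg⟩ := exists_toLE_comp_eq (n := 0) (zero_le_one.trans hm) f
  exact ⟨g, hg.symm⟩

lemma bijective_stableMap [∀ i, Injective (P.complex.X i)] {n : ℕ} (hn : 1 ≤ n) :
    Function.Bijective (P.stableMap n) :=
  (AddEquiv.ofBijective _ (P.bijective_postRes n)).symm.bijective.comp <|
    ((P.bijective_toRes_comp (M := le P.complex 0) (m := n) (by lia)).comp
      (extEquivHo P.isKProj_res P.resIso P.resIso n).bijective)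

/-- The target M is not replaced by a complete complex, so no lift along `toRes`, and hence no
injectivity, enters. -/
lemma bijective_stableCoefMap (M : Bimod K Λ) {n : ℕ} (hn : 1 ≤ n) :
    Function.Bijective (P.stableCoefMap M n) :=
  (P.bijective_toRes_comp (M := (CochainComplex.singleFunctor (Bimod K Λ) 0).obj M)
    (m := n) (by lia)).comp
      (extEquivHo P.isKProj_res P.resIso (singleIso M) n).bijective

end CompleteResolution

end StableComparison

end

end HochschildLocalization

namespace HochschildLocalization

noncomputable section

/-! ### The periodicity class as a brutal truncation of a resolution -/

section PeriodicityClass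

open Limits Pretriangulated Abelian BrutalTrunc CochainComplex.HomComplex

universe w v t t'

variable {C : Type w} [Category.{v} C] [Abelian C]

namespace BrutalTrunc

/-- A morphism to a complex concentrated in degree `n` factors through the part in
degrees `≤ n`. -/
def descLE (K : CochainComplex C ℤ) (n : ℤ) {T : CochainComplex C ℤ} (c : K ⟶ T)
    (hT : ∀ i, i ≠ n → IsZero (T.X i)) : le K n ⟶ T where
  f i := inc K (fun i => i ≤ n) i ≫ c.f i
  comm' i j h := by
    obtain rfl : i + 1 = j := h
    by_cases hi : i + 1 = n
    · change (inc K (fun i => i ≤ n) i ≫ c.f i) ≫ T.d i (i + 1) =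
        (inc K (fun i => i ≤ n) i ≫ K.d i (i + 1) ≫ prj K (fun i => i ≤ n) (i + 1)) ≫
          inc K (fun i => i ≤ n) (i + 1) ≫ c.f (i + 1)
      simp only [Category.assoc]
      rw [prj_inc_assoc (p := fun i => i ≤ n) hi.le, c.comm]
    · exact (hT _ hi).eq_of_tgt _ _

@[simp]
lemma toLE_descLE (K : CochainComplex C ℤ) (n : ℤ) {T : CochainComplex C ℤ} (c : K ⟶ T)
    (hT : ∀ i, i ≠ n → IsZero (T.X i)) : toLE K n ≫ descLE K n c hT = c := by
  ext i
  by_cases hi : i ≤ n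
  · exact prj_inc_assoc (p := fun i => i ≤ n) hi (c.f i)
  · exact (hT _ (by lia)).eq_of_tgt _ _

lemma isKProj_le (K : CochainComplex C ℤ) (n : ℤ) [∀ i, Projective (K.X i)] :
    IsKProj ((HomotopyCategory.quotient _ _).obj (le K n)) := by
  have := fun i => projective_trunc_X K (fun i => i ≤ n) i
  have := CochainComplex.isKProjective_of_projective (le K n) n
  exact CochainComplex.IsKProjective.leftOrthogonal _

end BrutalTrunc

lemma isKProj_projRes {X : C} (R : ProjectiveResolution X) :
    IsKProj ((HomotopyCategory.quotient _ _).obj R.cochainComplex) :=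
  CochainComplex.IsKProjective.leftOrthogonal _

lemma exactAt_cochainComplex {X : C} (R : ProjectiveResolution X) {i : ℤ} (hi : i < 0) :
    R.cochainComplex.ExactAt i := by
  rw [exactAt_iff_of_quasiIsoAt R.π' i]
  exact HomologicalComplex.exactAt_single_obj _ _ _ _ hi.ne

variable [HasDerivedCategory.{t} C]

section

variable {A A' N N' : HomotopyCategory C (ComplexShape.up ℤ)}

lemma IsKProj.bijective_comp (hA : IsKProj A) (f : N ⟶ N') [IsIso (DerivedCategory.Qh.map f)] :
    Function.Bijective (fun g : A ⟶ N => g ≫ f) := by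
  rw [← Function.Bijective.of_comp_iff' hA.bijective_Qh_map]
  have hf : Function.Bijective
      (fun g : DerivedCategory.Qh.obj A ⟶ DerivedCategory.Qh.obj N => g ≫ DerivedCategory.Qh.map f) :=
    ⟨fun g g' h => (cancel_mono _).1 h, fun g => ⟨g ≫ inv (DerivedCategory.Qh.map f), by simp⟩⟩
  convert! hf.comp
    (hA.bijective_Qh_map (N := N)) using 1
  funext g
  exact DerivedCategory.Qh.map_comp g f

/-- Between K-projective complexes, a quasi-isomorphism is a homotopy equivalence: lift the identity
of A' through `f`, then cancel `f`. -/
lemma IsKProj.isIso (hA : IsKProj A) (hA' : IsKProj A') (f : A ⟶ A')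
    [IsIso (DerivedCategory.Qh.map f)] : IsIso f := by
  obtain ⟨g, hg⟩ := (hA'.bijective_comp f).2 (𝟙 A')
  refine ⟨g, (hA.bijective_comp f).1 ?_, hg⟩
  change (f ≫ g) ≫ f = 𝟙 A ≫ f
  rw [Category.assoc, show g ≫ f = 𝟙 A' from hg]
  simp

end

lemma isIso_Qh_map_shift {N N' : HomotopyCategory C (ComplexShape.up ℤ)} (f : N ⟶ N')
    [IsIso (DerivedCategory.Qh.map f)] (n : ℤ) : IsIso (DerivedCategory.Qh.map (f⟦n⟧')) :=
  (NatIso.isIso_map_iff (DerivedCategory.Qh.commShiftIso (C := HomotopyCategory C (.up ℤ)) n) f).2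
    (inferInstanceAs (IsIso ((DerivedCategory.Qh.map f)⟦n⟧')))

variable {X : C} (R : ProjectiveResolution X)

/-- The derived and the homotopy category have the same complexes concentrated in degree `0`. -/
def quotientSingleIso (Y : C) :
    DerivedCategory.Qh.obj
        ((HomotopyCategory.quotient _ _).obj ((CochainComplex.singleFunctor C 0).obj Y)) ≅
      (DerivedCategory.singleFunctor C 0).obj Y :=
  (DerivedCategory.quotientCompQhIso C).app _ ≪≫
    (DerivedCategory.singleFunctorIsoCompQ C 0).symm.app Y

/-- A projective resolution as an object of the derived category. -/
def projResIso : DerivedCategory.Qh.obj ((HomotopyCategory.quotient _ _).obj R.cochainComplex) ≅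
    (DerivedCategory.singleFunctor C 0).obj X :=
  (DerivedCategory.quotientCompQhIso _).app _ ≪≫ asIso (DerivedCategory.Q.map R.π') ≪≫
    ((DerivedCategory.singleFunctorIsoCompQ _ 0).symm.app X)

/-- The chain map to a shifted complex concentrated in degree `0` given by a cocycle. -/
def cocycleHom {s : ℕ} {Y : C} (f : R.complex.X s ⟶ Y) (hf : R.complex.d (s + 1) s ≫ f = 0) :
    R.cochainComplex ⟶ ((CochainComplex.singleFunctor C 0).obj Y)⟦(s : ℤ)⟧ :=
  Cocycle.equivHomShift.symm
    (Cocycle.toSingleMk ((R.cochainComplexXIso (-s) s rfl).hom ≫ f) (by simp) (-(s + 1 : ℕ))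
      (by lia) (by rw [R.cochainComplex_d _ _ (s + 1) s rfl rfl]; simp [hf]))

omit [HasDerivedCategory.{t} C] in
-- Exactness arguments need the component in degree -s only up to an isomorphism of its target, so
-- the identifications made by the shift are hidden in `e`.
lemma exists_cocycleHom_f {s : ℕ} {Y : C} (f : R.complex.X s ⟶ Y)
    (hf : R.complex.d (s + 1) s ≫ f = 0) :
    ∃ e : Y ≅ (((CochainComplex.singleFunctor C 0).obj Y)⟦(s : ℤ)⟧).X (-s),
      (cocycleHom R f hf).f (-s) = (R.cochainComplexXIso (-s) s rfl).hom ≫ f ≫ e.hom := by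
  let e : Y ≅ ((CochainComplex.singleFunctor C 0).obj Y).X 0 :=
    (HomologicalComplex.singleObjXSelf (.up ℤ) 0 Y).symm
  refine ⟨e ≪≫ (((CochainComplex.singleFunctor C 0).obj Y).shiftFunctorObjXIso
    (s : ℤ) (-s) 0 (by simp)).symm, ?_⟩
  rw [cocycleHom, Cocycle.equivHomShift_symm_apply, Cocycle.homOf_f, Cocycle.rightShift_coe,
    Cochain.rightShift_v _ _ _ _ _ _ _ 0 (by simp), Cocycle.toSingleMk_coe,
    Cochain.toSingleMk_v]
  change (((R.cochainComplexXIso (-s) s rfl).hom ≫ f) ≫ e.hom) ≫ _ =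
    (R.cochainComplexXIso (-s) s rfl).hom ≫ f ≫ e.hom ≫ _
  simp only [Category.assoc]
  rfl

variable [HasExt.{t'} C]

/-- The link between the class of a cocycle, defined by a roof in the derived category, and an
honest chain map R → Y[s]. -/
lemma extEquivHo_extMk {s : ℕ} {Y : C} (f : R.complex.X s ⟶ Y)
    (hf : R.complex.d (s + 1) s ≫ f = 0) :
    extEquivHo (isKProj_projRes R)
      (projResIso R) (quotientSingleIso Y) s (R.extMk f (s + 1) rfl hf) =
    ShiftedHom.map (cocycleHom R f hf) (HomotopyCategory.quotient _ _) := by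
  apply ((isKProj_projRes R).bijective_shiftedHom_map _).1
  beta_reduce
  rw [extEquivHo_map, ← ShiftedHom.comp_map]
  have := ShiftedHom.map_naturality_2 (cocycleHom R f hf) (DerivedCategory.quotientCompQhIso C)
  rw [← this, conjEquiv_apply, ProjectiveResolution.extMk_hom]
  simp only [ShiftedHom.mk₀_comp, ShiftedHom.comp_mk₀]
  change ((DerivedCategory.quotientCompQhIso C).hom.app _ ≫ DerivedCategory.Q.map R.π' ≫
    (DerivedCategory.singleFunctorIsoCompQ _ 0).inv.app X) ≫
    (((DerivedCategory.singleFunctorIsoCompQ C 0).hom.app X ≫ inv (DerivedCategory.Q.map R.π')) ≫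
      ShiftedHom.map (cocycleHom R f hf) DerivedCategory.Q ≫
      ((DerivedCategory.singleFunctorIsoCompQ C 0).inv.app Y)⟦(s : ℤ)⟧') ≫
    (((DerivedCategory.singleFunctorIsoCompQ C 0).hom.app Y ≫
      (DerivedCategory.quotientCompQhIso C).inv.app _))⟦(s : ℤ)⟧' = _
  simp only [Category.assoc, Functor.map_comp]
  rw [Iso.inv_hom_id_app_assoc, IsIso.hom_inv_id_assoc, ← Functor.map_comp_assoc _
    ((DerivedCategory.singleFunctorIsoCompQ C 0).inv.app Y), Iso.inv_hom_id_app]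
  simp

/-- Exactness of R at s says that the part of R in degrees ≤ -s is a projective resolution of X,
shifted by s. So the class of `f` is the truncation map of R composed with isomorphisms on both
sides, and the truncation map has a K-injective fibre. -/
lemma trW_extEquivHo {A : HomotopyCategory C (ComplexShape.up ℤ)} (hA : IsKProj A)
    (d : DerivedCategory.Qh.obj A ≅ (DerivedCategory.singleFunctor C 0).obj X)
    [∀ i, Injective (R.cochainComplex.X i)] {s : ℕ} (f : R.complex.X s ⟶ X)
    (hf : R.complex.d (s + 1) s ≫ f = 0) [Epi f]
    (hex : (ShortComplex.mk _ _ hf).Exact) :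
    (acyclicOrthogonal C).trW (extEquivHo hA d d s (R.extMk f (s + 1) rfl hf)) := by
  set κ := (HomotopyCategory.quotient _ _).obj R.cochainComplex
  have hκ : IsKProj κ := isKProj_projRes R
  let N := (HomotopyCategory.quotient _ _).obj ((CochainComplex.singleFunctor C 0).obj X)
  let eN : DerivedCategory.Qh.obj N ≅ (DerivedCategory.singleFunctor C 0).obj X :=
    quotientSingleIso X
  set h := R.extMk f (s + 1) rfl hf
  -- `ε` is the augmentation of A and `α` the comparison of A with R; both exist in the homotopy
  -- category because A is K-projective.
  obtain ⟨ε, hε⟩ := (hA.bijective_Qh_map (N := N)).2 (d.hom ≫ eN.inv)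
  obtain ⟨α, hα⟩ := (hA.bijective_Qh_map (N := κ)).2 (d.hom ≫ (projResIso R).inv)
  have : IsIso (DerivedCategory.Qh.map ε) := hε ▸ inferInstance
  have : IsIso (DerivedCategory.Qh.map α) := hα ▸ inferInstance
  have : IsIso α := hA.isIso hκ α
  have h1 : extEquivHo hA d d s h ≫ ε⟦(s : ℤ)⟧' = extEquivHo hA d eN s h := by
    rw [← ShiftedHom.comp_mk₀ _ ((0 : ℕ) : ℤ) rfl,
      ← extEquivHo_mk₀ hA d eN (𝟙 X) ε (by rw [hε]; simp),
      ← extEquivHo_comp _ _ _ _ _ _ _ (add_zero s), Ext.comp_mk₀_id]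
  have h2 : extEquivHo hA d eN s h = α ≫ extEquivHo hκ (projResIso R) eN s h := by
    rw [← ShiftedHom.mk₀_comp ((0 : ℕ) : ℤ) rfl,
      ← extEquivHo_mk₀ hA d (projResIso R) (𝟙 X) α (by rw [hα]; simp),
      ← extEquivHo_comp _ _ _ _ _ _ _ (zero_add s), Ext.mk₀_id_comp]
  let T := ((CochainComplex.singleFunctor C 0).obj X)⟦(s : ℤ)⟧
  have hT : ∀ i, i ≠ (-s : ℤ) → IsZero (T.X i) := fun i hi =>
    HomologicalComplex.isZero_single_obj_X (.up ℤ) 0 X (i + s) (by lia)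
  -- The cocycle factors through the truncated resolution; this factor is its augmentation onto
  -- X[s].
  let c' := descLE R.cochainComplex (-s) (cocycleHom R f hf) hT
  have : QuasiIso c' := by
    obtain ⟨e, he⟩ := exists_cocycleHom_f R f hf
    have he' : (toLE R.cochainComplex (-s)).f (-s) ≫ c'.f (-s) =
        (R.cochainComplexXIso (-s) s rfl).hom ≫ f ≫ e.hom := by
      rw [← he, ← HomologicalComplex.comp_f, toLE_descLE]
    have h0 : R.cochainComplex.d (-s - 1) (-s) ≫
        (R.cochainComplexXIso (-s) s rfl).hom ≫ f ≫ e.hom = 0 := by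
      rw [R.cochainComplex_d _ _ (s + 1) s (by simp; ring) rfl]
      simp [reassoc_of% hf]
      rfl
    refine quasiIso_le_of_augmentation R.cochainComplex (-s) c' hT
      (fun i hi => exactAt_cochainComplex R (by lia)) _ he' h0 ?_
    refine ShortComplex.exact_of_iso ?_ hex
    refine ShortComplex.isoMk (R.cochainComplexXIso (-s - 1) (s + 1) (by simp; ring)).symm
      (R.cochainComplexXIso (-s) s rfl).symm e ?_ ?_
    · simp [R.cochainComplex_d (-s - 1) (-s) (s + 1) s (by simp; ring) rfl]
    · simp
  let τ := (HomotopyCategory.quotient _ _).obj (le R.cochainComplex (-s))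
  have hτ : IsKProj τ := isKProj_le _ _
  let γ : τ ⟶ N⟦(s : ℤ)⟧ := (HomotopyCategory.quotient _ _).map c' ≫
    ((HomotopyCategory.quotient C (.up ℤ)).commShiftIso (s : ℤ)).hom.app _
  have : IsIso (DerivedCategory.Qh.map ((HomotopyCategory.quotient _ _).map c')) :=
    (NatIso.isIso_map_iff (DerivedCategory.quotientCompQhIso C) c').2 inferInstance
  have : IsIso (DerivedCategory.Qh.map γ) := by
    dsimp only [γ]
    rw [Functor.map_comp]
    infer_instance
  have := isIso_Qh_map_shift ε s
  -- Lift the augmentation of the truncated resolution along that of A[s]: two K-projective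
  -- resolutions of X[s] are thereby compared.
  obtain ⟨β, hβ⟩ := (hτ.bijective_comp (ε⟦(s : ℤ)⟧')).2 γ
  have hβ' : β ≫ ε⟦(s : ℤ)⟧' = γ := hβ
  have : IsIso (DerivedCategory.Qh.map β) := by
    have h4 := congrArg DerivedCategory.Qh.map hβ'
    rw [Functor.map_comp] at h4
    have : IsIso (DerivedCategory.Qh.map β ≫ DerivedCategory.Qh.map (ε⟦(s : ℤ)⟧')) := by
      rw [h4]; infer_instance
    exact IsIso.of_isIso_comp_right _ (DerivedCategory.Qh.map (ε⟦(s : ℤ)⟧'))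
  have : IsIso β := hτ.isIso (hA.shift s) β
  -- The factorization is checked after composing with the shifted augmentation, which is injective
  -- on maps out of A.
  have h3 : extEquivHo hA d d s h =
      α ≫ (HomotopyCategory.quotient _ _).map (toLE R.cochainComplex (-s)) ≫ β := by
    apply (hA.bijective_comp (ε⟦(s : ℤ)⟧')).1
    change extEquivHo hA d d s h ≫ ε⟦(s : ℤ)⟧' =
      (α ≫ (HomotopyCategory.quotient _ _).map (toLE R.cochainComplex (-s)) ≫ β) ≫ ε⟦(s : ℤ)⟧'
    rw [h1, h2, Category.assoc, Category.assoc, hβ', extEquivHo_extMk, ShiftedHom.map]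
    congr 1
    dsimp only [γ]
    rw [← Functor.map_comp_assoc]
    congr 2
    exact (toLE_descLE _ _ _ _).symm
  rw [h3, (acyclicOrthogonal C).trW.cancel_left_of_respectsIso,
    (acyclicOrthogonal C).trW.cancel_right_of_respectsIso]
  exact trW_toLE _ _

end PeriodicityClass

end

end HochschildLocalization

namespace HochschildLocalization

noncomputable section

/-! ### Invertibility of the periodicity class -/

section Invertible

open Limits Pretriangulated Abelian BrutalTrunc

universe t

variable {K Λ : Type u} [Field K] [Ring Λ] [Algebra K Λ]

namespace CompleteResolution

variable [HasDerivedCategory.{t} (Bimod K Λ)] (P : CompleteResolution (reg K Λ))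
  [∀ i, Injective (P.complex.X i)]

/-- In the square of `postRes_stableMap` the other three sides are inverted by maps out of the
acyclic complex P. -/
lemma bijective_comp_shift_stableMap {n : ℕ} (x : HHn (reg K Λ) n)
    (hx : (acyclicOrthogonal _).trW (extEquivHo P.isKProj_res P.resIso P.resIso n x)) (m : ℤ) :
    Function.Bijective (fun g : P.toHo ⟶ P.toHo⟦m⟧ =>
      g ≫ (show P.toHo ⟶ P.toHo⟦(n : ℤ)⟧ from P.stableMap n x)⟦m⟧') := by
  have h := P.postRes_stableMap x
  rw [ShiftedHom.comp_mk₀, ShiftedHom.mk₀_comp] at h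
  have h1 := bijective_comp_of_trW P.toHo_acyclic ((acyclicOrthogonal _).trW.shift
    ((acyclicOrthogonal _).trW.shift (trW_toLE P.complex 0) (n : ℤ)) m)
  have h2 := bijective_comp_of_trW P.toHo_acyclic ((acyclicOrthogonal _).trW.shift
    (trW_toLE P.complex 0) m)
  have h3 := bijective_comp_of_trW P.toHo_acyclic ((acyclicOrthogonal _).trW.shift hx m)
  refine (Function.Bijective.of_comp_iff' h1 _).1 ?_
  convert! h3.comp h2 using 1
  funext g
  refine (Category.assoc _ _ _).trans (Eq.trans ?_ (Category.assoc _ _ _).symm)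
  refine congrArg (g ≫ ·) ?_
  refine (CategoryTheory.Functor.map_comp _ _ _).symm.trans (Eq.trans ?_ (CategoryTheory.Functor.map_comp _ _ _))
  exact congrArg (fun f => (shiftFunctor _ m).map f) h

lemma bijective_comp_stableMap {n : ℕ} (x : HHn (reg K Λ) n)
    (hx : (acyclicOrthogonal _).trW (extEquivHo P.isKProj_res P.resIso P.resIso n x))
    (m k : ℤ) (h : n + m = k) :
    Function.Bijective (fun y : StableHHn P m => (y.comp (P.stableMap n x) h : StableHHn P k)) := by
  have h1 := P.bijective_comp_shift_stableMap x hx m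
  have h2 : Function.Bijective (fun g : P.toHo ⟶ (P.toHo⟦(n : ℤ)⟧)⟦m⟧ =>
      g ≫ (shiftFunctorAdd' _ (n : ℤ) m k h).inv.app P.toHo) :=
    ⟨fun g g' h => (cancel_mono _).1 h,
      fun g => ⟨g ≫ (shiftFunctorAdd' _ (n : ℤ) m k h).hom.app P.toHo, by simp⟩⟩
  convert! h2.comp h1 using 1
  funext g
  exact (Category.assoc _ _ _).symm

lemma exists_inverse_stableMap {n : ℕ} (x : HHn (reg K Λ) n)
    (hx : (acyclicOrthogonal _).trW (extEquivHo P.isKProj_res P.resIso P.resIso n x)) :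
    ∃ y : StableHHn P (-n),
      y.comp (P.stableMap n x) (by simp) = ShiftedHom.mk₀ (0 : ℤ) rfl (𝟙 P.toHo) ∧
      (P.stableMap n x).comp y (by simp) = ShiftedHom.mk₀ (0 : ℤ) rfl (𝟙 P.toHo) := by
  obtain ⟨y, hy⟩ := (P.bijective_comp_stableMap x hx (-n) 0 (by simp)).2
    (ShiftedHom.mk₀ (0 : ℤ) rfl (𝟙 P.toHo))
  -- The one-sided inverse is two-sided: composing the other product and the identity with the image
  -- of x gives that image in both cases, and this composition is injective.
  refine ⟨y, hy, (P.bijective_comp_stableMap x hx 0 n (by simp)).1 ?_⟩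
  beta_reduce at hy ⊢
  rw [ShiftedHom.comp_assoc (P.stableMap n x) y (P.stableMap n x) (a₁₂ := 0) (a₂₃ := 0) (by simp) (by simp) (by simp), hy, ShiftedHom.comp_mk₀_id,
    ShiftedHom.mk₀_id_comp]

end CompleteResolution

/-- A class represented by an isomorphism `Ωˢ(Λ) ≅ Λ` becomes invertible in the stable Hochschild
cohomology. -/
lemma trW_of_isRepresentedByIso [HasDerivedCategory.{t} (Bimod K Λ)]
    (hinj : ∀ Q : Bimod K Λ, Projective Q → Injective Q)
    (P : CompleteResolution (reg K Λ)) {s : ℕ} {h : HHn (reg K Λ) s} (hh : IsRepresentedByIso h) :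
    (acyclicOrthogonal _).trW (extEquivHo P.isKProj_res P.resIso P.resIso s h) := by
  obtain ⟨R, -, φ, rfl⟩ := hh
  have : ∀ i, Injective (R.cochainComplex.X i) := fun i => hinj _ inferInstance
  have : Epi (R.complex.pOpcycles s ≫ φ.hom) := epi_comp _ _
  refine trW_extEquivHo R P.isKProj_res P.resIso (R.complex.pOpcycles s ≫ φ.hom) (by simp) ?_
  have h0 : R.complex.d (s + 1) s ≫ R.complex.pOpcycles s ≫ φ.hom = 0 := by simp
  refine ShortComplex.exact_of_g_is_cokernel _
    (IsColimit.ofIsoColimit (R.complex.opcyclesIsCokernel (s + 1) s (by simp))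
      (Cofork.ext φ (by simp)))

end Invertible

end

end HochschildLocalization

namespace HochschildLocalization

noncomputable section

/-! ### Graded natural families of Ext classes -/

section GradedNatural

open Limits Abelian

universe w w' v v' u'

section

variable {C : Type u} [Category.{v} C] [Abelian C] [HasExt.{w} C]
  {D : Type u'} [Category.{v'} D] [Abelian D] [HasExt.{w'} D]

/-- The class of a short exact sequence given by its objects and morphisms. -/
def connectingClass {X Y Z : C} {f : X ⟶ Y} {g : Y ⟶ Z} {w : f ≫ g = 0}
    (h : (ShortComplex.mk f g w).ShortExact) : Ext.{w} Z X 1 :=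
  h.extClass

lemma connectingClass_naturality {X Y Z : C} {f : X ⟶ Y} {g : Y ⟶ Z} {w : f ≫ g = 0}
    (h : (ShortComplex.mk f g w).ShortExact) {X' Y' Z' : C} {f' : X' ⟶ Y'} {g' : Y' ⟶ Z'}
    {w' : f' ≫ g' = 0} (h' : (ShortComplex.mk f' g' w').ShortExact) (a : X ⟶ X') (b : Y ⟶ Y')
    (c : Z ⟶ Z') (h₁ : a ≫ f' = f ≫ b) (h₂ : b ≫ g' = g ≫ c) :
    (connectingClass h).comp (Ext.mk₀ a) (add_zero 1) =
      (Ext.mk₀ c).comp (connectingClass h') (zero_add 1) :=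
  h.extClass_naturality h' { τ₁ := a, τ₂ := b, τ₃ := c, comm₁₂ := h₁, comm₂₃ := h₂ }

lemma mapExactFunctor_connectingClass (F : C ⥤ D) [F.Additive] [PreservesFiniteLimits F]
    [PreservesFiniteColimits F] {X Y Z : C} {f : X ⟶ Y} {g : Y ⟶ Z} {w : f ≫ g = 0}
    (h : (ShortComplex.mk f g w).ShortExact)
    {w' : F.map f ≫ F.map g = 0} (h' : (ShortComplex.mk (F.map f) (F.map g) w').ShortExact) :
    (connectingClass h).mapExactFunctor F = connectingClass h' :=
  Ext.mapExactFunctor_extClass F h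

/-- A family of classes in `Extⁿ(F X, G X)` commuting, up to the Koszul sign, with the maps on
`Ext` groups induced by the exact functors `F` and `G`. -/
def IsGradedNatural (F G : C ⥤ D) [F.Additive] [PreservesFiniteLimits F]
    [PreservesFiniteColimits F] [G.Additive] [PreservesFiniteLimits G]
    [PreservesFiniteColimits G] {n : ℕ} (η : ∀ X, Ext.{w'} (F.obj X) (G.obj X) n) : Prop :=
  ∀ ⦃k : ℕ⦄ ⦃X Y : C⦄ (a : Ext.{w} X Y k) (m : ℕ) (hm : k + n = m),
    (a.mapExactFunctor F).comp (η Y) hm =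
      ((-1) ^ (n * k) : ℤ) • (η X).comp (a.mapExactFunctor G) ((Nat.add_comm n k).trans hm)

/-- Dimension shifting along a projective cover of X in the weak sense: Ext out of a projective
vanishes in positive degree. -/
lemma exists_connectingClass_comp [EnoughProjectives C] {X Y : C} {n : ℕ}
    (a : Ext.{w} X Y (n + 1)) :
    ∃ (S T : C) (f : S ⟶ T) (g : T ⟶ X) (w : f ≫ g = 0) (h : (ShortComplex.mk f g w).ShortExact)
      (b : Ext.{w} S Y n), a = (connectingClass h).comp b (Nat.add_comm 1 n) := by
  have hS : (ShortComplex.mk (kernel.ι (Projective.π X)) (Projective.π X)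
    (kernel.condition _)).ShortExact := { exact := ShortComplex.exact_kernel _ }
  obtain ⟨b, hb⟩ := Ext.contravariant_sequence_exact₃ hS Y a (Ext.eq_zero_of_projective _)
    (Nat.add_comm 1 n)
  exact ⟨_, _, _, _, _, hS, b, hb.symm⟩

lemma zsmul_comp {X Y Z : C} {n m p : ℕ} (r : ℤ) (a : Ext.{w} X Y n) (b : Ext.{w} Y Z m)
    (h : n + m = p) : (r • a).comp b h = r • a.comp b h :=
  map_zsmul ((Ext.bilinearComp X Y Z n m p h).flip b) r a

lemma comp_zsmul {X Y Z : C} {n m p : ℕ} (r : ℤ) (a : Ext.{w} X Y n) (b : Ext.{w} Y Z m)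
    (h : n + m = p) : a.comp (r • b) h = r • a.comp b h :=
  map_zsmul (Ext.bilinearComp X Y Z n m p h a) r b

section

variable {F G H : C ⥤ D} [F.Additive] [PreservesFiniteLimits F]
    [PreservesFiniteColimits F] [G.Additive] [PreservesFiniteLimits G]
    [PreservesFiniteColimits G] [H.Additive] [PreservesFiniteLimits H]
    [PreservesFiniteColimits H]

/-- By dimension shifting, morphisms and connecting classes generate all Ext classes under Yoneda
products. Each connecting class contributes a factor (-1)ⁿ, whence the sign (-1)^(n k) in degree k.
-/
lemma IsGradedNatural.of_degree_le_one [EnoughProjectives C] {n : ℕ}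
    {η : ∀ X, Ext.{w'} (F.obj X) (G.obj X) n}
    (h₀ : ∀ ⦃X Y : C⦄ (f : X ⟶ Y), (Ext.mk₀ (F.map f)).comp (η Y) (zero_add n) =
      (η X).comp (Ext.mk₀ (G.map f)) (add_zero n))
    (h₁ : ∀ ⦃X Y Z : C⦄ ⦃f : X ⟶ Y⦄ ⦃g : Y ⟶ Z⦄ ⦃w : f ≫ g = 0⦄
      (h : (ShortComplex.mk f g w).ShortExact),
      ((connectingClass h).mapExactFunctor F).comp (η X) (Nat.add_comm 1 n) =
        ((-1) ^ n : ℤ) • (η Z).comp ((connectingClass h).mapExactFunctor G) rfl) :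
    IsGradedNatural.{u, w, w'} F G η := by
  intro k
  induction k with
  | zero =>
    intro X Y a m hm
    obtain ⟨f, rfl⟩ := (Ext.mk₀_bijective X Y).2 a
    obtain rfl : n = m := by lia
    simpa [Ext.mapExactFunctor_mk₀] using h₀ f
  | succ k ih =>
    intro X Y a m hm
    obtain ⟨S, T, f, g, w, h, b, rfl⟩ := exists_connectingClass_comp a
    rw [Ext.mapExactFunctor_comp, Ext.mapExactFunctor_comp,
      Ext.comp_assoc (a₁₂ := k + 1) (a₂₃ := k + n) _ _ _ (by lia)
        rfl (by lia), ih b _ rfl, comp_zsmul,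
      ← Ext.comp_assoc (a₁₂ := n + 1) (a₂₃ := k + n) _ _ _ (by lia) (by lia) (by lia), h₁,
      zsmul_comp, Ext.comp_assoc (a₁₂ := n + 1) (a₂₃ := k + 1) _ _ _ rfl (by lia) (by lia),
      smul_smul, Nat.mul_succ, pow_add]

lemma IsGradedNatural.of_natTrans (τ : F ⟶ G) [EnoughProjectives C] :
    IsGradedNatural.{u, w, w'} F G (fun X => Ext.mk₀ (τ.app X)) := by
  refine .of_degree_le_one (fun X Y f => ?_) (fun X Y Z f g w h => ?_)
  · simp
  · rw [mapExactFunctor_connectingClass F h (h.map_of_exact F),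
      mapExactFunctor_connectingClass G h (h.map_of_exact G), pow_zero, one_smul]
    exact connectingClass_naturality _ _ _ (τ.app Y) _ (τ.naturality f).symm (τ.naturality g).symm

lemma IsGradedNatural.comp {n m : ℕ} {η : ∀ X, Ext.{w'} (F.obj X) (G.obj X) n}
    {ζ : ∀ X, Ext.{w'} (G.obj X) (H.obj X) m} (hη : IsGradedNatural.{u, w, w'} F G η)
    (hζ : IsGradedNatural.{u, w, w'} G H ζ) {p : ℕ} (hp : n + m = p) :
    IsGradedNatural.{u, w, w'} F H (fun X => (η X).comp (ζ X) hp) := by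
  subst hp
  intro k X Y a q hq
  rw [← Ext.comp_assoc (a₁₂ := k + n) _ _ _ rfl _ (by lia), hη a _ rfl, zsmul_comp,
    Ext.comp_assoc (a₁₂ := k + n) (a₂₃ := k + m) _ _ _ (by lia) rfl (by lia), hζ a _ rfl,
    comp_zsmul, ← Ext.comp_assoc (a₁₂ := n + m) _ _ _ rfl (by lia) (by lia), smul_smul, ← pow_add,
    ← Nat.add_mul]

end

end

variable {C : Type u} [Category.{v} C] [Abelian C] [HasExt.{w} C]
  {A : Type u'} [Ring A] [HasExt.{w'} (ModuleCat.{v'} A)]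

/-- The two composites of connecting classes of a `3 × 3` diagram of short exact sequences
anticommute. -/
lemma connectingClass_comp_connectingClass_add {F G H : C ⥤ ModuleCat.{v'} A} [F.Additive]
    [PreservesFiniteLimits F] [PreservesFiniteColimits F] [G.Additive] [PreservesFiniteLimits G]
    [PreservesFiniteColimits G] [H.Additive] [PreservesFiniteLimits H]
    [PreservesFiniteColimits H] {α : F ⟶ G} {β : G ⟶ H} (w : ∀ X, α.app X ≫ β.app X = 0)
    (hS : ∀ X, (ShortComplex.mk (α.app X) (β.app X) (w X)).ShortExact)
    {X₁ X₂ X₃ : C} {i : X₁ ⟶ X₂} {r : X₂ ⟶ X₃} {w' : i ≫ r = 0}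
    (hT : (ShortComplex.mk i r w').ShortExact) :
    ((connectingClass hT).mapExactFunctor H).comp (connectingClass (hS X₁)) rfl +
      (connectingClass (hS X₃)).comp ((connectingClass hT).mapExactFunctor F) rfl = 0 := by
  have : Epi (β.app X₃) := (hS X₃).epi_g
  have : Epi (G.map r) := (hT.map_of_exact G).epi_g
  have : Mono (α.app X₃) := (hS X₃).mono_f
  have : Mono (H.map i) := (hT.map_of_exact H).mono_f
  -- The kernel Z of the diagonal map G X₂ → H X₃ maps to both F X₃ and H X₁. The sequences through
  -- Z split each of the two double extensions into a common first and a common second half, up to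
  -- sign.
  let φ := G.map r ≫ β.app X₃
  have : Epi φ := epi_comp _ _
  have h₂ : (ShortComplex.mk (kernel.ι φ) φ (kernel.condition _)).ShortExact :=
    { exact := ShortComplex.exact_kernel _ }
  let p : kernel φ ⟶ F.obj X₃ := (hS X₃).exact.lift (kernel.ι φ ≫ G.map r)
    ((Category.assoc _ _ _).trans (kernel.condition φ))
  have hp : p ≫ α.app X₃ = kernel.ι φ ≫ G.map r := (hS X₃).exact.lift_f _ _
  have hTH : (ShortComplex.mk (H.map i) (H.map r) _).ShortExact := hT.map_of_exact H
  let q : kernel φ ⟶ H.obj X₁ := hTH.exact.lift (kernel.ι φ ≫ β.app X₂) (by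
    change (kernel.ι φ ≫ β.app X₂) ≫ H.map r = 0
    rw [Category.assoc, ← β.naturality]
    exact kernel.condition φ)
  have hq : q ≫ H.map i = kernel.ι φ ≫ β.app X₂ := hTH.exact.lift_f _ _
  -- The minus sign in the second component, needed for the composite to vanish, is the origin of
  -- anticommutativity.
  let a : F.obj X₁ ⟶ ModuleCat.of A (F.obj X₂ × G.obj X₁) :=
    ModuleCat.ofHom ((F.map i).hom.prod (-(α.app X₁).hom))
  let b₁ : F.obj X₂ ⟶ kernel φ := kernel.lift φ (α.app X₂) (by
    rw [← α.naturality_assoc, w, comp_zero])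
  let b₂ : G.obj X₁ ⟶ kernel φ := kernel.lift φ (G.map i) (by
    rw [← G.map_comp_assoc, w', G.map_zero, zero_comp])
  let b : ModuleCat.of A (F.obj X₂ × G.obj X₁) ⟶ kernel φ :=
    ModuleCat.ofHom (b₁.hom.coprod b₂.hom)
  have hβα (X) (x : F.obj X) : β.app X (α.app X x) = 0 := by
    rw [← ConcreteCategory.comp_apply, w]
    rfl
  have hri (x : G.obj X₁) : G.map r (G.map i x) = 0 := by
    rw [← ConcreteCategory.comp_apply, ← G.map_comp, w', G.map_zero]
    rfl
  have hι : Function.Injective (kernel.ι φ) := (ModuleCat.mono_iff_injective _).1 inferInstance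
  have hb₁ (x) : kernel.ι φ (b₁ x) = α.app X₂ x := by
    rw [← ConcreteCategory.comp_apply, kernel.lift_ι]
  have hb₂ (x) : kernel.ι φ (b₂ x) = G.map i x := by
    rw [← ConcreteCategory.comp_apply, kernel.lift_ι]
  have hab : a ≫ b = 0 := by
    ext x
    apply hι
    change kernel.ι φ (b₁ (F.map i x) + b₂ (-α.app X₁ x)) = kernel.ι φ 0
    rw [map_add, hb₁, hb₂, map_neg, NatTrans.naturality_apply, add_neg_cancel, map_zero]
  have h₁ : (ShortComplex.mk a b hab).ShortExact := by
    have hF : Function.Injective (F.map i) :=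
      (ModuleCat.mono_iff_injective _).1 (hT.map_of_exact F).mono_f
    have hα : Function.Injective (α.app X₂) :=
      (ModuleCat.mono_iff_injective _).1 (hS X₂).mono_f
    have hα₃ : Function.Injective (α.app X₃) :=
      (ModuleCat.mono_iff_injective _).1 inferInstance
    have hH : Function.Injective (H.map i) := (ModuleCat.mono_iff_injective _).1 inferInstance
    refine { exact := (ShortComplex.moduleCat_exact_iff _).2 ?_
             mono_f := (ModuleCat.mono_iff_injective _).2 ?_
             epi_g := (ModuleCat.epi_iff_surjective _).2 ?_ }
    · rintro ⟨x, y⟩ hxy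
      replace hxy : b₁ x + b₂ y = 0 := hxy
      have h : α.app X₂ x + G.map i y = 0 := by rw [← hb₁, ← hb₂, ← map_add, hxy, map_zero]
      have hy : β.app X₁ y = 0 := by
        apply hH
        have h' := congrArg (β.app X₂) h
        rw [map_add, hβα, NatTrans.naturality_apply, zero_add, map_zero] at h'
        exact h'.trans (map_zero _).symm
      obtain ⟨z, hz⟩ := (ShortComplex.moduleCat_exact_iff _).1 (hS X₁).exact y hy
      refine ⟨-z, Prod.ext (hα ?_) ?_⟩
      · change α.app X₂ (F.map i (-z)) = α.app X₂ x
        rw [NatTrans.naturality_apply, map_neg, map_neg]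
        refine (eq_neg_of_add_eq_zero_left ?_).symm
        convert! h
      · change -(α.app X₁ (-z)) = y
        rw [map_neg, neg_neg]
        exact hz
    · intro x y hxy
      exact hF (congrArg Prod.fst hxy)
    · intro (m : (kernel φ : ModuleCat A))
      obtain ⟨z, hz⟩ : ∃ z : F.obj X₂, F.map r z = p m := (ModuleCat.epi_iff_surjective _).1 (hT.map_of_exact F).epi_g (p m)
      have h : G.map r (kernel.ι φ m - α.app X₂ z) = 0 := by
        have h' := congrArg (α.app X₃) hz
        rw [NatTrans.naturality_apply, ← ConcreteCategory.comp_apply p, hp] at h'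
        rw [map_sub, h']
        exact sub_self _
      obtain ⟨y, hy⟩ : ∃ y : G.obj X₁, G.map i y = _ :=
        (ShortComplex.moduleCat_exact_iff _).1 (hT.map_of_exact G).exact _ h
      refine ⟨(z, y), hι ?_⟩
      change kernel.ι φ (b₁ z + b₂ y) = _
      rw [map_add, hb₁, hb₂, hy, add_sub_cancel]
  rw [mapExactFunctor_connectingClass H hT (hT.map_of_exact H),
    mapExactFunctor_connectingClass F hT (hT.map_of_exact F)]
  have hb₃ : ModuleCat.ofHom (LinearMap.fst _ _ _) ≫ F.map r = b ≫ p := by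
    rw [← cancel_mono (α.app X₃), Category.assoc, Category.assoc, hp]
    refine ModuleCat.hom_ext (LinearMap.ext fun ⟨x, y⟩ => ?_)
    change α.app X₃ (F.map r x) = G.map r (kernel.ι φ (b₁ x + b₂ y))
    rw [map_add, hb₁, hb₂, map_add, NatTrans.naturality_apply, hri, add_zero]
  have hb₄ : ModuleCat.ofHom (LinearMap.snd _ _ _) ≫ β.app X₁ = b ≫ q := by
    rw [← cancel_mono (H.map i), Category.assoc, Category.assoc, hq]
    refine ModuleCat.hom_ext (LinearMap.ext fun ⟨x, y⟩ => ?_)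
    change H.map i (β.app X₁ y) = β.app X₂ (kernel.ι φ (b₁ x + b₂ y))
    rw [map_add, hb₁, hb₂, map_add, NatTrans.naturality_apply, hβα, zero_add]
  -- `e₁` and `e₂` write both first factors as pushouts of the class of `h₂`; `e₃` and `e₄` write
  -- the pullbacks to Z of both second factors as plus and minus the class of `h₁`.
  have e₁ := connectingClass_naturality h₂ (hS X₃) p (G.map r) (𝟙 _) hp (Category.comp_id _).symm
  have e₂ := connectingClass_naturality h₂ (hT.map_of_exact H) q (β.app X₂) (𝟙 _) hq
    ((β.naturality r).symm.trans (Category.comp_id _).symm)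
  have e₃ := connectingClass_naturality h₁ (hT.map_of_exact F) (𝟙 _)
    (ModuleCat.ofHom (LinearMap.fst _ _ _)) p rfl hb₃
  have e₄ := connectingClass_naturality h₁ (hS X₁) (-𝟙 _)
    (ModuleCat.ofHom (LinearMap.snd _ _ _)) q (by rw [Preadditive.neg_comp, Category.id_comp]; rfl) hb₄
  simp only [Ext.mk₀_id_comp, Ext.comp_mk₀_id, Ext.mk₀_neg, Ext.comp_neg] at e₁ e₂ e₃ e₄
  rw [← e₁, ← e₂, Ext.comp_assoc (a₂₃ := 1) _ _ _ _ (by lia) (by lia),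
    Ext.comp_assoc (a₂₃ := 1) _ _ _ _ (by lia) (by lia), ← e₃, ← e₄, Ext.comp_neg, neg_add_cancel]

/-- The connecting classes of a short exact sequence of exact functors are graded natural. -/
lemma IsGradedNatural.connecting [EnoughProjectives C] {F G H : C ⥤ ModuleCat.{v'} A}
    [F.Additive] [PreservesFiniteLimits F] [PreservesFiniteColimits F] [G.Additive]
    [PreservesFiniteLimits G] [PreservesFiniteColimits G] [H.Additive] [PreservesFiniteLimits H]
    [PreservesFiniteColimits H] {α : F ⟶ G} {β : G ⟶ H} (w : ∀ X, α.app X ≫ β.app X = 0)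
    (hS : ∀ X, (ShortComplex.mk (α.app X) (β.app X) (w X)).ShortExact) :
    IsGradedNatural.{u, w, w'} H F (fun X => connectingClass (hS X)) := by
  refine .of_degree_le_one (fun X Y f => ?_) (fun X Y Z f g w' h => ?_)
  · exact (connectingClass_naturality (hS X) (hS Y) (F.map f) (G.map f) (H.map f)
      (α.naturality f) (β.naturality f)).symm
  · rw [pow_one, neg_one_smul]
    exact eq_neg_of_add_eq_zero_left (connectingClass_comp_connectingClass_add w hS h)

end GradedNatural

end

end HochschildLocalization

namespace HochschildLocalization

noncomputable section

/-! ### Bimodules of left linear maps -/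

section LeftHom

open Limits Abelian

section

variable {A B : Type*} [Ring A] [Ring B] (f : A →+* B)

lemma restrictScalars_map_exact (S : ShortComplex (ModuleCat.{u} B)) (h : S.Exact) :
    (S.map (ModuleCat.restrictScalars.{u} f)).Exact := by
  rw [ShortComplex.ShortExact.moduleCat_exact_iff_function_exact] at h ⊢
  exact h

instance preservesFiniteLimits_restrictScalars :
    PreservesFiniteLimits (ModuleCat.restrictScalars.{u} f) := by
  have h := ((CategoryTheory.Functor.exact_tfae (ModuleCat.restrictScalars.{u} f)).out 1 3).mp
    (restrictScalars_map_exact f)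
  exact h.1

instance preservesFiniteColimits_restrictScalars :
    PreservesFiniteColimits (ModuleCat.restrictScalars.{u} f) := by
  have h := ((CategoryTheory.Functor.exact_tfae (ModuleCat.restrictScalars.{u} f)).out 1 3).mp
    (restrictScalars_map_exact f)
  exact h.2

end

variable (K Λ : Type u) [Field K] [Ring Λ] [Algebra K Λ]

/-- The underlying left module of a bimodule. -/
abbrev leftRestrict : Bimod K Λ ⥤ ModuleCat.{u} Λ :=
  ModuleCat.restrictScalars
    (Algebra.TensorProduct.includeLeftRingHom : Λ →+* Env K Λ)

variable {K Λ}

/-- Right multiplication by an element of `Λ`, as an endomorphism of the underlying left module. -/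
def rightMul (V : Bimod K Λ) (b : Λᵐᵒᵖ) :
    (leftRestrict K Λ).obj V ⟶ (leftRestrict K Λ).obj V :=
  ModuleCat.ofHom (X := (leftRestrict K Λ).obj V) (Y := (leftRestrict K Λ).obj V)
    { toFun := fun v : V => (1 ⊗ₜ b : Env K Λ) • v
      map_add' := fun v w : V => smul_add (1 ⊗ₜ b : Env K Λ) v w
      map_smul' := fun (a : Λ) (v : V) => by
        change ((1 ⊗ₜ b : Env K Λ) • (a ⊗ₜ 1 : Env K Λ) • v) =
          ((a ⊗ₜ 1 : Env K Λ) • (1 ⊗ₜ b : Env K Λ) • v)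
        simp [smul_smul] }

lemma rightMul_one (V : Bimod K Λ) : rightMul V (1 : Λᵐᵒᵖ) = 𝟙 _ :=
  ModuleCat.hom_ext (LinearMap.ext fun v : V => one_smul (Env K Λ) v)

lemma rightMul_mul (V : Bimod K Λ) (b c : Λᵐᵒᵖ) :
    rightMul V (b * c) = rightMul V c ≫ rightMul V b :=
  ModuleCat.hom_ext (LinearMap.ext fun v : V => by
    change ((1 ⊗ₜ (b * c) : Env K Λ) • v : V) =
      ((1 ⊗ₜ b : Env K Λ) • (1 ⊗ₜ c : Env K Λ) • v : V)
    simp [smul_smul])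

lemma rightMul_add (V : Bimod K Λ) (b c : Λᵐᵒᵖ) :
    rightMul V (b + c) = rightMul V b + rightMul V c :=
  ModuleCat.hom_ext (LinearMap.ext fun v : V => by
    change ((1 ⊗ₜ (b + c) : Env K Λ) • v : V) =
      ((1 ⊗ₜ b : Env K Λ) • v : V) + ((1 ⊗ₜ c : Env K Λ) • v : V)
    rw [TensorProduct.tmul_add, add_smul])

lemma rightMul_algebraMap (V : Bimod K Λ) (r : K) :
    rightMul V (algebraMap K Λᵐᵒᵖ r) = r • 𝟙 _ :=
  ModuleCat.hom_ext (LinearMap.ext fun v : V => by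
    change ((1 ⊗ₜ algebraMap K Λᵐᵒᵖ r : Env K Λ) • v : V) =
      ((algebraMap K Λ r ⊗ₜ 1 : Env K Λ) • v : V)
    rw [Algebra.algebraMap_eq_smul_one, Algebra.algebraMap_eq_smul_one, TensorProduct.tmul_smul,
      TensorProduct.smul_tmul'])

lemma rightMul_naturality {V W : Bimod K Λ} (f : V ⟶ W) (b : Λᵐᵒᵖ) :
    rightMul V b ≫ (leftRestrict K Λ).map f = (leftRestrict K Λ).map f ≫ rightMul W b :=
  ModuleCat.hom_ext (LinearMap.ext fun v : V => f.hom.map_smul (1 ⊗ₜ b : Env K Λ) v)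

/-- The left action on left linear maps, by `(a φ) v = φ (v a)`. -/
def leftHomActionLeft (V X : Bimod K Λ) : Λ →ₐ[K]
    Module.End K ((leftRestrict K Λ).obj V ⟶ (leftRestrict K Λ).obj X) :=
  AlgHom.ofLinearMap
      { toFun a :=
          { toFun φ := rightMul V (MulOpposite.op a) ≫ φ
            map_add' φ ψ := Preadditive.comp_add _ _ _ _ _ _
            map_smul' r φ := Linear.comp_smul _ _ _ _ _ _ }
        map_add' a b := LinearMap.ext fun φ => by
          change rightMul V (MulOpposite.op a + MulOpposite.op b) ≫ φ = _
          rw [rightMul_add, Preadditive.add_comp]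
          rfl
        map_smul' r a := LinearMap.ext fun φ => by
          change rightMul V (r • MulOpposite.op a) ≫ φ = r • rightMul V (MulOpposite.op a) ≫ φ
          rw [Algebra.smul_def, rightMul_mul, rightMul_algebraMap]
          simp }
      (LinearMap.ext fun φ => by
        change rightMul V 1 ≫ φ = φ
        rw [rightMul_one, Category.id_comp])
      (fun a b => LinearMap.ext fun φ => by
        change rightMul V (MulOpposite.op b * MulOpposite.op a) ≫ φ = _
        rw [rightMul_mul, Category.assoc]
        rfl)

/-- The right action on left linear maps, by `(φ b) v = φ v b`. -/
def leftHomActionRight (V X : Bimod K Λ) : Λᵐᵒᵖ →ₐ[K]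
    Module.End K ((leftRestrict K Λ).obj V ⟶ (leftRestrict K Λ).obj X) :=
  AlgHom.ofLinearMap
      { toFun b :=
          { toFun φ := φ ≫ rightMul X b
            map_add' φ ψ := Preadditive.add_comp _ _ _ _ _ _
            map_smul' r φ := Linear.smul_comp _ _ _ _ _ _ }
        map_add' a b := LinearMap.ext fun φ => by
          change φ ≫ rightMul X (a + b) = _
          rw [rightMul_add, Preadditive.comp_add]
          rfl
        map_smul' r a := LinearMap.ext fun φ => by
          change φ ≫ rightMul X (r • a) = r • φ ≫ rightMul X a
          rw [Algebra.smul_def, rightMul_mul, rightMul_algebraMap]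
          simp }
      (LinearMap.ext fun φ => by
        change φ ≫ rightMul X 1 = φ
        rw [rightMul_one, Category.comp_id])
      (fun a b => LinearMap.ext fun φ => by
        change φ ≫ rightMul X (a * b) = _
        rw [rightMul_mul, ← Category.assoc]
        rfl)

lemma leftHomAction_commute (V X : Bimod K Λ) (a : Λ) (b : Λᵐᵒᵖ) :
    Commute (leftHomActionLeft V X a) (leftHomActionRight V X b) :=
  LinearMap.ext fun φ => (Category.assoc (rightMul V (MulOpposite.op a)) φ (rightMul X b)).symm

/-- The action of the enveloping algebra on left linear maps between bimodules:
`((a ⊗ b) φ) v = φ (v a) b`. -/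
def leftHomAction (V X : Bimod K Λ) : Env K Λ →ₐ[K]
    Module.End K ((leftRestrict K Λ).obj V ⟶ (leftRestrict K Λ).obj X) :=
  Algebra.TensorProduct.lift (leftHomActionLeft V X) (leftHomActionRight V X)
    (leftHomAction_commute V X)

/-- The bimodule of left linear maps between two bimodules. -/
def leftHom (V X : Bimod K Λ) : Bimod K Λ :=
  letI := Module.compHom ((leftRestrict K Λ).obj V ⟶ (leftRestrict K Λ).obj X)
    (leftHomAction V X).toRingHom
  ModuleCat.of (Env K Λ) ((leftRestrict K Λ).obj V ⟶ (leftRestrict K Λ).obj X)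

/-- A left linear map, as an element of the bimodule of left linear maps. -/
def leftHom.equiv (V X : Bimod K Λ) :
    ((leftRestrict K Λ).obj V ⟶ (leftRestrict K Λ).obj X) ≃+ leftHom V X :=
  AddEquiv.refl _

lemma leftHom.smul_equiv {V X : Bimod K Λ} (a : Λ) (b : Λᵐᵒᵖ)
    (φ : (leftRestrict K Λ).obj V ⟶ (leftRestrict K Λ).obj X) :
    (a ⊗ₜ b : Env K Λ) • leftHom.equiv V X φ =
      leftHom.equiv V X (rightMul V (MulOpposite.op a) ≫ φ ≫ rightMul X b) := by
  have h := DFunLike.congr_fun (Algebra.TensorProduct.lift_tmul (leftHomActionLeft V X)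
    (leftHomActionRight V X) (leftHomAction_commute V X) a b) φ
  exact h

/-- A map into or out of a bimodule is determined by its compatibility with pure tensors. -/
def bimodHom {X Y : Bimod K Λ} (f : X →+ Y)
    (hf : ∀ (a : Λ) (b : Λᵐᵒᵖ) x, f ((a ⊗ₜ b : Env K Λ) • x) = (a ⊗ₜ b : Env K Λ) • f x) :
    X ⟶ Y :=
  ModuleCat.ofHom
    { toFun := f
      map_add' := f.map_add
      map_smul' e x := by
        induction e using TensorProduct.induction_on with
        | zero =>
          exact (congrArg f (zero_smul (Env K Λ) x)).trans
            ((map_zero f).trans (zero_smul (Env K Λ) (f x)).symm)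
        | tmul a b => exact hf a b x
        | add e e' h h' => rw [add_smul, map_add, h, h']; exact (add_smul _ _ _).symm }

/-- The functoriality of the bimodule of left linear maps. -/
def leftHom.map {V V' X X' : Bimod K Λ} (g : V' ⟶ V) (f : X ⟶ X') : leftHom V X ⟶ leftHom V' X' :=
  bimodHom
    { toFun φ := leftHom.equiv V' X' ((leftRestrict K Λ).map g ≫ (leftHom.equiv V X).symm φ ≫
        (leftRestrict K Λ).map f)
      map_zero' := by simp
      map_add' φ ψ := by simp }
    (fun a b φ => by
      obtain ⟨φ, rfl⟩ := (leftHom.equiv V X).surjective φ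
      rw [leftHom.smul_equiv]
      change leftHom.equiv V' X' ((leftRestrict K Λ).map g ≫
        (rightMul V (MulOpposite.op a) ≫ φ ≫ rightMul X b) ≫ (leftRestrict K Λ).map f) =
          (a ⊗ₜ b : Env K Λ) • leftHom.equiv V' X' ((leftRestrict K Λ).map g ≫ φ ≫
            (leftRestrict K Λ).map f)
      rw [leftHom.smul_equiv]
      simp only [Category.assoc, rightMul_naturality, reassoc_of% @rightMul_naturality])

lemma leftHom.map_equiv {V V' X X' : Bimod K Λ} (g : V' ⟶ V) (f : X ⟶ X')
    (φ : (leftRestrict K Λ).obj V ⟶ (leftRestrict K Λ).obj X) :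
    leftHom.map g f (leftHom.equiv V X φ) =
      leftHom.equiv V' X' ((leftRestrict K Λ).map g ≫ φ ≫ (leftRestrict K Λ).map f) := rfl

lemma leftHom.hom_ext {V X : Bimod K Λ} {Y : Bimod K Λ} {f g : leftHom V X ⟶ Y}
    (h : ∀ φ, f (leftHom.equiv V X φ) = g (leftHom.equiv V X φ)) : f = g :=
  ModuleCat.hom_ext (LinearMap.ext fun φ => h φ)

lemma leftHom.map_comp_map {V V' V'' X X' X'' : Bimod K Λ} (g : V' ⟶ V) (g' : V'' ⟶ V')
    (f : X ⟶ X') (f' : X' ⟶ X'') :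
    leftHom.map g f ≫ leftHom.map g' f' = leftHom.map (g' ≫ g) (f ≫ f') :=
  leftHom.hom_ext fun φ => by
    rw [ConcreteCategory.comp_apply, map_equiv, map_equiv, map_equiv]
    simp

lemma leftHom.map_id_id (V X : Bimod K Λ) : leftHom.map (𝟙 V) (𝟙 X) = 𝟙 _ :=
  leftHom.hom_ext fun φ => by
    rw [map_equiv]
    simp

lemma leftHom.map_add_right {V V' X X' : Bimod K Λ} (g : V' ⟶ V) (f f' : X ⟶ X') :
    leftHom.map g (f + f') = leftHom.map g f + leftHom.map g f' :=
  leftHom.hom_ext fun φ => by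
    refine (leftHom.map_equiv _ _ _).trans ?_
    rw [CategoryTheory.Functor.map_add, Preadditive.comp_add, Preadditive.comp_add]
    rfl

lemma leftHom.map_zero_right {V V' X X' : Bimod K Λ} (g : V' ⟶ V)  :
    leftHom.map g (0 : X ⟶ X') = 0 := by
  simpa using leftHom.map_add_right g (0 : X ⟶ X') 0

lemma leftHom.map_zero_left {V V' X X' : Bimod K Λ} (f : X ⟶ X')  :
    leftHom.map (0 : V' ⟶ V) f = 0 :=
  leftHom.hom_ext fun φ => by
    refine (leftHom.map_equiv _ _ _).trans ?_
    rw [CategoryTheory.Functor.map_zero, zero_comp]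
    rfl

/-- The functor of left linear maps out of a bimodule. -/
def leftHomFunctor (V : Bimod K Λ) : Bimod K Λ ⥤ Bimod K Λ where
  obj X := leftHom V X
  map f := leftHom.map (𝟙 V) f
  map_id X := leftHom.map_id_id V X
  map_comp f g := by rw [leftHom.map_comp_map, Category.comp_id]

instance (V : Bimod K Λ) : (leftHomFunctor V).Additive where
  map_add := leftHom.map_add_right _ _ _

/-- The contravariant functoriality of the functor of left linear maps. -/
def leftHomPrecomp {V V' : Bimod K Λ} (g : V' ⟶ V) : leftHomFunctor V ⟶ leftHomFunctor V' where
  app X := leftHom.map g (𝟙 X)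
  naturality X Y f := by
    change leftHom.map (𝟙 V) f ≫ leftHom.map g (𝟙 Y) = leftHom.map g (𝟙 X) ≫ leftHom.map (𝟙 V') f
    rw [leftHom.map_comp_map, leftHom.map_comp_map]
    simp only [Category.comp_id, Category.id_comp]

/-- Projectivity of V is needed only over Λ on the left, so this applies to Λ and all its syzygies.
-/
lemma shortExact_leftHom_right {V X Y Z : Bimod K Λ} [Projective ((leftRestrict K Λ).obj V)]
    {f : X ⟶ Y} {g : Y ⟶ Z} {w : f ≫ g = 0} (h : (ShortComplex.mk f g w).ShortExact)
    (w' : leftHom.map (𝟙 V) f ≫ leftHom.map (𝟙 V) g = 0) :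
    (ShortComplex.mk _ _ w').ShortExact := by
  have hL : (ShortComplex.mk ((leftRestrict K Λ).map f) ((leftRestrict K Λ).map g)
    (by rw [← CategoryTheory.Functor.map_comp, w, CategoryTheory.Functor.map_zero])).ShortExact :=
    h.map_of_exact (leftRestrict K Λ)
  have : Mono ((leftRestrict K Λ).map f) := hL.mono_f
  have : Epi ((leftRestrict K Λ).map g) := hL.epi_g
  refine { exact := (ShortComplex.moduleCat_exact_iff _).2 ?_
           mono_f := (ModuleCat.mono_iff_injective _).2 ?_
           epi_g := (ModuleCat.epi_iff_surjective _).2 ?_ }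
  · intro φ hφ
    obtain ⟨φ, rfl⟩ := (leftHom.equiv V Y).surjective φ
    have hφ' : φ ≫ (leftRestrict K Λ).map g = 0 := by
      have h' := (leftHom.map_equiv _ _ _).symm.trans hφ
      rwa [CategoryTheory.Functor.map_id, Category.id_comp] at h'
    refine ⟨leftHom.equiv V X (hL.exact.lift φ hφ'), ?_⟩
    refine (leftHom.map_equiv _ _ _).trans ?_
    rw [CategoryTheory.Functor.map_id, Category.id_comp]
    exact congrArg _ (hL.exact.lift_f _ _)
  · intro φ ψ hφ
    obtain ⟨φ, rfl⟩ := (leftHom.equiv V X).surjective φ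
    obtain ⟨ψ, rfl⟩ := (leftHom.equiv V X).surjective ψ
    have h' := ((leftHom.map_equiv _ _ _).symm.trans hφ).trans (leftHom.map_equiv _ _ _)
    rw [CategoryTheory.Functor.map_id, Category.id_comp, Category.id_comp] at h'
    exact congrArg _ ((cancel_mono ((leftRestrict K Λ).map f)).1 h')
  · intro φ
    obtain ⟨φ, rfl⟩ := (leftHom.equiv V Z).surjective φ
    refine ⟨leftHom.equiv V Y (Projective.factorThru φ ((leftRestrict K Λ).map g)), ?_⟩
    refine (leftHom.map_equiv _ _ _).trans ?_
    rw [CategoryTheory.Functor.map_id, Category.id_comp]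
    exact congrArg _ (Projective.factorThru_comp _ _)

/-- The sequence splits as left modules, so the contravariant functor stays exact on the right. -/
lemma shortExact_leftHom_left {V₁ V₂ V₃ X : Bimod K Λ} [Projective ((leftRestrict K Λ).obj V₃)]
    {i : V₁ ⟶ V₂} {p : V₂ ⟶ V₃} {w : i ≫ p = 0} (h : (ShortComplex.mk i p w).ShortExact)
    (w' : leftHom.map p (𝟙 X) ≫ leftHom.map i (𝟙 X) = 0) :
    (ShortComplex.mk _ _ w').ShortExact := by
  have hL : (ShortComplex.mk ((leftRestrict K Λ).map i) ((leftRestrict K Λ).map p)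
    (by rw [← CategoryTheory.Functor.map_comp, w, CategoryTheory.Functor.map_zero])).ShortExact :=
    h.map_of_exact (leftRestrict K Λ)
  have : Mono ((leftRestrict K Λ).map i) := hL.mono_f
  have : Epi ((leftRestrict K Λ).map p) := hL.epi_g
  have σ := hL.splittingOfProjective
  refine { exact := (ShortComplex.moduleCat_exact_iff _).2 ?_
           mono_f := (ModuleCat.mono_iff_injective _).2 ?_
           epi_g := (ModuleCat.epi_iff_surjective _).2 ?_ }
  · intro φ hφ
    obtain ⟨φ, rfl⟩ := (leftHom.equiv V₂ X).surjective φ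
    have hφ' : (leftRestrict K Λ).map i ≫ φ = 0 := by
      have h' := (leftHom.map_equiv _ _ _).symm.trans hφ
      rwa [CategoryTheory.Functor.map_id, Category.comp_id] at h'
    refine ⟨leftHom.equiv V₃ X (hL.exact.desc φ hφ'), ?_⟩
    refine (leftHom.map_equiv _ _ _).trans ?_
    rw [CategoryTheory.Functor.map_id, Category.comp_id]
    exact congrArg _ (hL.exact.g_desc _ _)
  · intro φ ψ hφ
    obtain ⟨φ, rfl⟩ := (leftHom.equiv V₃ X).surjective φ
    obtain ⟨ψ, rfl⟩ := (leftHom.equiv V₃ X).surjective ψ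
    have h' := ((leftHom.map_equiv _ _ _).symm.trans hφ).trans (leftHom.map_equiv _ _ _)
    rw [CategoryTheory.Functor.map_id, Category.comp_id, Category.comp_id] at h'
    exact congrArg _ ((cancel_epi ((leftRestrict K Λ).map p)).1 h')
  · intro φ
    obtain ⟨φ, rfl⟩ := (leftHom.equiv V₁ X).surjective φ
    refine ⟨leftHom.equiv V₂ X (σ.r ≫ φ), ?_⟩
    refine (leftHom.map_equiv _ _ _).trans ?_
    have h₁ : (leftRestrict K Λ).map i ≫ σ.r = 𝟙 _ := σ.f_r
    rw [CategoryTheory.Functor.map_id]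
    refine congrArg _ ?_
    refine (congrArg _ (Category.comp_id _)).trans ?_
    refine (Category.assoc _ _ _).symm.trans ?_
    rw [h₁]
    exact Category.id_comp _

end LeftHom

end

end HochschildLocalization

namespace HochschildLocalization

noncomputable section

/-! ### Unit maps and their compatibility with connecting classes -/

section GradedCommutative

open Limits Abelian

universe w v

/-- Dimension shifting reduces this to morphisms and connecting classes. -/
lemma mapExactFunctor_id {C : Type u} [Category.{v} C] [Abelian C] [HasExt.{w} C]
    [EnoughProjectives C] {X Y : C} {n : ℕ} (a : Ext.{w} X Y n) : a.mapExactFunctor (𝟭 C) = a := by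
  induction n generalizing X Y with
  | zero =>
    obtain ⟨f, rfl⟩ := (Ext.mk₀_bijective X Y).2 a
    exact Ext.mapExactFunctor_mk₀ _ _
  | succ n ih =>
    obtain ⟨S, T, f, g, w, h, b, rfl⟩ := exists_connectingClass_comp a
    rw [Ext.mapExactFunctor_comp, ih, mapExactFunctor_connectingClass (𝟭 C) h h]

variable {K Λ : Type u} [Field K] [Ring Λ] [Algebra K Λ]

lemma reg_smul (a : Λ) (b : Λᵐᵒᵖ) (x : Λ) :
    ((a ⊗ₜ b : Env K Λ) • (show reg K Λ from x) : reg K Λ) = (a * x * b.unop : Λ) := by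
  let : Module (Env K Λ) Λ := TensorProduct.Algebra.module
  change (a ⊗ₜ b : Env K Λ) • x = _
  rw [TensorProduct.Algebra.smul_def, MulOpposite.smul_eq_mul_unop, smul_eq_mul, mul_assoc]

/-- Right multiplications, as a map from `Λ` to the left linear endomorphisms of a bimodule. -/
def leftHomUnit (V : Bimod K Λ) : reg K Λ ⟶ leftHom V V :=
  bimodHom
    (AddMonoidHom.mk' (fun x : Λ => leftHom.equiv V V (rightMul V (MulOpposite.op x)))
      (fun x y : Λ => congrArg (leftHom.equiv V V) (rightMul_add V _ _)))
    (fun a b (x : Λ) => by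
      refine Eq.trans ?_ (leftHom.smul_equiv a b (rightMul V (MulOpposite.op x))).symm
      rw [← rightMul_mul, ← rightMul_mul]
      exact congrArg (fun y : Λ => leftHom.equiv V V (rightMul V (MulOpposite.op y)))
        ((reg_smul a b x).trans (mul_assoc a x b.unop)))

/-- Dinaturality of the unit: a bimodule map commutes with right multiplications. -/
lemma leftHomUnit_map {V W : Bimod K Λ} (f : V ⟶ W) :
    leftHomUnit V ≫ leftHom.map (𝟙 V) f = leftHomUnit W ≫ leftHom.map f (𝟙 W) :=
  ModuleCat.hom_ext (LinearMap.ext fun x : Λ => by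
    change leftHom.map (𝟙 V) f (leftHom.equiv V V (rightMul V (MulOpposite.op x))) =
      leftHom.map f (𝟙 W) (leftHom.equiv W W (rightMul W (MulOpposite.op x)))
    rw [leftHom.map_equiv, leftHom.map_equiv]
    simp [rightMul_naturality])

/-- The left linear map from `Λ` to `X` sending `1` to `x`. -/
def leftHomOfElem (X : Bimod K Λ) (x : X) :
    (leftRestrict K Λ).obj (reg K Λ) ⟶ (leftRestrict K Λ).obj X :=
  ModuleCat.ofHom (X := (leftRestrict K Λ).obj (reg K Λ)) (Y := (leftRestrict K Λ).obj X)
    { toFun := fun a : Λ => (a ⊗ₜ 1 : Env K Λ) • x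
      map_add' := fun (a b : Λ) =>
        (congrArg (· • x) (TensorProduct.add_tmul a b (1 : Λᵐᵒᵖ))).trans
          (add_smul (a ⊗ₜ 1 : Env K Λ) (b ⊗ₜ 1 : Env K Λ) x)
      map_smul' := fun (a b : Λ) => by
        have h : ((a ⊗ₜ 1 : Env K Λ) • (show reg K Λ from b) : reg K Λ) = (a * b : Λ) := by
          rw [reg_smul, MulOpposite.unop_one, mul_one]
        refine (congrArg (fun c : Λ => (c ⊗ₜ 1 : Env K Λ) • x) h).trans ?_
        change ((a * b) ⊗ₜ 1 : Env K Λ) • x = (a ⊗ₜ 1 : Env K Λ) • (b ⊗ₜ 1 : Env K Λ) • x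
        rw [smul_smul, Algebra.TensorProduct.tmul_mul_tmul, one_mul] }

lemma leftHom_reg_ext {X : Bimod K Λ}
    {f g : (leftRestrict K Λ).obj (reg K Λ) ⟶ (leftRestrict K Λ).obj X}
    (h : f.hom (1 : Λ) = g.hom (1 : Λ)) : f = g := by
  refine ModuleCat.hom_ext (LinearMap.ext fun a : Λ => ?_)
  have e : ∀ f : (leftRestrict K Λ).obj (reg K Λ) ⟶ (leftRestrict K Λ).obj X,
      f.hom a = a • f.hom (1 : Λ) := fun f => by
    refine Eq.trans (congrArg f.hom ?_) (f.hom.map_smul a (1 : Λ))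
    exact ((reg_smul a 1 1).trans ((mul_one _).trans (mul_one a))).symm
  exact (e f).trans ((congrArg (a • ·) h).trans (e g).symm)

lemma leftHomOfElem_one (X : Bimod K Λ) (x : X) : (leftHomOfElem X x).hom (1 : Λ) = x :=
  one_smul (Env K Λ) x

/-- The natural map from a bimodule `X` to the left linear maps from `Λ` to `X`. -/
def toLeftHomReg (X : Bimod K Λ) : X ⟶ leftHom (reg K Λ) X :=
  bimodHom
    (AddMonoidHom.mk' (fun x => leftHom.equiv _ _ (leftHomOfElem X x))
      (fun x y => congrArg (leftHom.equiv _ _) (leftHom_reg_ext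
        ((leftHomOfElem_one X (x + y)).trans (congrArg₂ (· + ·) (leftHomOfElem_one X x).symm
          (leftHomOfElem_one X y).symm)))))
    (fun a b x => by
      refine Eq.trans ?_ (leftHom.smul_equiv a b (leftHomOfElem X x)).symm
      refine congrArg (leftHom.equiv _ _) (leftHom_reg_ext ?_)
      refine (leftHomOfElem_one _ _).trans ?_
      have h : (rightMul (reg K Λ) (MulOpposite.op a)).hom (1 : Λ) = a :=
        (reg_smul 1 (MulOpposite.op a) 1).trans (by rw [one_mul, one_mul, MulOpposite.unop_op])
      refine Eq.trans ?_ (congrArg (fun c => (rightMul X b).hom ((leftHomOfElem X x).hom c)) h).symm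
      change (a ⊗ₜ b : Env K Λ) • x = (1 ⊗ₜ b : Env K Λ) • (a ⊗ₜ 1 : Env K Λ) • x
      rw [smul_smul, Algebra.TensorProduct.tmul_mul_tmul, one_mul, mul_one])

/-- A left linear endomorphism of Λ is determined by its value at 1. Here the natural isomorphism X
≅ Hom(Λ, X) meets the dinatural unit. -/
lemma toLeftHomReg_reg : toLeftHomReg (reg K Λ) = leftHomUnit (reg K Λ) :=
  ModuleCat.hom_ext (LinearMap.ext fun x : Λ => by
    have h : leftHomOfElem (reg K Λ) x = rightMul (reg K Λ) (MulOpposite.op x) :=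
      leftHom_reg_ext ((leftHomOfElem_one (reg K Λ) x).trans
        ((reg_smul 1 (MulOpposite.op x) 1).trans
          (by rw [one_mul, one_mul, MulOpposite.unop_op])).symm)
    exact congrArg (leftHom.equiv _ _) h)

lemma toLeftHomReg_naturality {X Y : Bimod K Λ} (f : X ⟶ Y) :
    f ≫ toLeftHomReg Y = toLeftHomReg X ≫ leftHom.map (𝟙 _) f :=
  ModuleCat.hom_ext (LinearMap.ext fun x => congrArg (leftHom.equiv _ _) (leftHom_reg_ext
    ((leftHomOfElem_one _ _).trans (congrArg f.hom (leftHomOfElem_one X x)).symm)))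

instance (X : Bimod K Λ) : IsIso (toLeftHomReg X) := by
  rw [ConcreteCategory.isIso_iff_bijective]
  refine ⟨fun x y h => ?_, fun φ => ?_⟩
  · exact (leftHomOfElem_one X x).symm.trans
      ((congrArg (fun f => f.hom (1 : Λ)) ((leftHom.equiv _ _).injective h)).trans
        (leftHomOfElem_one X y))
  · obtain ⟨φ, rfl⟩ := (leftHom.equiv _ _).surjective φ
    exact ⟨φ.hom (1 : Λ), congrArg (leftHom.equiv _ _) (leftHom_reg_ext (leftHomOfElem_one X _))⟩

instance (V : Bimod K Λ) [Projective ((leftRestrict K Λ).obj V)] :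
    PreservesFiniteLimits (leftHomFunctor V) := by
  have h := ((CategoryTheory.Functor.exact_tfae (leftHomFunctor V)).out 0 3).mp
    (fun S hS => shortExact_leftHom_right hS _)
  exact h.1

instance (V : Bimod K Λ) [Projective ((leftRestrict K Λ).obj V)] :
    PreservesFiniteColimits (leftHomFunctor V) := by
  have h := ((CategoryTheory.Functor.exact_tfae (leftHomFunctor V)).out 0 3).mp
    (fun S hS => shortExact_leftHom_right hS _)
  exact h.2

section

variable {V' V V'' : Bimod K Λ} {i : V' ⟶ V} {p : V ⟶ V''} {w : i ≫ p = 0}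

lemma leftHom_comp_eq_zero (w : i ≫ p = 0) (X : Bimod K Λ) :
    leftHom.map p (𝟙 X) ≫ leftHom.map i (𝟙 X) = 0 := by
  rw [leftHom.map_comp_map, w, leftHom.map_zero_left]

lemma leftHom_comp_eq_zero' (w : i ≫ p = 0) (X : Bimod K Λ) :
    leftHom.map (𝟙 X) i ≫ leftHom.map (𝟙 X) p = 0 := by
  rw [leftHom.map_comp_map, w, leftHom.map_zero_right]

/-- Both sides measure the failure of a sequence of bimodules, split over left modules, to split
over bimodules: one through sections σ of p, the other through retractions of i. A section
determines the retraction 1 - σ p, and its minus sign is the sign of the statement. -/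
lemma leftHomUnit_comp_connectingClass
    (h₁ : (ShortComplex.mk _ _ (leftHom_comp_eq_zero' w V'')).ShortExact)
    (h₂ : (ShortComplex.mk _ _ (leftHom_comp_eq_zero w V')).ShortExact)
    (hV : (ShortComplex.mk _ _ (leftHom_comp_eq_zero' w V)).ShortExact)
    (hV' : Mono (leftHom.map (𝟙 V') i)) :
    (Ext.mk₀ (leftHomUnit V'')).comp (connectingClass h₁) (zero_add 1) =
      -(Ext.mk₀ (leftHomUnit V')).comp (connectingClass h₂) (zero_add 1) := by
  have : Mono (leftHom.map (𝟙 V) i) := hV.mono_f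
  -- E consists of pairs (σ, x), with σ : V'' → V left linear lifting right multiplication by x.
  let E := pullback (leftHom.map (𝟙 V'') p) (leftHomUnit V'')
  let a : E ⟶ leftHom V'' V := pullback.fst _ _
  let b : E ⟶ reg K Λ := pullback.snd _ _
  have hab : a ≫ leftHom.map (𝟙 V'') p = b ≫ leftHomUnit V'' := pullback.condition
  let j : leftHom V'' V' ⟶ E := pullback.lift (leftHom.map (𝟙 V'') i) 0
    (by rw [leftHom_comp_eq_zero' w, zero_comp])
  have ja : j ≫ a = leftHom.map (𝟙 V'') i := pullback.lift_fst _ _ _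
  have jb : j ≫ b = 0 := pullback.lift_snd _ _ _
  have hE : (ShortComplex.mk j b jb).ShortExact := by
    have : Mono (leftHom.map (𝟙 V'') i) := h₁.mono_f
    have : Epi (leftHom.map (𝟙 V'') p) := h₁.epi_g
    have : Mono (j ≫ a) := by rw [ja]; infer_instance
    have : Mono j := mono_of_mono j a
    have : Epi b := inferInstanceAs (Epi (pullback.snd _ _))
    refine { exact := ?_, mono_f := ‹_›, epi_g := ‹_› }
    refine ShortComplex.exact_of_f_is_kernel _ (KernelFork.IsLimit.ofι' _ _ fun k hk => ?_)
    have hk' : (k ≫ a) ≫ leftHom.map (𝟙 V'') p = 0 := by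
      rw [Category.assoc, hab, reassoc_of% hk, zero_comp]
    refine ⟨h₁.exact.lift (k ≫ a) hk', pullback.hom_ext ?_ ?_⟩
    · refine (Category.assoc _ _ _).trans ((congrArg _ ja).trans (h₁.exact.lift_f _ _))
    · refine (Category.assoc _ _ _).trans ((congrArg _ jb).trans ?_)
      rw [comp_zero]
      exact hk.symm
  -- Sends (σ, x) to v ↦ v x - σ(p v), which lands in V'. On V' it is right multiplication by x.
  let c : E ⟶ leftHom V V' := hV.exact.lift (b ≫ leftHomUnit V - a ≫ leftHom.map p (𝟙 V)) (by
    change (b ≫ leftHomUnit V - a ≫ leftHom.map p (𝟙 V)) ≫ leftHom.map (𝟙 V) p = 0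
    rw [Preadditive.sub_comp, Category.assoc, Category.assoc, leftHomUnit_map,
      leftHom.map_comp_map, sub_eq_zero, ← reassoc_of% hab, leftHom.map_comp_map]
    simp)
  have hc : c ≫ leftHom.map (𝟙 V) i = b ≫ leftHomUnit V - a ≫ leftHom.map p (𝟙 V) :=
    hV.exact.lift_f _ _
  have e₁ := connectingClass_naturality hE h₁ (𝟙 _) a (leftHomUnit V'')
    ((Category.id_comp _).trans ja.symm) hab
  have e₂ := connectingClass_naturality hE h₂ (-𝟙 _) c (leftHomUnit V')
    (by
      rw [← cancel_mono (leftHom.map (𝟙 V) i), Category.assoc, Category.assoc, hc,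
        Preadditive.comp_sub, reassoc_of% jb, reassoc_of% ja, leftHom.map_comp_map,
        leftHom.map_comp_map]
      simp)
    (by
      rw [← cancel_mono (leftHom.map (𝟙 V') i), Category.assoc, Category.assoc,
        leftHomUnit_map]
      have e : leftHom.map i (𝟙 V') ≫ leftHom.map (𝟙 V') i =
          leftHom.map (𝟙 V) i ≫ leftHom.map i (𝟙 V) := by
        rw [leftHom.map_comp_map, leftHom.map_comp_map]
        simp
      rw [e, reassoc_of% hc, Preadditive.sub_comp, Category.assoc, Category.assoc,
        leftHom_comp_eq_zero w, comp_zero, sub_zero])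
  rw [Ext.comp_mk₀_id] at e₁
  rw [Ext.mk₀_neg, Ext.comp_neg, Ext.comp_mk₀_id] at e₂
  rw [← e₁, ← e₂, neg_neg]

end

end GradedCommutative

end

end HochschildLocalization

namespace HochschildLocalization

noncomputable section

/-! ### Graded commutativity of Hochschild cohomology -/

section GradedCommutative

open Limits Abelian

variable {K Λ : Type u} [Field K] [Ring Λ] [Algebra K Λ]

/-- An additive isomorphism commuting with the action, as an isomorphism of modules. -/
def isoOfAddEquiv {A : Type*} [Ring A] {X Y : ModuleCat.{u} A} (e : X ≃+ Y)
    (h : ∀ (a : A) (x : X), e (a • x) = a • e x) : X ≅ Y :=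
  LinearEquiv.toModuleIso (X₁ := X) (X₂ := Y) { e with map_smul' := h }

/-- The right adjoint Hom_A(B, -) preserves epimorphisms because B is projective over A. -/
lemma preservesProjectiveObjects_restrictScalars {A B : Type u} [Ring A] [Ring B] (f : A →+* B)
    [Projective ((ModuleCat.restrictScalars.{u} f).obj (ModuleCat.of B B))] :
    (ModuleCat.restrictScalars.{u} f).PreservesProjectiveObjects := by
  have : (ModuleCat.coextendScalars.{u, u, u} f).PreservesEpimorphisms :=
    { preserves := fun {X Y} g _ => by
        refine (ModuleCat.epi_iff_surjective _).2 fun φ => ?_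
        let φ' : (ModuleCat.restrictScalars.{u} f).obj (ModuleCat.of B B) ⟶ Y :=
          ModuleCat.ofHom (X := (ModuleCat.restrictScalars.{u} f).obj (ModuleCat.of B B))
            (Y := Y) (ModuleCat.CoextendScalars.equiv f Y φ)
        refine ⟨(ModuleCat.CoextendScalars.equiv f X).symm (Projective.factorThru φ' g).hom, ?_⟩
        refine (ModuleCat.CoextendScalars.equiv f Y).injective ?_
        exact congrArg ModuleCat.Hom.hom (Projective.factorThru_comp φ' g) }
  exact CategoryTheory.Functor.preservesProjectiveObjects_of_adjunction_of_preservesEpimorphisms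
    (ModuleCat.restrictCoextendScalarsAdj.{u, u, u} f)

variable (K Λ) in
/-- The underlying right module of a bimodule. -/
abbrev rightRestrict : Bimod K Λ ⥤ ModuleCat.{u} Λᵐᵒᵖ :=
  ModuleCat.restrictScalars
    ((Algebra.TensorProduct.includeRight : Λᵐᵒᵖ →ₐ[K] Env K Λ) : Λᵐᵒᵖ →+* Env K Λ)

instance projective_leftRestrict_env :
    Projective ((leftRestrict K Λ).obj (ModuleCat.of (Env K Λ) (Env K Λ))) := by
  have : Module.Free Λ (Λ ⊗[K] Λᵐᵒᵖ) :=
    Module.Free.of_basis (Algebra.TensorProduct.basis Λ (Module.Free.chooseBasis K Λᵐᵒᵖ))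
  have : Projective (ModuleCat.of Λ (Λ ⊗[K] Λᵐᵒᵖ)) :=
    (IsProjective.iff_projective (R := Λ) (Λ ⊗[K] Λᵐᵒᵖ)).1 inferInstance
  refine Projective.of_iso (P := ModuleCat.of Λ (Λ ⊗[K] Λᵐᵒᵖ)) (isoOfAddEquiv
    (Y := (leftRestrict K Λ).obj (ModuleCat.of (Env K Λ) (Env K Λ)))
    (AddEquiv.refl (Env K Λ)) fun (a : Λ) (x : Env K Λ) => ?_) this
  change a • x = (a ⊗ₜ 1 : Env K Λ) * x
  induction x using TensorProduct.induction_on with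
  | zero => rw [smul_zero, mul_zero]
  | tmul x y => rw [TensorProduct.smul_tmul', smul_eq_mul, Algebra.TensorProduct.tmul_mul_tmul,
      one_mul]
  | add x y hx hy => rw [smul_add, mul_add, hx, hy]

instance projective_rightRestrict_env :
    Projective ((rightRestrict K Λ).obj (ModuleCat.of (Env K Λ) (Env K Λ))) := by
  have : Module.Free Λᵐᵒᵖ (Λᵐᵒᵖ ⊗[K] Λ) :=
    Module.Free.of_basis (Algebra.TensorProduct.basis Λᵐᵒᵖ (Module.Free.chooseBasis K Λ))
  have : Projective (ModuleCat.of Λᵐᵒᵖ (Λᵐᵒᵖ ⊗[K] Λ)) :=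
    (IsProjective.iff_projective (R := Λᵐᵒᵖ) (Λᵐᵒᵖ ⊗[K] Λ)).1 inferInstance
  refine Projective.of_iso (P := ModuleCat.of Λᵐᵒᵖ (Λᵐᵒᵖ ⊗[K] Λ)) (isoOfAddEquiv
    (Y := (rightRestrict K Λ).obj (ModuleCat.of (Env K Λ) (Env K Λ)))
    (TensorProduct.comm K Λᵐᵒᵖ Λ).toAddEquiv fun (a : Λᵐᵒᵖ) (x : Λᵐᵒᵖ ⊗[K] Λ) => ?_) this
  change TensorProduct.comm K Λᵐᵒᵖ Λ (a • x) =
    (1 ⊗ₜ a : Env K Λ) * TensorProduct.comm K Λᵐᵒᵖ Λ x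
  induction x using TensorProduct.induction_on with
  | zero => rw [smul_zero, map_zero, mul_zero]
  | tmul x y => rw [TensorProduct.smul_tmul', smul_eq_mul, TensorProduct.comm_tmul,
      TensorProduct.comm_tmul, Algebra.TensorProduct.tmul_mul_tmul, one_mul]
  | add x y hx hy => rw [smul_add, map_add, map_add, mul_add, hx, hy]

instance : (leftRestrict K Λ).PreservesProjectiveObjects :=
  preservesProjectiveObjects_restrictScalars _

instance : (rightRestrict K Λ).PreservesProjectiveObjects :=
  preservesProjectiveObjects_restrictScalars _

instance projective_leftRestrict_reg : Projective ((leftRestrict K Λ).obj (reg K Λ)) := by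
  have : Projective (ModuleCat.of Λ Λ) := (IsProjective.iff_projective (R := Λ) Λ).1 inferInstance
  refine Projective.of_iso (P := ModuleCat.of Λ Λ) (isoOfAddEquiv
    (Y := (leftRestrict K Λ).obj (reg K Λ)) (AddEquiv.refl Λ) fun (a x : Λ) => ?_) this
  exact ((reg_smul a 1 x).trans (by rw [MulOpposite.unop_one, mul_one]; rfl)).symm

instance projective_rightRestrict_reg : Projective ((rightRestrict K Λ).obj (reg K Λ)) := by
  have : Projective (ModuleCat.of Λᵐᵒᵖ Λᵐᵒᵖ) :=
    (IsProjective.iff_projective (R := Λᵐᵒᵖ) Λᵐᵒᵖ).1 inferInstance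
  refine Projective.of_iso (P := ModuleCat.of Λᵐᵒᵖ Λᵐᵒᵖ) (isoOfAddEquiv
    (Y := (rightRestrict K Λ).obj (reg K Λ)) (MulOpposite.opAddEquiv : Λ ≃+ Λᵐᵒᵖ).symm
    fun (a x : Λᵐᵒᵖ) => ?_) this
  exact ((reg_smul 1 a x.unop).trans (by rw [one_mul]; rfl)).symm

/-- A family of iterated kernels of epimorphisms from projective bimodules, starting at `X`. -/
def iterKernel (X : Bimod K Λ) : ℕ → Bimod K Λ
  | 0 => X
  | n + 1 => kernel (Projective.π (iterKernel X n))

/-- The inclusion of an iterated kernel into a projective bimodule. -/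
def iterKernelι (X : Bimod K Λ) (n : ℕ) :
    iterKernel X (n + 1) ⟶ Projective.over (iterKernel X n) :=
  kernel.ι _

lemma iterKernelι_π (X : Bimod K Λ) (n : ℕ) : iterKernelι X n ≫ Projective.π (iterKernel X n) = 0 :=
  kernel.condition _

lemma shortExact_iterKernel (X : Bimod K Λ) (n : ℕ) :
    (ShortComplex.mk _ _ (iterKernelι_π X n)).ShortExact :=
  { exact := ShortComplex.exact_kernel _
    mono_f := inferInstanceAs (Mono (kernel.ι _)) }

instance projective_iterKernel (n : ℕ) :
    Projective ((leftRestrict K Λ).obj (iterKernel (reg K Λ) n)) := by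
  induction n with
  | zero => exact inferInstanceAs (Projective ((leftRestrict K Λ).obj (reg K Λ)))
  | succ n ih =>
    have h := (shortExact_iterKernel (reg K Λ) n).map_of_exact (leftRestrict K Λ)
    have : Projective ((ShortComplex.mk _ _ (iterKernelι_π (reg K Λ) n)).map
      (leftRestrict K Λ)).X₃ := ih
    have σ := h.splittingOfProjective
    exact Retract.projective (Y := (leftRestrict K Λ).obj (Projective.over (iterKernel (reg K Λ) n)))
      ⟨_, σ.r, σ.f_r⟩

variable (K Λ) in
/-- The Yoneda product of the classes of the short exact sequences of iterated kernels. -/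
def iterClass : ∀ n : ℕ, Ext.{u} (reg K Λ) (iterKernel (reg K Λ) n) n
  | 0 => Ext.mk₀ (𝟙 _)
  | n + 1 => (iterClass n).comp (connectingClass (shortExact_iterKernel _ n)) rfl

/-- Dimension shifting n times; for k = 0, a class of degree n becomes a morphism out of the n-th
iterated kernel. -/
lemma exists_iterClass_comp {Y : Bimod K Λ} (n : ℕ) {k m : ℕ} (h : n + k = m)
    (a : Ext.{u} (reg K Λ) Y m) :
    ∃ b : Ext.{u} (iterKernel (reg K Λ) n) Y k, a = (iterClass K Λ n).comp b h := by
  induction n generalizing k with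
  | zero =>
    obtain rfl : k = m := by lia
    exact ⟨a, (Ext.mk₀_id_comp a).symm⟩
  | succ n ih =>
    obtain ⟨b, rfl⟩ := ih (k := k + 1) (by lia)
    obtain ⟨c, rfl⟩ := Ext.contravariant_sequence_exact₃ (shortExact_iterKernel (reg K Λ) n) Y b
      (Ext.eq_zero_of_projective _) (Nat.add_comm 1 k)
    exact ⟨c, (Ext.comp_assoc _ _ _ _ _ (by lia)).symm⟩

lemma shortExact_leftHom_iterKernel (X : Bimod K Λ) (n : ℕ) :
    (ShortComplex.mk _ _ (leftHom_comp_eq_zero (iterKernelι_π (reg K Λ) n) X)).ShortExact :=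
  shortExact_leftHom_left (shortExact_iterKernel _ n) _

/-- The classes obtained from `iterClass` by applying the functor of left linear maps to `X`. -/
def iterCoclass (X : Bimod K Λ) : ∀ n : ℕ,
    Ext.{u} (leftHom (iterKernel (reg K Λ) n) X) (leftHom (reg K Λ) X) n
  | 0 => Ext.mk₀ (𝟙 _)
  | n + 1 => (connectingClass (shortExact_leftHom_iterKernel X n)).comp (iterCoclass X n)
      (Nat.add_comm 1 n)

/-- A product of n connecting families of degree 1; their Koszul signs multiply. -/
lemma isGradedNatural_iterCoclass (n : ℕ) :
    IsGradedNatural (leftHomFunctor (iterKernel (reg K Λ) n)) (leftHomFunctor (reg K Λ))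
      (fun X => iterCoclass X n) := by
  induction n with
  | zero => exact .of_natTrans (𝟙 (leftHomFunctor (reg K Λ)))
  | succ n ih =>
    have : Projective ((leftRestrict K Λ).obj (Projective.over (iterKernel (reg K Λ) n))) :=
      inferInstance
    exact (IsGradedNatural.connecting (α := leftHomPrecomp (Projective.π (iterKernel (reg K Λ) n)))
      (β := leftHomPrecomp (iterKernelι (reg K Λ) n))
      (fun X => leftHom_comp_eq_zero (iterKernelι_π (reg K Λ) n) X)
      (fun X => shortExact_leftHom_iterKernel X n)).comp ih (Nat.add_comm 1 n)

/-- The map on `Ext` groups induced by the functor of left linear maps out of `V`. -/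
def mapLeftHom (V : Bimod K Λ) [Projective ((leftRestrict K Λ).obj V)] {X Y : Bimod K Λ} {n : ℕ}
    (a : Ext.{u} X Y n) : Ext.{u} (leftHom V X) (leftHom V Y) n :=
  a.mapExactFunctor (leftHomFunctor V)

section

variable (V : Bimod K Λ) [Projective ((leftRestrict K Λ).obj V)]

lemma mapLeftHom_mk₀ {X Y : Bimod K Λ} (f : X ⟶ Y) :
    mapLeftHom V (Ext.mk₀ f) = Ext.mk₀ (leftHom.map (𝟙 V) f) :=
  Ext.mapExactFunctor_mk₀ _ _

lemma mapLeftHom_comp {X Y Z : Bimod K Λ} {m n p : ℕ} (a : Ext.{u} X Y m) (b : Ext.{u} Y Z n)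
    (h : m + n = p) :
    mapLeftHom V (a.comp b h) = (mapLeftHom V a).comp (mapLeftHom V b) h :=
  Ext.mapExactFunctor_comp _ _ _ _

lemma mapLeftHom_connectingClass {X Y Z : Bimod K Λ} {f : X ⟶ Y} {g : Y ⟶ Z} {w : f ≫ g = 0}
    (h : (ShortComplex.mk f g w).ShortExact) :
    mapLeftHom V (connectingClass h) =
      connectingClass (shortExact_leftHom_right (V := V) h (leftHom_comp_eq_zero' w V)) :=
  Ext.mapExactFunctor_extClass (leftHomFunctor V) h

lemma toLeftHomReg_mapLeftHom {X Y : Bimod K Λ} {n : ℕ} (a : Ext.{u} X Y n) :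
    a.comp (Ext.mk₀ (toLeftHomReg Y)) (add_zero n) =
      (Ext.mk₀ (toLeftHomReg X)).comp (mapLeftHom (reg K Λ) a) (zero_add n) := by
  have h := IsGradedNatural.of_natTrans (F := 𝟭 (Bimod K Λ)) (G := leftHomFunctor (reg K Λ))
    { app := toLeftHomReg, naturality := fun _ _ f => toLeftHomReg_naturality f } a n (add_zero n)
  rw [mapExactFunctor_id, zero_mul, pow_zero, one_smul] at h
  exact h

lemma leftHom_map_mapLeftHom {V W : Bimod K Λ} [Projective ((leftRestrict K Λ).obj V)]
    [Projective ((leftRestrict K Λ).obj W)] (g : V ⟶ W) {X Y : Bimod K Λ} {n : ℕ}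
    (a : Ext.{u} X Y n) :
    (mapLeftHom W a).comp (Ext.mk₀ (leftHom.map g (𝟙 Y))) (add_zero n) =
      (Ext.mk₀ (leftHom.map g (𝟙 X))).comp (mapLeftHom V a) (zero_add n) := by
  have h := IsGradedNatural.of_natTrans (leftHomPrecomp g) a n (add_zero n)
  rw [zero_mul, pow_zero, one_smul] at h
  exact h

lemma iterCoclass_mapLeftHom (n : ℕ) {X Y : Bimod K Λ} {m k : ℕ} (a : Ext.{u} X Y m)
    (h : m + n = k) :
    (mapLeftHom (iterKernel (reg K Λ) n) a).comp (iterCoclass Y n) h =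
      ((-1) ^ (n * m) : ℤ) • (iterCoclass X n).comp (mapLeftHom (reg K Λ) a)
        ((Nat.add_comm n m).trans h) :=
  isGradedNatural_iterCoclass n a k h

end

/-- Transfers `iterClass`, a class between covariant arguments, to the contravariant `iterCoclass`.
The value of k does not matter: it involves no further class and cancels in `graded_commutative`. -/
lemma leftHomUnit_comp_iterClass (n : ℕ) : ∃ k : ℕ,
    (Ext.mk₀ (leftHomUnit (reg K Λ))).comp (mapLeftHom (reg K Λ) (iterClass K Λ n)) (zero_add n) =
    ((-1) ^ k : ℤ) • (Ext.mk₀ (leftHomUnit (iterKernel (reg K Λ) n))).comp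
      (iterCoclass (iterKernel (reg K Λ) n) n) (zero_add n) := by
  induction n with
  | zero =>
    refine ⟨0, ?_⟩
    rw [pow_zero, one_smul]
    refine (congrArg (fun z => (Ext.mk₀ (leftHomUnit (reg K Λ))).comp z (zero_add 0))
      ((mapLeftHom_mk₀ (reg K Λ) (𝟙 (reg K Λ))).trans (congrArg _ (leftHom.map_id_id _ _)))).trans ?_
    rfl
  | succ n ih =>
    obtain ⟨k, hk⟩ := ih
    -- The new sign (-1)ⁿ comes from moving a class of degree 1 past `iterCoclass`, and the last
    -- factor -1 from `leftHomUnit_comp_connectingClass`.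
    refine ⟨k + n + 1, ?_⟩
    have hn := shortExact_iterKernel (reg K Λ) n
    have : Projective ((leftRestrict K Λ).obj (Projective.over (iterKernel (reg K Λ) n))) :=
      inferInstance
    have h₂ := iterCoclass_mapLeftHom n (connectingClass hn) (Nat.add_comm 1 n)
    have h₃ := leftHomUnit_comp_connectingClass (w := iterKernelι_π _ n)
      (shortExact_leftHom_right (V := iterKernel (reg K Λ) n) hn
        (leftHom_comp_eq_zero' (iterKernelι_π _ n) _))
      (shortExact_leftHom_iterKernel (iterKernel (reg K Λ) (n + 1)) n)
      (shortExact_leftHom_right (V := Projective.over (iterKernel (reg K Λ) n)) hn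
        (leftHom_comp_eq_zero' (iterKernelι_π _ n) _))
      (shortExact_leftHom_right (V := iterKernel (reg K Λ) (n + 1)) hn
        (leftHom_comp_eq_zero' (iterKernelι_π _ n) _)).mono_f
    rw [← mapLeftHom_connectingClass _ hn] at h₃
    rw [iterCoclass, ← Ext.comp_assoc (a₁₂ := 1) _ _ _ (by lia) (by lia) (by lia),
      ← neg_eq_iff_eq_neg.2 h₃, Ext.neg_comp,
      Ext.comp_assoc (a₂₃ := n + 1) _ _ _ (by lia) (by lia) (by lia), h₂, comp_zsmul, iterClass,
      mapLeftHom_comp, ← Ext.comp_assoc (a₁₂ := n) _ _ _ (by lia) (by lia) (by lia), hk,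
      zsmul_comp, Ext.comp_assoc (a₂₃ := n + 1) _ _ _ (by lia) (by lia) (by lia), smul_neg, smul_smul,
      ← neg_smul]
    congr 1
    rw [mul_one, pow_add, pow_add, pow_one, mul_neg_one, neg_mul, neg_neg, mul_assoc,
      ← mul_pow, neg_one_mul, neg_neg, one_pow, mul_one]

/-- Hochschild cohomology is graded commutative. -/
theorem graded_commutative {m n : ℕ} (a : HHn (reg K Λ) m) (b : HHn (reg K Λ) n) :
    a.comp b rfl = ((-1) ^ (n * m) : ℤ) • b.comp a (Nat.add_comm n m) := by
  obtain ⟨c, rfl⟩ := exists_iterClass_comp n (add_zero n) b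
  obtain ⟨g, rfl⟩ := (Ext.mk₀_bijective _ _).2 c
  obtain ⟨k, hk⟩ := leftHomUnit_comp_iterClass (K := K) (Λ := Λ) n
  let ι := Ext.mk₀ (toLeftHomReg (reg K Λ))
  let γ := Ext.mk₀ (leftHom.map g (𝟙 (reg K Λ)))
  let η := γ.comp (iterCoclass (reg K Λ) n) (zero_add n)
  -- Under Λ ≅ Hom(Λ, Λ), the class b becomes, up to a sign, the value `η` at Λ of a family acting
  -- through the contravariant variable.
  have key : ((iterClass K Λ n).comp (Ext.mk₀ g) (add_zero n)).comp ι (add_zero n) =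
      ((-1) ^ k : ℤ) • ι.comp η (zero_add n) := by
    have h₁ := iterCoclass_mapLeftHom n (Ext.mk₀ g) (zero_add n)
    rw [mul_zero, pow_zero, one_smul, mapLeftHom_mk₀, mapLeftHom_mk₀] at h₁
    rw [toLeftHomReg_mapLeftHom, mapLeftHom_comp,
      ← Ext.comp_assoc (a₁₂ := n) _ _ _ (by lia) (by lia) (by lia), toLeftHomReg_reg, hk,
      zsmul_comp, Ext.comp_assoc (a₂₃ := n) _ _ _ (by lia) (by lia) (by lia), mapLeftHom_mk₀,
      ← h₁, ← Ext.comp_assoc (a₁₂ := 0) _ _ _ (by lia) (by lia) (by lia), Ext.mk₀_comp_mk₀,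
      leftHomUnit_map, ← Ext.mk₀_comp_mk₀,
      Ext.comp_assoc (a₂₃ := n) _ _ _ (by lia) (by lia) (by lia), ← toLeftHomReg_reg]
  -- The class a acts through the covariant variable, so graded naturality makes it commute with `η`
  -- up to the Koszul sign.
  have comm : (mapLeftHom (reg K Λ) a).comp η rfl =
      ((-1) ^ (n * m) : ℤ) • η.comp (mapLeftHom (reg K Λ) a) (Nat.add_comm n m) := by
    rw [← Ext.comp_assoc (a₁₂ := m) _ _ _ (by lia) (by lia) (by lia), leftHom_map_mapLeftHom,
      Ext.comp_assoc (a₂₃ := m + n) _ _ _ (by lia) (by lia) (by lia),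
      iterCoclass_mapLeftHom n a rfl, comp_zsmul,
      ← Ext.comp_assoc (a₁₂ := n) _ _ _ (by lia) (by lia) (by lia)]
  have inj : ∀ {p : ℕ} (x y : HHn (reg K Λ) p),
      x.comp ι (add_zero p) = y.comp ι (add_zero p) → x = y := fun x y h => by
    have h' := congrArg (fun z => z.comp (Ext.mk₀ (inv (toLeftHomReg (reg K Λ)))) (add_zero _)) h
    simpa [ι, Ext.comp_assoc_of_third_deg_zero] using h'
  apply inj
  rw [Ext.comp_assoc (a₂₃ := n) _ _ _ (by lia) (by lia) (by lia), key, comp_zsmul,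
    ← Ext.comp_assoc (a₁₂ := m) _ _ _ (by lia) (by lia) (by lia), toLeftHomReg_mapLeftHom,
    Ext.comp_assoc (a₂₃ := m + n) _ _ _ (by lia) (by lia) (by lia), comm, comp_zsmul,
    ← Ext.comp_assoc (a₁₂ := n) _ _ _ (by lia) (by lia) (by lia), smul_comm, ← zsmul_comp, ← key,
    zsmul_comp, Ext.comp_assoc (a₂₃ := m) _ _ _ (by lia) (by lia) (by lia),
    Ext.comp_assoc (a₂₃ := m) _ a _ (by lia) (by lia) (by lia), toLeftHomReg_mapLeftHom]

end GradedCommutative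

end

end HochschildLocalization

namespace HochschildLocalization

noncomputable section

/-! ### Syzygies and one-sided splittings -/

section Syzygies

open Limits

variable {C D : Type*} [Category* C] [Abelian C] [Category* D] [Abelian D]
  {X : C} (R : ProjectiveResolution X)

lemma fromOpcycles_pOpcycles (n : ℕ) :
    R.complex.fromOpcycles (n + 1) n ≫ R.complex.pOpcycles n = 0 := by
  rw [← cancel_epi (R.complex.pOpcycles (n + 1)), HomologicalComplex.p_fromOpcycles_assoc,
    HomologicalComplex.d_pOpcycles, comp_zero]

/-- The short exact sequences `0 → Ωⁿ⁺¹ → Rₙ → Ωⁿ → 0` of a projective resolution. -/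
lemma shortExact_fromOpcycles (n : ℕ) :
    (ShortComplex.mk _ _ (fromOpcycles_pOpcycles R n)).ShortExact := by
  have hmono : Mono (R.complex.fromOpcycles (n + 1) n) :=
    Preadditive.mono_of_isZero_kernel' _
      (R.complex.homologyIsKernel (n + 1) n (by simp)) (R.complex_exactAt_succ n).isZero_homology
  have hex : (ShortComplex.mk _ _ (R.complex.d_pOpcycles (n + 1) n)).Exact :=
    ShortComplex.exact_of_g_is_cokernel _ (R.complex.opcyclesIsCokernel (n + 1) n (by simp))
  refine { exact := ?_, mono_f := hmono, epi_g := inferInstanceAs (Epi (R.complex.pOpcycles n)) }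
  rw [ShortComplex.exact_iff_exact_up_to_refinements] at hex ⊢
  intro A x hx
  obtain ⟨A', π, hπ, y, hy⟩ := hex x hx
  exact ⟨A', π, hπ, y ≫ R.complex.pOpcycles (n + 1), by
    simpa [HomologicalComplex.p_fromOpcycles] using hy⟩

/-- The zeroth syzygy is the resolved object. -/
def opcyclesZeroIso : R.complex.opcycles 0 ≅ X :=
  (R.complex.opcyclesIsCokernel 1 0 (by simp)).coconePointUniqueUpToIso R.isColimitCokernelCofork

variable (F : C ⥤ D) [F.Additive] [PreservesFiniteLimits F] [PreservesFiniteColimits F]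
  [F.PreservesProjectiveObjects]

include F in
-- Applied with F the restriction to left or to right modules: when the quotient of 0 → Ωⁿ⁺¹ → Rₙ →
-- Ωⁿ → 0 becomes projective, the sequence splits and the next syzygy is a retract of a projective.
lemma projective_map_opcycles [Projective (F.obj X)] (n : ℕ) :
    Projective (F.obj (R.complex.opcycles n)) := by
  induction n with
  | zero => exact Projective.of_iso (F.mapIso (opcyclesZeroIso R)).symm inferInstance
  | succ n ih =>
    have h := (shortExact_fromOpcycles R n).map_of_exact F
    have : Projective ((ShortComplex.mk _ _ (fromOpcycles_pOpcycles R n)).map F).X₃ := ih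
    have σ := h.splittingOfProjective
    exact Retract.projective (Y := F.obj (R.complex.X n)) ⟨_, σ.r, σ.f_r⟩

lemma exists_map_fromOpcycles_comp [Projective (F.obj X)] (n : ℕ) :
    ∃ r : F.obj (R.complex.X n) ⟶ F.obj (R.complex.opcycles (n + 1)),
      F.map (R.complex.fromOpcycles (n + 1) n) ≫ r = 𝟙 _ := by
  have h := (shortExact_fromOpcycles R n).map_of_exact F
  have : Projective ((ShortComplex.mk _ _ (fromOpcycles_pOpcycles R n)).map F).X₃ :=
    projective_map_opcycles R F n
  have σ := h.splittingOfProjective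
  exact ⟨σ.r, σ.f_r⟩

end Syzygies

end

end HochschildLocalization

namespace HochschildLocalization

noncomputable section

/-! ### Casimir elements and injectivity of projective modules -/

section Casimir

variable (K : Type u) [Field K]

/-- A `K`-algebra `B` admits Casimir elements `cᵢ ∈ B ⊗ B` together with linear endomorphisms `βᵢ`
such that `∑ᵢ uᵢ βᵢ(vᵢ) = 1`, where `cᵢ = uᵢ ⊗ vᵢ` (a sum being understood). -/
def HasCasimirSplitting (B : Type u) [Ring B] [Algebra K B] : Prop :=
  ∃ (ι : Type u) (_ : Fintype ι) (c : ι → B ⊗[K] B) (β : ι → B →ₗ[K] B),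
    (∀ i b, (b ⊗ₜ 1) * c i = c i * (1 ⊗ₜ b)) ∧
      ∑ i, LinearMap.mul' K B ((β i).lTensor B (c i)) = 1

variable {K}

/-- The coordinates of q in a dual basis of Q inherit the relation l(b) q = r(b) q, so they are
Casimir elements. Applying ρ to the expansion of q in that basis gives the normalization, since ρ(q)
= 1. -/
lemma HasCasimirSplitting.of_projective {B E Q : Type u} [Ring B] [Algebra K B] [Ring E]
    [Algebra K E] [AddCommGroup Q] [Module E Q] [Module K Q] [IsScalarTower K E Q]
    [Module.Projective E Q] (e : E ≃ₗ[K] B ⊗[K] B) (l r : B → E)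
    (hl : ∀ b z, e (l b * z) = (b ⊗ₜ 1) * e z) (hr : ∀ b z, e (r b * z) = e z * (1 ⊗ₜ b))
    (q : Q) (hq : ∀ b, l b • q = r b • q) (ρ : Q →+ B) (hρ : ∀ b x, ρ (l b • x) = b * ρ x)
    (hρq : ρ q = 1) : HasCasimirSplitting K B := by
  obtain ⟨t, ht⟩ := Module.projective_def'.1 ‹Module.Projective E Q›
  have hlK : ∀ k : K, l (algebraMap K B k) = algebraMap K E k := fun k => e.injective (by
    rw [← mul_one (l _), hl, Algebra.algebraMap_eq_smul_one, ← TensorProduct.smul_tmul',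
      smul_mul_assoc, ← Algebra.TensorProduct.one_def, one_mul, Algebra.algebraMap_eq_smul_one,
      map_smul])
  have hρK : ∀ (k : K) (x : Q), ρ (k • x) = k • ρ x := fun k x => by
    rw [← algebraMap_smul E k x, ← hlK, hρ, Algebra.smul_def]
  let ρ' : Q →ₗ[K] B := { ρ with map_smul' := hρK }
  -- For a basis element x, the endomorphism is v ↦ ρ((1 ⊗ v) x).
  let β : Q → B →ₗ[K] B := fun x => ρ' ∘ₗ (LinearMap.toSpanSingleton E Q x).restrictScalars K ∘ₗ
    e.symm.toLinearMap ∘ₗ TensorProduct.mk K B B 1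
  have hβ : ∀ (z : E) (x : Q), LinearMap.mul' K B ((β x).lTensor B (e z)) = ρ (z • x) := by
    intro z x
    obtain ⟨w, rfl⟩ := e.symm.surjective z
    rw [e.apply_symm_apply]
    induction w using TensorProduct.induction_on with
    | zero => simp
    | add w w' hw hw' => simp only [map_add, hw, hw', add_smul]
    | tmul u v =>
      rw [LinearMap.lTensor_tmul, LinearMap.mul'_apply]
      have h₁ : l u * e.symm (1 ⊗ₜ v) = e.symm (u ⊗ₜ v) := e.injective (by
        rw [hl, e.apply_symm_apply, e.apply_symm_apply, Algebra.TensorProduct.tmul_mul_tmul,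
          mul_one, one_mul])
      rw [← h₁, mul_smul, hρ]
      rfl
  refine ⟨(t q).support, inferInstance, fun i => e (t q i), fun i => β i, fun i b => ?_, ?_⟩
  · rw [← hl, ← hr]
    have h₁ := congrArg (fun f => f i.1) (congrArg t (hq b))
    simp only [map_smul, Finsupp.smul_apply, smul_eq_mul] at h₁
    rw [h₁]
  · have h₁ : (Finsupp.linearCombination E id) (t q) = q := LinearMap.congr_fun ht q
    simp only [hβ]
    rw [Finset.sum_coe_sort (t q).support (fun x => ρ (t q x • x)), ← map_sum, ← hρq]
    exact congrArg ρ h₁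

/-- Multiply Casimir elements factorwise after swapping the middle tensor factors. -/
lemma HasCasimirSplitting.tensorProduct {A B : Type u} [Ring A] [Algebra K A] [Ring B] [Algebra K B]
    (hA : HasCasimirSplitting K A) (hB : HasCasimirSplitting K B) :
    HasCasimirSplitting K (A ⊗[K] B) := by
  obtain ⟨ι, _, c, β, hc, hβ⟩ := hA
  obtain ⟨κ, _, d, γ, hd, hγ⟩ := hB
  let τ := Algebra.TensorProduct.tensorTensorTensorComm K K K K A A B B
  refine ⟨ι × κ, inferInstance, fun p => τ (c p.1 ⊗ₜ d p.2), fun p => TensorProduct.map (β p.1) (γ p.2),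
    fun p b => ?_, ?_⟩
  · induction b using TensorProduct.induction_on with
    | zero => simp
    | add x y hx hy => rw [TensorProduct.add_tmul, add_mul, hx, hy, TensorProduct.tmul_add, mul_add]
    | tmul a b =>
      have h₁ : ((a ⊗ₜ b) ⊗ₜ 1 : (A ⊗[K] B) ⊗[K] (A ⊗[K] B)) =
        τ ((a ⊗ₜ 1) ⊗ₜ (b ⊗ₜ 1)) := rfl
      have h₂ : (1 ⊗ₜ (a ⊗ₜ b) : (A ⊗[K] B) ⊗[K] (A ⊗[K] B)) =
        τ ((1 ⊗ₜ a) ⊗ₜ (1 ⊗ₜ b)) := rfl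
      rw [h₁, h₂, ← map_mul, ← map_mul, Algebra.TensorProduct.tmul_mul_tmul,
        Algebra.TensorProduct.tmul_mul_tmul, hc, hd]
  · have h₁ : ∀ (β : A →ₗ[K] A) (γ : B →ₗ[K] B) (c : A ⊗[K] A) (d : B ⊗[K] B),
        LinearMap.mul' K (A ⊗[K] B) ((TensorProduct.map β γ).lTensor (A ⊗[K] B) (τ (c ⊗ₜ d))) =
          LinearMap.mul' K A (β.lTensor A c) ⊗ₜ LinearMap.mul' K B (γ.lTensor B d) := by
      intro β γ c d
      induction c using TensorProduct.induction_on with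
      | zero => simp
      | add x y hx hy => simp only [TensorProduct.add_tmul, map_add, hx, hy]
      | tmul a a' =>
        induction d using TensorProduct.induction_on with
        | zero => simp
        | add x y hx hy => simp only [TensorProduct.tmul_add, map_add, hx, hy]
        | tmul b b' =>
          have h₂ : τ ((a ⊗ₜ a') ⊗ₜ (b ⊗ₜ b')) = (a ⊗ₜ b) ⊗ₜ (a' ⊗ₜ b') := rfl
          rw [h₂, LinearMap.lTensor_tmul, LinearMap.lTensor_tmul, LinearMap.lTensor_tmul,
            TensorProduct.map_tmul, LinearMap.mul'_apply, LinearMap.mul'_apply,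
            LinearMap.mul'_apply, Algebra.TensorProduct.tmul_mul_tmul]
    simp only [h₁]
    rw [Fintype.sum_prod_type]
    simp only [← TensorProduct.tmul_sum, ← TensorProduct.sum_tmul]
    rw [hβ, hγ, Algebra.TensorProduct.one_def]

section Coinduced

variable {B : Type u} [Ring B] [Algebra K B] {ι : Type u}
  (c : ι → B ⊗[K] B) {Q : Type u} [AddCommGroup Q] [Module B Q] [Module K Q] [IsScalarTower K B Q]

/-- The map `u ⊗ v ↦ u φ(v)`. -/
def casimirPairing (φ : B →ₗ[K] Q) : B ⊗[K] B →ₗ[K] Q :=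
  TensorProduct.lift ((LinearMap.llcomp K B Q Q).flip φ ∘ₗ (Algebra.lsmul K K Q).toLinearMap)

lemma casimirPairing_tmul (φ : B →ₗ[K] Q) (u v : B) : casimirPairing φ (u ⊗ₜ v) = u • φ v := rfl

lemma casimirPairing_mul_left (φ : B →ₗ[K] Q) (b : B) (z : B ⊗[K] B) :
    casimirPairing φ ((b ⊗ₜ 1) * z) = b • casimirPairing φ z := by
  induction z using TensorProduct.induction_on with
  | zero => simp
  | add x y hx hy => rw [mul_add, map_add, hx, hy, map_add, smul_add]
  | tmul u v =>
    rw [Algebra.TensorProduct.tmul_mul_tmul, one_mul, casimirPairing_tmul, casimirPairing_tmul,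
      mul_smul]

lemma casimirPairing_mul_right (φ ψ : B →ₗ[K] Q) (b : B) (h : ∀ v, ψ v = φ (v * b)) (z : B ⊗[K] B) :
    casimirPairing φ (z * (1 ⊗ₜ b)) = casimirPairing ψ z := by
  induction z using TensorProduct.induction_on with
  | zero => simp
  | add x y hx hy => rw [add_mul, map_add, hx, hy, map_add]
  | tmul u v =>
    rw [Algebra.TensorProduct.tmul_mul_tmul, mul_one, casimirPairing_tmul, casimirPairing_tmul, h]

lemma casimirPairing_smul (β : B →ₗ[K] B) (q : Q) (φ : B →ₗ[K] Q) (h : ∀ v, φ v = β v • q)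
    (z : B ⊗[K] B) :
    casimirPairing φ z = LinearMap.mul' K B (β.lTensor B z) • q := by
  induction z using TensorProduct.induction_on with
  | zero => simp
  | add x y hx hy => simp only [map_add, hx, hy, add_smul]
  | tmul u v =>
    rw [casimirPairing_tmul, LinearMap.lTensor_tmul, LinearMap.mul'_apply, h, mul_smul]

lemma casimirPairing_add (φ ψ : B →ₗ[K] Q) (z : B ⊗[K] B) :
    casimirPairing (φ + ψ) z = casimirPairing φ z + casimirPairing ψ z := by
  induction z using TensorProduct.induction_on with
  | zero => simp
  | add x y hx hy => rw [map_add, hx, hy, map_add, map_add]; abel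
  | tmul u v => exact smul_add _ _ _

end Coinduced

open scoped ModuleCat in
-- Coinduction from a field gives injective modules. Averaging over the Casimir elements is a
-- B-linear surjection from a coinduced module onto Q, and it splits when Q is projective.
lemma HasCasimirSplitting.injective {B : Type u} [Ring B] [Algebra K B]
    (hB : HasCasimirSplitting K B) (Q : ModuleCat.{u} B) (hQ : Projective Q) : Injective Q := by
  obtain ⟨ι, _, c, β, hc, hβ⟩ := hB
  let f := algebraMap K B
  let N : ModuleCat.{u} K := ModuleCat.of K (ι → Q)
  have hN : Injective N := by
    have : Module.Injective K N := Module.injective_of_isSemisimpleRing _ _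
    exact Module.injective_object_of_injective_module K N
  let I := (ModuleCat.coextendScalars.{u, u, u} f).obj N
  have hI : Injective I := Injective.injective_of_adjoint
    (ModuleCat.restrictCoextendScalarsAdj.{u, u, u} f) N
  let comp (φ : I) (i : ι) : B →ₗ[K] Q :=
    { toFun := fun b => (ModuleCat.CoextendScalars.equiv f N φ) b i
      map_add' := fun x y => congrFun ((ModuleCat.CoextendScalars.equiv f N φ).map_add x y) i
      map_smul' := fun k x => by
        rw [Algebra.smul_def]
        exact congrFun ((ModuleCat.CoextendScalars.equiv f N φ).map_smul k x) i }
  -- With cᵢ = uᵢ ⊗ vᵢ this is φ ↦ ∑ᵢ uᵢ φᵢ(vᵢ); B-linearity is exactly the Casimir relation.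
  let π : I ⟶ Q := ModuleCat.ofHom
    { toFun := fun φ => ∑ i, casimirPairing (comp φ i) (c i)
      map_add' := fun φ ψ => by
        rw [← Finset.sum_add_distrib]
        exact Finset.sum_congr rfl fun i _ => casimirPairing_add (comp φ i) (comp ψ i) (c i)
      map_smul' := fun b φ => by
        rw [RingHom.id_apply, Finset.smul_sum]
        refine Finset.sum_congr rfl fun i _ => ?_
        rw [← casimirPairing_mul_left, hc, casimirPairing_mul_right (comp φ i) (comp (b • φ) i)]
        intro v
        rfl }
  have hπ : Epi π := by
    refine (ModuleCat.epi_iff_surjective _).2 fun q => ?_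
    -- The components v ↦ βᵢ(v) q average to ∑ᵢ uᵢ βᵢ(vᵢ) q = q.
    let φ : B →ₗ[K] (ι → Q) := LinearMap.pi fun i =>
      (LinearMap.toSpanSingleton B Q q).restrictScalars K ∘ₗ β i
    let ψ : I := (ModuleCat.CoextendScalars.equiv f N).symm
      { toFun := φ
        map_add' := φ.map_add
        map_smul' := fun k x => Eq.trans (congrArg φ (Algebra.smul_def k (A := B) x).symm)
          (φ.map_smul k x) }
    have h₁ := fun i => casimirPairing_smul (β i) q (comp ψ i) (fun v => rfl) (c i)
    refine ⟨ψ, ?_⟩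
    change ∑ i, casimirPairing (comp ψ i) (c i) = q
    rw [Finset.sum_congr rfl fun i _ => h₁ i, ← Finset.sum_smul, hβ, one_smul]
  exact Retract.injective ⟨Projective.factorThru (𝟙 Q) π, π, Projective.factorThru_comp _ _⟩

end Casimir

end

end HochschildLocalization

namespace HochschildLocalization

noncomputable section

/-! ### Projective bimodules over a periodic algebra are injective -/

section ProjectiveInjective

variable {K Λ : Type u} [Field K] [Ring Λ] [Algebra K Λ]

open scoped ModuleCat in
-- The element i(1) satisfies a i(1) = i(1) a. The left linear retraction yields Casimir elements
-- for Λ and the right linear one yields them for Λᵒᵖ; no retraction of bimodules is required.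
lemma hasCasimirSplitting_env {Q : Bimod K Λ} [Projective Q] (i : reg K Λ ⟶ Q)
    (r : (leftRestrict K Λ).obj Q ⟶ (leftRestrict K Λ).obj (reg K Λ))
    (hr : (leftRestrict K Λ).map i ≫ r = 𝟙 _)
    (r' : (rightRestrict K Λ).obj Q ⟶ (rightRestrict K Λ).obj (reg K Λ))
    (hr' : (rightRestrict K Λ).map i ≫ r' = 𝟙 _) : HasCasimirSplitting K (Env K Λ) := by
  have : Module.Projective (Env K Λ) Q := (IsProjective.iff_projective _).2 inferInstance
  have hq : ∀ a : Λ, (a ⊗ₜ 1 : Env K Λ) • i.hom (1 : Λ) = (1 ⊗ₜ .op a : Env K Λ) • i.hom (1 : Λ) := by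
    intro a
    refine (i.hom.map_smul _ _).symm.trans (Eq.trans ?_ (i.hom.map_smul _ _))
    refine congrArg i.hom ((reg_smul a 1 1).trans (Eq.trans ?_ (reg_smul 1 (.op a) 1).symm))
    exact (congrArg (· * (1 : Λ)) (mul_one a)).trans
      ((mul_one a).trans (congrArg (· * a) (one_mul (1 : Λ)) |>.trans (one_mul a)).symm)
  refine HasCasimirSplitting.tensorProduct ?_ ?_
  · refine HasCasimirSplitting.of_projective (E := Env K Λ) (Q := Q)
      (TensorProduct.congr (LinearEquiv.refl K Λ) (MulOpposite.opLinearEquiv K).symm)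
      (fun a => a ⊗ₜ 1) (fun a => 1 ⊗ₜ .op a) (fun a z => ?_) (fun a z => ?_) (i.hom (1 : Λ)) hq
      r.hom.toAddMonoidHom (fun a x => ?_) ?_
    · induction z using TensorProduct.induction_on with
      | zero => simp
      | add x y hx hy => rw [mul_add, map_add, map_add, mul_add, hx, hy]
      | tmul u v => simp
    · induction z using TensorProduct.induction_on with
      | zero => simp
      | add x y hx hy => rw [mul_add, map_add, map_add, add_mul, hx, hy]
      | tmul u v => simp
    · refine (r.hom.map_smul a x).trans ((reg_smul a 1 (r.hom x)).trans ?_)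
      simp; rfl
    · exact LinearMap.congr_fun (congrArg ModuleCat.Hom.hom hr) (1 : Λ)
  · refine HasCasimirSplitting.of_projective (E := Env K Λ) (Q := Q)
      ((TensorProduct.comm K Λ Λᵐᵒᵖ).trans
        (TensorProduct.congr (LinearEquiv.refl K Λᵐᵒᵖ) (MulOpposite.opLinearEquiv K)))
      (fun a => 1 ⊗ₜ a) (fun a => a.unop ⊗ₜ 1) (fun a z => ?_) (fun a z => ?_) (i.hom (1 : Λ))
      (fun a => (hq a.unop).symm)
      (MulOpposite.opAddEquiv.toAddMonoidHom.comp r'.hom.toAddMonoidHom) (fun a x => ?_) ?_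
    · induction z using TensorProduct.induction_on with
      | zero => simp
      | add x y hx hy => rw [mul_add, map_add, map_add, mul_add, hx, hy]
      | tmul u v => simp
    · induction z using TensorProduct.induction_on with
      | zero => simp
      | add x y hx hy => rw [mul_add, map_add, map_add, add_mul, hx, hy]
      | tmul u v => simp
    · refine congrArg MulOpposite.op ((r'.hom.map_smul a x).trans
        ((reg_smul 1 a (r'.hom x)).trans ?_))
      exact congrArg (· * a.unop) (one_mul _)
    · exact congrArg MulOpposite.op (LinearMap.congr_fun (congrArg ModuleCat.Hom.hom hr') (1 : Λ))

/-- Λ ≅ Ωᵐ⁺¹ embeds into the projective bimodule Rₘ, with quotient Ωᵐ projective on each side, so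
the one-sided retractions exist. -/
lemma injective_of_projective_of_iso (R : ProjectiveResolution (reg K Λ)) {m : ℕ}
    (φ : syzygy R (m + 1) ≅ reg K Λ) (Q : Bimod K Λ) (hQ : Projective Q) : Injective Q := by
  obtain ⟨r, hr⟩ := exists_map_fromOpcycles_comp R (leftRestrict K Λ) m
  obtain ⟨r', hr'⟩ := exists_map_fromOpcycles_comp R (rightRestrict K Λ) m
  refine (hasCasimirSplitting_env (φ.inv ≫ R.complex.fromOpcycles (m + 1) m)
    (r ≫ (leftRestrict K Λ).map φ.hom) ?_ (r' ≫ (rightRestrict K Λ).map φ.hom) ?_).injective Q hQ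
  · rw [CategoryTheory.Functor.map_comp, Category.assoc, reassoc_of% hr,
      ← CategoryTheory.Functor.map_comp, φ.inv_hom_id, CategoryTheory.Functor.map_id]
  · rw [CategoryTheory.Functor.map_comp, Category.assoc, reassoc_of% hr',
      ← CategoryTheory.Functor.map_comp, φ.inv_hom_id, CategoryTheory.Functor.map_id]

end ProjectiveInjective

/-! ### Splicing short exact sequences -/

section CompleteResolutions

open Limits

variable {C : Type*} [Category* C] [Abelian C] {V Q : ℤ → C} (f : ∀ n, V n ⟶ Q n)
  (g : ∀ n, Q n ⟶ V (n + 1)) (w : ∀ n, f n ≫ g n = 0)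

/-- The complex obtained by splicing short exact sequences `0 → Vₙ → Qₙ → Vₙ₊₁ → 0`. -/
def splice : CochainComplex C ℤ :=
  CochainComplex.of Q (fun n => g n ≫ f (n + 1)) fun n => by
    rw [Category.assoc, reassoc_of% (w (n + 1)), zero_comp, comp_zero]

lemma splice_d (n : ℤ) : (splice f g w).d n (n + 1) = g n ≫ f (n + 1) :=
  CochainComplex.of_d Q (fun n => g n ≫ f (n + 1)) n

variable (h : ∀ n, (ShortComplex.mk _ _ (w n)).ShortExact)
include h

lemma exactAt_splice (n : ℤ) : (splice f g w).ExactAt n := by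
  obtain ⟨n, rfl⟩ : ∃ m, m + 1 = n := ⟨n - 1, by lia⟩
  have hf := fun n => (h n).mono_f
  have hg := fun n => (h n).epi_g
  dsimp at hf hg
  rw [HomologicalComplex.exactAt_iff' _ n (n + 1) (n + 1 + 1) (by simp) (by simp)]
  let S := ShortComplex.mk (f (n + 1)) (g (n + 1) ≫ f (n + 1 + 1)) (by simp [reassoc_of% w])
  let α : (splice f g w).sc' n (n + 1) (n + 1 + 1) ⟶ S :=
    { τ₁ := g n, τ₂ := 𝟙 _, τ₃ := 𝟙 _
      comm₁₂ := by
        refine Eq.trans ?_ ((Category.comp_id _).trans (splice_d f g w n)).symm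
        rfl
      comm₂₃ := (Category.id_comp _).trans (Eq.trans (splice_d f g w (n + 1)).symm (Category.comp_id _).symm) }
  let β : ShortComplex.mk _ _ (w (n + 1)) ⟶ S :=
    { τ₁ := 𝟙 _, τ₂ := 𝟙 _, τ₃ := f (n + 1 + 1) }
  have : Epi α.τ₁ := hg n
  have : IsIso α.τ₂ := inferInstanceAs (IsIso (𝟙 _))
  have : Mono α.τ₃ := inferInstanceAs (Mono (𝟙 _))
  have : Epi β.τ₁ := inferInstanceAs (Epi (𝟙 _))
  have : IsIso β.τ₂ := inferInstanceAs (IsIso (𝟙 _))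
  have : Mono β.τ₃ := hf _
  rw [ShortComplex.exact_iff_of_epi_of_isIso_of_mono α,
    ← ShortComplex.exact_iff_of_epi_of_isIso_of_mono β]
  exact (h (n + 1)).exact

/-- The cycles of a spliced complex. -/
def cyclesSpliceIso (n : ℤ) : (splice f g w).cycles n ≅ V n :=
  have : Mono (f (n + 1)) := (h (n + 1)).mono_f
  ((splice f g w).cyclesIsKernel n (n + 1) (by simp)).conePointUniqueUpToIso
    (isKernelCompMono (h n).fIsKernel (f (n + 1)) (splice_d f g w n))

end CompleteResolutions

/-! ### Existence of a complete resolution -/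

section Existence

open Limits

variable {K Λ : Type u} [Field K] [Ring Λ] [Algebra K Λ]

lemma exists_completeResolution_of_shortExact {V : ℤ → Bimod K Λ}
    (hV : ∀ n, ∃ (Q : Bimod K Λ) (f : V n ⟶ Q) (g : Q ⟶ V (n + 1)) (w : f ≫ g = 0),
      Projective Q ∧ (ShortComplex.mk _ _ w).ShortExact) :
    Nonempty (CompleteResolution (V 1)) := by
  choose Q f g w hQ h using hV
  exact ⟨⟨splice f g w, hQ, exactAt_splice f g w h, cyclesSpliceIso f g w h 1⟩⟩

/-- Ωⁿ⁺¹ embeds into Rₙ with quotient Ωⁿ, and at the end Ω⁰ ≅ Λ ≅ Ωᵐ⁺¹ restarts the process. The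
quotient is again a syzygy, so the step can be iterated forever. -/
lemma exists_shortExact_of_iso {R : ProjectiveResolution (reg K Λ)} {m : ℕ}
    (φ : syzygy R (m + 1) ≅ reg K Λ) {V : Bimod K Λ} (hV : ∃ n, Nonempty (V ≅ syzygy R n)) :
    ∃ (W Q : Bimod K Λ) (f : V ⟶ Q) (g : Q ⟶ W) (w : f ≫ g = 0),
      (∃ n, Nonempty (W ≅ syzygy R n)) ∧ Projective Q ∧ (ShortComplex.mk _ _ w).ShortExact := by
  obtain ⟨n, ⟨e⟩⟩ : ∃ n, Nonempty (V ≅ syzygy R (n + 1)) := by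
    obtain ⟨n, ⟨e⟩⟩ := hV
    cases n with
    | zero => exact ⟨m, ⟨e ≪≫ opcyclesZeroIso R ≪≫ φ.symm⟩⟩
    | succ n => exact ⟨n, ⟨e⟩⟩
  refine ⟨syzygy R n, R.complex.X n, e.hom ≫ R.complex.fromOpcycles (n + 1) n,
    R.complex.pOpcycles n, by rw [Category.assoc, fromOpcycles_pOpcycles, comp_zero],
    ⟨n, ⟨Iso.refl _⟩⟩, inferInstance, ?_⟩
  refine ShortComplex.shortExact_of_iso ?_ (shortExact_fromOpcycles R n)
  exact ShortComplex.isoMk e.symm (Iso.refl _) (Iso.refl _)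

lemma nonempty_completeResolution {R : ProjectiveResolution (reg K Λ)} {m : ℕ}
    (φ : syzygy R (m + 1) ≅ reg K Λ) : Nonempty (CompleteResolution (reg K Λ)) := by
  choose W Q f g w hW hQ h using fun V => exists_shortExact_of_iso (V := V) φ
  let next : {V : Bimod K Λ // ∃ n, Nonempty (V ≅ syzygy R n)} →
      {V : Bimod K Λ // ∃ n, Nonempty (V ≅ syzygy R n)} := fun V => ⟨W V.1 V.2, hW V.1 V.2⟩
  let start : {V : Bimod K Λ // ∃ n, Nonempty (V ≅ syzygy R n)} :=
    ⟨reg K Λ, 0, ⟨(opcyclesZeroIso R).symm⟩⟩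
  let seq : ℕ → {V : Bimod K Λ // ∃ n, Nonempty (V ≅ syzygy R n)} :=
    Nat.rec start fun _ => next
  -- The cycles of the spliced complex in degree n are V n, so V 1 has to be Λ. To the right one
  -- continues by periodicity, to the left by kernels of projective presentations.
  let V : ℤ → Bimod K Λ
    | .ofNat 0 => iterKernel (reg K Λ) 1
    | .ofNat (k + 1) => (seq k).1
    | .negSucc k => iterKernel (reg K Λ) (k + 2)
  refine exists_completeResolution_of_shortExact (V := V) fun n => ?_
  have left := fun k : ℕ => (⟨_, _, _, iterKernelι_π (reg K Λ) k, inferInstance,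
    shortExact_iterKernel _ k⟩ : ∃ (Q : Bimod K Λ) (f : iterKernel (reg K Λ) (k + 1) ⟶ Q)
      (g : Q ⟶ iterKernel (reg K Λ) k) (w : f ≫ g = 0),
      Projective Q ∧ (ShortComplex.mk _ _ w).ShortExact)
  match n with
  | .ofNat 0 => exact left 0
  | .ofNat (k + 1) => exact ⟨_, _, _, _, hQ (seq k).1 (seq k).2, h (seq k).1 (seq k).2⟩
  | .negSucc 0 => exact left 1
  | .negSucc (k + 1) => exact left (k + 2)

end Existence

end

end HochschildLocalization

namespace HochschildLocalization

noncomputable section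

/-! ### Recognizing a localization at a central element -/

section LocalizationEquiv

section

variable {R T : Type*} [Ring R] [Ring T] {h : R} (hc : ∀ a, Commute h a) (Θ : R →+* T) (u : Tˣ)
  (hu : Θ h = u)

include hu in
lemma isUnit_map_powers (s : Submonoid.powers h) :
    IsUnit (((Θ : R →* T).comp (Submonoid.powers h).subtype) s) := by
  obtain ⟨_, n, rfl⟩ := s
  exact ⟨u ^ n, by simp [hu]⟩

/-- The units which are the images of the powers of `h`. -/
def unitsOfPowers : Submonoid.powers h →* Tˣ :=
  IsUnit.liftRight (((Θ : R →* T).comp (Submonoid.powers h).subtype)) (isUnit_map_powers Θ u hu)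

lemma coe_unitsOfPowers (s : Submonoid.powers h) : (unitsOfPowers Θ u hu s : T) = Θ s := rfl

lemma unitsOfPowers_pow (n : ℕ) : unitsOfPowers Θ u hu ⟨h ^ n, n, rfl⟩ = u ^ n :=
  Units.ext (by rw [coe_unitsOfPowers, map_pow, hu, Units.val_pow_eq_pow_val])

lemma oreDiv_eq_zero_of_smul_eq_zero {N : Type*} [AddCommGroup N] [Module R N] (x : N)
    (s : Submonoid.powers h) (hx : h • x = 0) :
    letI := orePowers h hc
    OreLocalization.oreDiv x s = 0 := by
  let _ := orePowers h hc
  change OreLocalization.oreDiv x s = 0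
  rw [OreLocalization.zero_def, OreLocalization.oreDiv_eq_iff]
  exact ⟨⟨h, 1, pow_one h⟩ * s, h, by rw [smul_zero, hx], by rw [OneMemClass.coe_one, mul_one]; rfl⟩

include hu in
-- The map x / hⁿ ↦ u⁻ⁿ θ(x) is injective because elements of the kernel of θ are killed by h, so
-- they vanish as fractions. It is surjective because every w is reached by θ after multiplication
-- by a power of u.
lemma exists_oreLocalization_equiv {N W : Type*} [AddCommGroup N] [Module R N] [AddCommGroup W]
    [Module T W] (θ : N →+ W) (hθ : ∀ (a : R) x, θ (a • x) = Θ a • θ x)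
    (inj : ∀ x, θ x = 0 → h • x = 0) (surj : ∀ w, ∃ (n : ℕ) (x : N), θ x = (u ^ n : Tˣ) • w) :
    letI := orePowers h hc
    ∃ Ψ : OreLocalization (Submonoid.powers h) N ≃+ W,
      ∀ x n, Ψ (OreLocalization.oreDiv x (⟨h ^ n, n, rfl⟩ : Submonoid.powers h)) =
        (u⁻¹ ^ n : Tˣ) • θ x := by
  let _ := orePowers h hc
  let σ := unitsOfPowers Θ u hu
  have hσ : ∀ (a b : R) (s : Submonoid.powers h) (ht : a * s ∈ Submonoid.powers h) (x : N),
      (σ ⟨a * s, ht⟩)⁻¹ • θ (a • x) = (σ s)⁻¹ • θ x := by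
    intro a _ s ht x
    rw [inv_smul_eq_iff, hθ, Units.smul_def, Units.smul_def, smul_smul, coe_unitsOfPowers]
    change _ = (Θ (a * s) * _) • _
    rw [map_mul, mul_assoc, ← coe_unitsOfPowers Θ u hu s, Units.mul_inv, mul_one]
  let Ψ₀ : OreLocalization (Submonoid.powers h) N → W :=
    OreLocalization.liftExpand (fun x s => (σ s)⁻¹ • θ x) fun x a s ht => (hσ a 1 s ht x).symm
  have hΨ₀ : ∀ x s, Ψ₀ (OreLocalization.oreDiv x s) = (σ s)⁻¹ • θ x := fun x s => rfl
  have add : ∀ x y, Ψ₀ (x + y) = Ψ₀ x + Ψ₀ y := by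
    intro x y
    induction x using OreLocalization.ind with | _ x s
    induction y using OreLocalization.ind with | _ y t
    have e₁ : OreLocalization.oreDiv x s = OreLocalization.oreDiv (t • x) (t * s) :=
      OreLocalization.expand' x s t
    have e₂ : OreLocalization.oreDiv y t = OreLocalization.oreDiv (s • y) (s * t) :=
      OreLocalization.expand' y t s
    have e₃ : s * t = t * s := by
      obtain ⟨_, m, rfl⟩ := s
      obtain ⟨_, n, rfl⟩ := t
      exact Subtype.ext (pow_mul_comm h m n)
    rw [e₁, e₂, e₃, OreLocalization.add_oreDiv, hΨ₀, hΨ₀, hΨ₀, map_add, smul_add]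
  let Ψ₁ : OreLocalization (Submonoid.powers h) N →+ W := AddMonoidHom.mk' Ψ₀ add
  have hpow : ∀ x n, Ψ₁ (OreLocalization.oreDiv x (⟨h ^ n, n, rfl⟩ : Submonoid.powers h)) =
      (u⁻¹ ^ n : Tˣ) • θ x := fun x n => by
    refine (hΨ₀ x _).trans ?_
    rw [unitsOfPowers_pow, inv_pow]
  refine ⟨AddEquiv.ofBijective Ψ₁ ⟨(injective_iff_map_eq_zero _).2 fun x hx => ?_, fun w => ?_⟩, hpow⟩
  · induction x using OreLocalization.ind with | _ x s
    exact oreDiv_eq_zero_of_smul_eq_zero hc x s (inj x (by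
      rwa [show Ψ₁ (OreLocalization.oreDiv x s) = (σ s)⁻¹ • θ x from rfl, smul_eq_zero_iff_eq] at hx))
  · obtain ⟨n, x, hx⟩ := surj w
    exact ⟨_, (hpow x n).trans (by rw [hx, inv_pow, inv_smul_smul])⟩

end

section

variable {K R T : Type*} [Field K] [Ring R] [Algebra K R] [Ring T] [Algebra K T] {h : R}
  (hc : ∀ a, Commute h a) (Θ : R →ₐ[K] T) (u : Tˣ) (hu : Θ h = u)

include hu in
lemma exists_locRing_equiv (inj : ∀ a, Θ a = 0 → h * a = 0)
    (surj : ∀ t, ∃ (n : ℕ) (a : R), Θ a = (u ^ n : Tˣ) * t) :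
    ∃ Φ : LocRing h hc ≃ₐ[K] T, ∀ a n, Φ (LocRing.frac hc a n) = (u⁻¹ ^ n : Tˣ) * Θ a := by
  let _ := orePowers h hc
  let σ := unitsOfPowers (Θ : R →+* T) u hu
  let Φ₀ : LocRing h hc →+* T := OreLocalization.universalHom (Θ : R →+* T) σ fun s => rfl
  have hΦ₀ : ∀ (a : R) (s : Submonoid.powers h),
      Φ₀ (OreLocalization.oreDiv a s) = ((σ s)⁻¹ : Tˣ) * Θ a := fun a s => rfl
  have hpow : ∀ a n, Φ₀ (LocRing.frac hc a n) = (u⁻¹ ^ n : Tˣ) * Θ a := fun a n => by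
    refine (hΦ₀ a _).trans (congrArg (fun v : Tˣ => (v : T) * Θ a) ?_)
    exact (congrArg _ (unitsOfPowers_pow (Θ : R →+* T) u hu n)).trans (inv_pow u n).symm
  refine ⟨AlgEquiv.ofBijective { Φ₀ with commutes' := fun k => ?_ }
    ⟨(injective_iff_map_eq_zero _).2 fun x hx => ?_, fun w => ?_⟩, hpow⟩
  · exact (hΦ₀ (algebraMap K R k) 1).trans (by simp)
  · induction x using OreLocalization.ind with | _ x s
    exact oreDiv_eq_zero_of_smul_eq_zero hc x s (inj x
      ((Units.mul_right_eq_zero _).1 ((hΦ₀ x s).symm.trans hx)))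
  · obtain ⟨n, x, hx⟩ := surj w
    exact ⟨_, (hpow x n).trans (by rw [hx, inv_pow, Units.inv_mul_cancel_left])⟩

include hu in
lemma exists_locModule_equiv {N W : Type*} [AddCommGroup N] [Module Rᵐᵒᵖ N] [AddCommGroup W]
    [Module Tᵐᵒᵖ W] (θ : N →+ W)
    (hθ : ∀ (a : R) x, θ (MulOpposite.op a • x) = MulOpposite.op (Θ a) • θ x)
    (inj : ∀ x, θ x = 0 → MulOpposite.op h • x = 0)
    (surj : ∀ w, ∃ (n : ℕ) (x : N), θ x = MulOpposite.op ((u ^ n : Tˣ) : T) • w) :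
    ∃ Ψ : LocModule h hc N ≃+ W, ∀ x n,
      Ψ (LocModule.frac hc x n) = MulOpposite.op ((u⁻¹ ^ n : Tˣ) : T) • θ x := by
  let u' : (Tᵐᵒᵖ)ˣ := Units.opEquiv.symm (MulOpposite.op u)
  have hu' : ∀ n : ℕ, ((u' ^ n : (Tᵐᵒᵖ)ˣ) : Tᵐᵒᵖ) = MulOpposite.op ((u ^ n : Tˣ) : T) := fun n => by
    rw [Units.val_pow_eq_pow_val, Units.val_pow_eq_pow_val, MulOpposite.op_pow]
    rfl
  have hu'' : ∀ n : ℕ, ((u'⁻¹ ^ n : (Tᵐᵒᵖ)ˣ) : Tᵐᵒᵖ) = MulOpposite.op ((u⁻¹ ^ n : Tˣ) : T) :=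
    fun n => by
      rw [Units.val_pow_eq_pow_val, Units.val_pow_eq_pow_val, MulOpposite.op_pow]
      rfl
  obtain ⟨Ψ, hΨ⟩ := exists_oreLocalization_equiv (commute_op hc) (RingHom.op (Θ : R →+* T)) u'
    (congrArg MulOpposite.op hu) θ (fun a x => hθ a.unop x) inj fun w => by
      obtain ⟨n, x, hx⟩ := surj w
      exact ⟨n, x, hx.trans (congrArg (· • w) (hu' n).symm)⟩
  exact ⟨Ψ, fun x n => (hΨ x n).trans (congrArg (· • θ x) (hu'' n))⟩

end

end LocalizationEquiv

/-! ### Maps from ℕ-graded to ℤ-graded groups -/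

section GradedMaps

variable {A : ℕ → Type*} {B : ℤ → Type*} [∀ n, AddCommGroup (A n)] [∀ n, AddCommGroup (B n)]
  (f : ∀ n : ℕ, A n →+ B n)

/-- The map from an `ℕ`-graded to a `ℤ`-graded abelian group with given components. -/
def gradedMap : (⨁ n, A n) →+ ⨁ n, B n :=
  DirectSum.toAddMonoid fun n => (DirectSum.of B (n : ℤ)).comp (f n)

lemma gradedMap_of {n : ℕ} (a : A n) :
    gradedMap f (DirectSum.of A n a) = DirectSum.of B (n : ℤ) (f n a) := by
  simp [gradedMap]

lemma gradedMap_apply (a : ⨁ n, A n) (n : ℕ) : gradedMap f a n = f n (a n) := by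
  induction a using DirectSum.induction_on with
  | zero => simp
  | add x y hx hy => rw [map_add, DirectSum.add_apply, DirectSum.add_apply, hx, hy, map_add]
  | of m x =>
    rw [gradedMap_of]
    by_cases h : m = n
    · subst h
      rw [DirectSum.of_eq_same, DirectSum.of_eq_same]
    · rw [DirectSum.of_eq_of_ne _ _ _ (by lia), DirectSum.of_eq_of_ne _ _ _ (by lia), map_zero]

lemma eq_of_gradedMap_eq_zero (hf : ∀ n, 1 ≤ n → Function.Injective (f n)) {a : ⨁ n, A n}
    (ha : gradedMap f a = 0) : a = DirectSum.of A 0 (a 0) ∧ f 0 (a 0) = 0 := by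
  have h : ∀ n, f n (a n) = 0 := fun n => by
    rw [← gradedMap_apply, ha, DirectSum.zero_apply]
  refine ⟨DFinsupp.ext fun n => ?_, h 0⟩
  by_cases hn : n = 0
  · subst hn
    exact (DirectSum.of_eq_same 0 (a 0)).symm
  · refine Eq.trans ?_ (DirectSum.of_eq_of_ne _ _ _ hn).symm
    exact hf n (by lia) ((h n).trans (map_zero _).symm)

end GradedMaps

end

end HochschildLocalization

namespace HochschildLocalization

noncomputable section

/-! ### Shift isomorphisms from an invertible commuting element -/

section StableHomologyAction

variable {K Λ : Type u} [Field K] [Ring Λ] [Algebra K Λ]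

lemma shiftMap_shiftedHom_comp {C D : Type*} [Category* C] [Category* D] [HasShift C ℤ]
    (F : C ⥤ D) [F.ShiftSequence ℤ] {X Y Z : C} {a b c : ℤ} (f : ShiftedHom X Y a)
    (g : ShiftedHom Y Z b) (h : b + a = c) (i k l : ℤ) (hk : a + i = k) (hl : b + k = l) :
    F.shiftMap f i k hk ≫ F.shiftMap g k l hl = F.shiftMap (f.comp g h) i l (by lia) := by
  rw [CategoryTheory.Functor.shiftMap, Category.assoc,
    F.shiftIso_hom_app_comp_shiftMap g a c h i k l hk hl, CategoryTheory.Functor.shiftMap,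
    ShiftedHom.comp, CategoryTheory.Functor.map_comp, CategoryTheory.Functor.map_comp,
    Category.assoc, Category.assoc]

variable (P : CompleteResolution (reg K Λ)) (M : Bimod K Λ)

/-- The left action of an element of stable Hochschild cohomology, as a linear map. -/
def homologyActHom {i j k : ℤ} (b : StableHHn P j) (h : j + i = k) :
    StableHomologyn P M i →ₗ[K] StableHomologyn P M k :=
  ((HomotopyCategory.homologyFunctor (ModuleCat.{u} K) (ComplexShape.up ℤ) 0).shiftMap
    (ShiftedHom.map b ((tensorFunctor M).mapHomotopyCategory (ComplexShape.up ℤ))) i k h).hom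

lemma homologyLeftAct_comp {i j k l m : ℤ} (a : StableHHn P j) (b : StableHHn P l)
    (v : StableHomologyn P M i) (h : j + i = k) (h' : l + k = m) {n : ℤ} (hn : l + j = n) :
    homologyLeftAct P M b (homologyLeftAct P M a v h) h' =
      homologyLeftAct P M (ShiftedHom.comp a b hn) v (by lia) := by
  have := shiftMap_shiftedHom_comp
    (HomotopyCategory.homologyFunctor (ModuleCat.{u} K) (ComplexShape.up ℤ) 0)
    (ShiftedHom.map a ((tensorFunctor M).mapHomotopyCategory (ComplexShape.up ℤ)))
    (ShiftedHom.map b ((tensorFunctor M).mapHomotopyCategory (ComplexShape.up ℤ))) hn i k m h h'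
  rw [← ShiftedHom.map_comp] at this
  exact LinearMap.congr_fun (congrArg ModuleCat.Hom.hom this) v

lemma homologyLeftAct_one {i : ℤ} (v : StableHomologyn P M i) :
    homologyLeftAct P M (ShiftedHom.mk₀ (0 : ℤ) rfl (𝟙 P.toHo)) v (zero_add i) = v := by
  have h₁ : (HomotopyCategory.homologyFunctor (ModuleCat.{u} K) (ComplexShape.up ℤ) 0).shiftMap
      (ShiftedHom.map (ShiftedHom.mk₀ (0 : ℤ) rfl (𝟙 P.toHo))
        ((tensorFunctor M).mapHomotopyCategory (ComplexShape.up ℤ))) i i (zero_add i) = 𝟙 _ := by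
    rw [ShiftedHom.map_mk₀, CategoryTheory.Functor.map_id, CategoryTheory.Functor.shiftMap,
      CategoryTheory.Functor.shiftIso_zero_hom_app, ← CategoryTheory.Functor.map_comp,
      ShiftedHom.mk₀, shiftFunctorZero', Category.id_comp]
    simp
  exact LinearMap.congr_fun (congrArg ModuleCat.Hom.hom h₁) v

/-- An element of degree `s` of the commutant of stable Hochschild cohomology which has an inverse
induces an isomorphism between stable Hochschild homology and its shift. -/
lemma homologyShiftIso_of_inverse {s : ℕ} (x : StableHHn P s) (y : StableHHn P (-s))
    (hyx : y.comp x (by simp) = ShiftedHom.mk₀ (0 : ℤ) rfl (𝟙 P.toHo))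
    (hxy : x.comp y (by simp) = ShiftedHom.mk₀ (0 : ℤ) rfl (𝟙 P.toHo))
    (hx : ∀ (j : ℤ) (b : StableHHn P j), x.comp b (Int.add_comm j s) = b.comp x rfl) :
    HomologyShiftIso P M s := by
  -- The sign makes this the right action of x, v ↦ v x. It then commutes with the right action of
  -- each b, since x commutes with b without a sign.
  let f (n : ℤ) : StableHomologyn P M n →ₗ[K] StableHomologyn P M (n + s) :=
    ((s * n : ℤ).negOnePow : ℤ) • homologyActHom P M x (Int.add_comm s n)
  have hf : ∀ n v, f n v =
      ((s * n : ℤ).negOnePow : ℤ) • homologyLeftAct P M x v (Int.add_comm s n) := fun n v => rfl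
  have sq : ∀ (n : ℤ) {N : Type u} [AddCommGroup N] (v : N),
      (n.negOnePow : ℤ) • (n.negOnePow : ℤ) • v = v := fun n _ _ v => by
    rw [smul_smul, ← Units.val_mul, Int.units_mul_self, Units.val_one, one_smul]
  have actsmul : ∀ {i j k : ℤ} (b : StableHHn P j) (h : j + i = k) (z : ℤ)
      (v : StableHomologyn P M i),
      homologyLeftAct P M b (z • v) h = z • homologyLeftAct P M b v h := fun b h z v =>
    map_zsmul (homologyActHom P M b h) z v
  have h₁ : ∀ n v, homologyLeftAct P M y (homologyLeftAct P M x v (Int.add_comm s n))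
      (neg_add_cancel_comm_assoc (s : ℤ) n) = v := fun n v => by
    rw [homologyLeftAct_comp P M x y v _ _ (n := 0) (by simp), hxy]
    exact homologyLeftAct_one P M v
  have h₂ : ∀ n v, homologyLeftAct P M x (homologyLeftAct P M y v
      (neg_add_cancel_comm_assoc (s : ℤ) n)) (Int.add_comm s n) = v := fun n v => by
    rw [homologyLeftAct_comp P M y x v _ _ (n := 0) (by simp), hyx]
    exact homologyLeftAct_one P M v
  refine ⟨fun n => LinearEquiv.ofBijective (f n)
    ⟨(injective_iff_map_eq_zero _).2 fun v hv => ?_, fun v => ?_⟩, ?_⟩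
  · rw [← h₁ n v, ← sq (s * n) (homologyLeftAct P M x v _), ← hf, hv, smul_zero]
    exact map_zero (homologyActHom P M y _)
  · refine ⟨((s * n : ℤ).negOnePow : ℤ) • homologyLeftAct P M y v
      (neg_add_cancel_comm_assoc (s : ℤ) n), ?_⟩
    rw [hf, actsmul, sq, h₂]
  · rintro i j k rfl v b
    change f (i + j) _ = homologyRightAct P M (f i v) b _
    rw [hf, hf, homologyRightAct, homologyRightAct, actsmul, actsmul,
      homologyLeftAct_comp P M b x v _ _ rfl, homologyLeftAct_comp P M x b v _ _ (Int.add_comm j s),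
      hx, smul_smul, smul_smul, ← Units.val_mul, ← Units.val_mul, ← Int.negOnePow_add,
      ← Int.negOnePow_add]
    -- With v and b of degrees i and j, the exponents on both sides equal s i + s j + i j.
    congr 3
    ring

/-- An element of degree `s` of the commutant of stable Hochschild cohomology which has an inverse
induces an isomorphism between stable Hochschild cohomology and its shift. -/
lemma cohomologyShiftIso_of_inverse {s : ℕ} (x : StableHHn P s) (y : StableHHn P (-s))
    (hyx : y.comp x (by simp) = ShiftedHom.mk₀ (0 : ℤ) rfl (𝟙 P.toHo))
    (hxy : x.comp y (by simp) = ShiftedHom.mk₀ (0 : ℤ) rfl (𝟙 P.toHo))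
    (hx : ∀ (j : ℤ) (b : StableHHn P j), x.comp b (Int.add_comm j s) = b.comp x rfl) :
    CohomologyShiftIso P M s := by
  let f (n : ℤ) : StableHHCoefn P M n →ₗ[K] StableHHCoefn P M (n + s) :=
    { toFun := fun v => x.comp v rfl
      map_add' := fun v w => ShiftedHom.comp_add _ _ _ _
      map_smul' := fun r v => ShiftedHom.comp_smul _ _ _ _ }
  refine ⟨fun n => LinearEquiv.ofBijective (f n)
    ⟨(injective_iff_map_eq_zero _).2 fun v hv => ?_, fun v => ?_⟩, ?_⟩
  · have hv' : x.comp v rfl = 0 := hv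
    rw [← ShiftedHom.mk₀_id_comp (0 : ℤ) rfl v, ← hyx,
      ShiftedHom.comp_assoc y x v (a₂₃ := n + s) (by simp) rfl (by lia), hv',
      ShiftedHom.comp_zero]
  · refine ⟨y.comp v (by lia), ?_⟩
    change x.comp (y.comp v _) rfl = v
    rw [← ShiftedHom.comp_assoc x y v (a₁₂ := 0) (by simp) (by lia) (by lia), hxy,
      ShiftedHom.mk₀_id_comp]
  · rintro i j k rfl v b
    change x.comp (b.comp v rfl) rfl = b.comp (x.comp v rfl) _
    rw [← ShiftedHom.comp_assoc x b v (Int.add_comm j s) rfl (by lia), hx,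
      ShiftedHom.comp_assoc b x v rfl rfl (by lia)]

end StableHomologyAction

end

end HochschildLocalization

namespace HochschildLocalization

noncomputable section

/-! ### Non-vanishing and centrality of the periodicity class -/

section Centrality

open Limits Abelian

variable {K Λ : Type u} [Field K] [Ring Λ] [Algebra K Λ]

/-- If the cocycle were a coboundary, Ωᵐ⁺¹ ≅ Λ would be a direct summand of Rₘ. By minimality it is
also superfluous in Rₘ, hence zero, which contradicts Λ ≠ 0. -/
lemma ne_zero_of_isRepresentedByIso [Nontrivial Λ] {m : ℕ} {h : HHn (reg K Λ) (m + 1)}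
    (hh : IsRepresentedByIso h) : h ≠ 0 := by
  obtain ⟨R, hR, φ, rfl⟩ := hh
  rw [ne_eq, R.extMk_eq_zero_iff _ _ _ _ m rfl]
  rintro ⟨g, hg⟩
  have h₁ : R.complex.fromOpcycles (m + 1) m ≫ g = φ.hom := by
    rw [← cancel_epi (R.complex.pOpcycles (m + 1)), HomologicalComplex.p_fromOpcycles_assoc, hg]
  have hsplit : ∀ x : reg K Λ, g.hom ((R.complex.fromOpcycles (m + 1) m).hom (φ.inv.hom x)) = x :=
    fun x => LinearMap.congr_fun (congrArg ModuleCat.Hom.hom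
      (show (φ.inv ≫ R.complex.fromOpcycles (m + 1) m) ≫ g = 𝟙 _ by
        rw [Category.assoc, h₁, φ.inv_hom_id])) x
  have hker : ∀ z : syzygy R (m + 1), (R.complex.pOpcycles m).hom
      ((R.complex.fromOpcycles (m + 1) m).hom z) = 0 := fun z =>
    LinearMap.congr_fun (congrArg ModuleCat.Hom.hom (fromOpcycles_pOpcycles R m)) z
  -- The kernel of Rₘ → Ωᵐ contains the image of Ωᵐ⁺¹, which complements the kernel of the
  -- retraction g; superfluity then forces g = 0.
  have htop : LinearMap.ker (R.complex.pOpcycles m).hom ⊔ LinearMap.ker g.hom = ⊤ := by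
    refine eq_top_iff.2 fun x _ => ?_
    rw [← add_sub_cancel ((R.complex.fromOpcycles (m + 1) m).hom (φ.inv.hom (g.hom x))) x]
    refine Submodule.add_mem_sup (LinearMap.mem_ker.2 (hker _)) (LinearMap.mem_ker.2 ?_)
    rw [map_sub, hsplit, sub_self]
  have h₂ := hR m _ htop
  have h₃ : ∀ x, g.hom x = 0 := fun x => LinearMap.mem_ker.1 (h₂ ▸ Submodule.mem_top)
  exact one_ne_zero (α := Λ) ((hsplit (1 : Λ)).symm.trans (h₃ _))

lemma homog_mul_of {s i : ℕ} (h : HHn (reg K Λ) s) (a : HHn (reg K Λ) i) :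
    homog h * homog a = homog (a.comp h (Nat.add_comm i s)) :=
  DirectSum.of_mul_of h a

lemma homog_smul {i : ℕ} (z : ℤ) (a : HHn (reg K Λ) i) : homog (z • a) = z • homog a :=
  map_zsmul (DirectSum.of (fun n => HHn (reg K Λ) n) i) z a

lemma homog_mul_eq {s i : ℕ} (h : HHn (reg K Λ) s) (a : HHn (reg K Λ) i) :
    homog h * homog a = ((-1) ^ (s * i) : ℤ) • (homog a * homog h) := by
  rw [homog_mul_of, homog_mul_of, ← homog_smul]
  refine of_eq_of_sigma_eq (fun n => HHn (reg K Λ) n)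
    ((ext_comp_sigma a h (Nat.add_comm i s) rfl).trans ?_)
  rw [graded_commutative a h]

/-- A homogeneous element which is not nilpotent is central. -/
lemma commute_homog {s : ℕ} (h : HHn (reg K Λ) s) (hh : ¬ IsNilpotent (homog h)) (x : HH K Λ) :
    Commute (homog h) x := by
  have hsq := homog_mul_eq h h
  have hsign : ∀ (i : ℕ) (y : HH K Λ), ((-1) ^ (s * i) : ℤ) • y = y := by
    intro i y
    rcases Nat.even_or_odd s with hs | hs
    · rw [(hs.mul_right i).neg_one_pow, one_smul]
    · rw [(hs.mul hs).neg_one_pow, neg_one_smul] at hsq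
      have h2 : (2 : K) = 0 := by
        by_contra h2
        refine hh ⟨2, ?_⟩
        rw [pow_two]
        have h3 : (2 : K) • (homog h * homog h) = 0 := by
          rw [two_smul]
          nth_rw 1 [hsq]
          exact neg_add_cancel _
        exact (smul_eq_zero_iff_right h2).1 h3
      have h4 : -y = y := by
        rw [neg_eq_iff_add_eq_zero, ← two_smul K y, h2, zero_smul]
      rcases neg_one_pow_eq_or ℤ (s * i) with h5 | h5 <;> rw [h5]
      · exact one_smul _ _
      · exact (neg_one_smul _ _).trans h4
  induction x using DirectSum.induction_on with
  | zero => exact Commute.zero_right _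
  | add x y hx hy => exact hx.add_right hy
  | of i a => exact (homog_mul_eq h a).trans (hsign i _)

end Centrality

end

end HochschildLocalization

namespace HochschildLocalization

noncomputable section

/-! ### The comparison as an algebra map and a map of modules -/

section StableComparison

open Limits Abelian

universe t

variable {K Λ : Type u} [Field K] [Ring Λ] [Algebra K Λ]
  [HasDerivedCategory.{t} (Bimod K Λ)] (P : CompleteResolution (reg K Λ))
  [∀ i, Injective (P.complex.X i)]

lemma gradedMap_stableMap_algebraMap (r : K) :
    gradedMap P.stableMap (algebraMap K (HH K Λ) r) = algebraMap K (StableHH P) r :=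
  (gradedMap_of P.stableMap (scalarHH K Λ r)).trans
    (of_eq_of_sigma_eq (fun n => StableHHn P n)
      (congrArg (Sigma.mk (0 : ℤ)) (P.stableMap_smul_one r)))

lemma gradedMap_stableMap_mul (a b : HH K Λ) :
    gradedMap P.stableMap (a * b) = gradedMap P.stableMap a * gradedMap P.stableMap b := by
  induction a using DirectSum.induction_on with
  | zero => simp
  | add x y hx hy => rw [add_mul, map_add, map_add, add_mul, hx, hy]
  | of i a =>
    induction b using DirectSum.induction_on with
    | zero => simp
    | add x y hx hy => rw [mul_add, map_add, map_add, mul_add, hx, hy]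
    | of j b =>
      rw [DirectSum.of_mul_of, gradedMap_of, gradedMap_of, gradedMap_of, DirectSum.of_mul_of, HHn_mul,
        P.stableMap_comp b a (Nat.add_comm j i) (Nat.cast_add i j).symm]
      exact of_eq_of_sigma_eq (fun n => StableHHn P n) (ho_comp_sigma _ _ _ _)

/-- The comparison map from Hochschild cohomology to stable Hochschild cohomology. -/
def stableAlgHom : HH K Λ →ₐ[K] StableHH P where
  toFun := gradedMap P.stableMap
  map_zero' := map_zero _
  map_add' := map_add _
  map_one' := by
    rw [← map_one (algebraMap K (HH K Λ)), gradedMap_stableMap_algebraMap, map_one]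
  map_mul' := gradedMap_stableMap_mul P
  commutes' := gradedMap_stableMap_algebraMap P

lemma stableAlgHom_homog {n : ℕ} (a : HHn (reg K Λ) n) :
    stableAlgHom P (homog a) = DirectSum.of (fun n => StableHHn P n) (n : ℤ) (P.stableMap n a) :=
  gradedMap_of P.stableMap a

/-- The comparison map from Hochschild cohomology to stable Hochschild cohomology with
coefficients. -/
def stableCoefHom (M : Bimod K Λ) : HHCoef M →+ StableHHCoef P M :=
  gradedMap (P.stableCoefMap M)

omit [HasDerivedCategory.{t} (Bimod K Λ)] in
lemma HHCoef.induction {M : Bimod K Λ} {p : HHCoef M → Prop} (x : HHCoef M) (zero : p 0)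
    (of : ∀ n (x : HHn M n), p (HHCoef.of x)) (add : ∀ x y, p x → p y → p (x + y)) : p x :=
  DirectSum.induction_on x zero of add

omit [HasDerivedCategory.{t} (Bimod K Λ)] [∀ i, Injective (P.complex.X i)] in
variable {P} in
lemma StableHHCoef.induction {M : Bimod K Λ} {p : StableHHCoef P M → Prop} (x : StableHHCoef P M)
    (zero : p 0) (of : ∀ n (x : StableHHCoefn P M n), p (StableHHCoef.of x))
    (add : ∀ x y, p x → p y → p (x + y)) : p x :=
  DirectSum.induction_on x zero of add

omit [HasDerivedCategory.{t} (Bimod K Λ)] in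
lemma op_smul_HHCoef_of {M : Bimod K Λ} {i j : ℕ} (x : HHn M i) (a : HHn (reg K Λ) j) :
    MulOpposite.op (homog a) • HHCoef.of x = HHCoef.of (a.comp x (Nat.add_comm j i)) :=
  rightAct_of_of (fun n => HHn (reg K Λ) n) (fun n => HHn M n) x a

omit [HasDerivedCategory.{t} (Bimod K Λ)] [∀ i, Injective (P.complex.X i)] in
lemma op_smul_StableHHCoef_of {M : Bimod K Λ} {i j : ℤ} (x : StableHHCoefn P M i)
    (a : StableHHn P j) :
    MulOpposite.op (DirectSum.of (fun n => StableHHn P n) j a) • StableHHCoef.of x =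
      StableHHCoef.of (ShiftedHom.comp a x rfl : StableHHCoefn P M (i + j)) :=
  rightAct_of_of (fun n => StableHHn P n) (fun n => StableHHCoefn P M n) x a

omit [∀ i, Injective (P.complex.X i)] in
lemma stableCoefHom_of {M : Bimod K Λ} {n : ℕ} (x : HHn M n) :
    stableCoefHom P M (HHCoef.of x) = StableHHCoef.of (P.stableCoefMap M n x) :=
  gradedMap_of (P.stableCoefMap M) x

lemma stableCoefHom_smul (M : Bimod K Λ) (a : HH K Λ) (x : HHCoef M) :
    stableCoefHom P M (MulOpposite.op a • x) =
      MulOpposite.op (stableAlgHom P a) • stableCoefHom P M x := by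
  induction a using DirectSum.induction_on with
  | zero => rw [MulOpposite.op_zero, zero_smul, map_zero, map_zero, MulOpposite.op_zero, zero_smul]
  | add a b ha hb =>
    rw [MulOpposite.op_add, add_smul, map_add, map_add, MulOpposite.op_add, add_smul, ha, hb]
  | of j a =>
    induction x using HHCoef.induction with
    | zero => rw [smul_zero, map_zero, smul_zero]
    | add x y hx hy => rw [smul_add, map_add, map_add, smul_add, hx, hy]
    | of i x =>
      change stableCoefHom P M (MulOpposite.op (homog a) • HHCoef.of x) =
        MulOpposite.op (stableAlgHom P (homog a)) • stableCoefHom P M (HHCoef.of x)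
      rw [op_smul_HHCoef_of, stableAlgHom_homog, stableCoefHom_of, stableCoefHom_of,
        op_smul_StableHHCoef_of,
        P.stableCoefMap_comp a x (Nat.add_comm j i) (Nat.cast_add i j).symm]

/-- The set of homogeneous elements of degree `d`. -/
def homogeneous (d : ℤ) : Set (StableHH P) := Set.range (DirectSum.of (fun n => StableHHn P n) d)

omit [HasDerivedCategory.{t} (Bimod K Λ)] [∀ i, Injective (P.complex.X i)] in
variable {P} in
lemma homogeneous_mul {i j k : ℤ} {x y : StableHH P} (hx : x ∈ homogeneous P i)
    (hy : y ∈ homogeneous P j) (h : i + j = k) : x * y ∈ homogeneous P k := by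
  obtain ⟨x, rfl⟩ := hx
  obtain ⟨y, rfl⟩ := hy
  subst h
  exact ⟨_, (DirectSum.of_mul_of x y).symm⟩

omit [HasDerivedCategory.{t} (Bimod K Λ)] [∀ i, Injective (P.complex.X i)] in
variable {P} in
lemma homogeneous_pow {i : ℤ} {x : StableHH P} (hx : x ∈ homogeneous P i) (n : ℕ) :
    x ^ n ∈ homogeneous P (n * i) := by
  induction n with
  | zero =>
    rw [Nat.cast_zero, zero_mul]
    exact ⟨GradedMonoid.GOne.one, rfl⟩
  | succ n ih => exact pow_succ x n ▸ homogeneous_mul ih hx (by push_cast; ring)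

/-- The set of homogeneous elements of degree `d`. -/
def coefHomogeneous (M : Bimod K Λ) (d : ℤ) : Set (StableHHCoef P M) :=
  Set.range (StableHHCoef.of : StableHHCoefn P M d → StableHHCoef P M)

omit [HasDerivedCategory.{t} (Bimod K Λ)] [∀ i, Injective (P.complex.X i)] in
variable {P} in
lemma coefHomogeneous_smul {M : Bimod K Λ} {i j k : ℤ} {x : StableHHCoef P M} {a : StableHH P}
    (hx : x ∈ coefHomogeneous P M i) (ha : a ∈ homogeneous P j) (h : i + j = k) :
    MulOpposite.op a • x ∈ coefHomogeneous P M k := by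
  obtain ⟨x, rfl⟩ := hx
  obtain ⟨a, rfl⟩ := ha
  subst h
  exact ⟨_, (op_smul_StableHHCoef_of P x a).symm⟩

lemma exists_stableAlgHom_eq {d : ℤ} (hd : 1 ≤ d) {x : StableHH P} (hx : x ∈ homogeneous P d) :
    ∃ (n : ℕ) (a : HHn (reg K Λ) n), (n : ℤ) = d ∧ stableAlgHom P (homog a) = x := by
  obtain ⟨n, rfl⟩ := Int.eq_ofNat_of_zero_le (zero_le_one.trans hd)
  obtain ⟨x, rfl⟩ := hx
  obtain ⟨a, ha⟩ := (P.bijective_stableMap (n := n) (by lia)).2 x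
  exact ⟨n, a, rfl, by rw [stableAlgHom_homog, ha]⟩

omit [∀ i, Injective (P.complex.X i)] in
lemma exists_stableCoefHom_eq {M : Bimod K Λ} {d : ℤ} (hd : 1 ≤ d) {x : StableHHCoef P M}
    (hx : x ∈ coefHomogeneous P M d) :
    ∃ (n : ℕ) (a : HHn M n), (n : ℤ) = d ∧ stableCoefHom P M (HHCoef.of a) = x := by
  obtain ⟨n, rfl⟩ := Int.eq_ofNat_of_zero_le (zero_le_one.trans hd)
  obtain ⟨x, rfl⟩ := hx
  obtain ⟨a, ha⟩ := (P.bijective_stableCoefMap M (n := n) (by lia)).2 x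
  exact ⟨n, a, rfl, by rw [stableCoefHom_of, ha]⟩

/-- The kernel of the comparison lies in degree 0; its product with h has degree s ≥ 1, where the
comparison is injective. -/
lemma homog_mul_eq_zero {s : ℕ} (hs : 1 ≤ s) (h : HHn (reg K Λ) s) {a : HH K Λ}
    (ha : stableAlgHom P a = 0) : homog h * a = 0 := by
  obtain ⟨h₁, h₂⟩ := eq_of_gradedMap_eq_zero P.stableMap
    (fun n hn => (P.bijective_stableMap hn).1) ha
  rw [h₁]
  refine (homog_mul_of h (a 0)).trans ?_
  refine (congrArg _ ((P.bijective_stableMap (n := s + 0) (by lia)).1 ?_)).trans (map_zero _)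
  rw [P.stableMap_comp (a 0) h (Nat.add_comm 0 s) (by simp), h₂, ShiftedHom.zero_comp, map_zero]

lemma op_homog_smul_eq_zero {s : ℕ} (hs : 1 ≤ s) (h : HHn (reg K Λ) s) {M : Bimod K Λ} {x : HHCoef M}
    (hx : stableCoefHom P M x = 0) : MulOpposite.op (homog h) • x = 0 := by
  obtain ⟨x₀, rfl, h₂⟩ : ∃ x₀ : HHn M 0, x = HHCoef.of x₀ ∧ P.stableCoefMap M 0 x₀ = 0 :=
    ⟨_, eq_of_gradedMap_eq_zero (P.stableCoefMap M)
      (fun n hn => (P.bijective_stableCoefMap M hn).1) hx⟩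
  rw [op_smul_HHCoef_of]
  refine (congrArg HHCoef.of ((P.bijective_stableCoefMap M (n := 0 + s) (by lia)).1 ?_)).trans
    (map_zero (DirectSum.of (fun n => HHn M n) (0 + s)))
  rw [P.stableCoefMap_comp h x₀ (Nat.add_comm s 0) (by simp), h₂, ShiftedHom.comp_zero, map_zero]

end StableComparison

end

end HochschildLocalization

namespace HochschildLocalization

noncomputable section

/-- Multiplication by the power |d| + 1 of h brings degree d into the range ≥ 1 where the comparison
is bijective. -/
lemma one_le_natAbs_mul_add {s : ℕ} (hs : 1 ≤ s) (d : ℤ) :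
    (1 : ℤ) ≤ (d.natAbs + 1 : ℕ) * s + d := by
  have h₁ : (d.natAbs + 1) * 1 ≤ (d.natAbs + 1) * s := Nat.mul_le_mul_left _ hs
  zify at h₁
  have h₂ := neg_abs_le d
  push_cast
  linarith

/-! ### Identification with the localization and proof of the theorem -/

section Main

open Limits Abelian

universe t

variable {K Λ : Type u} [Field K] [Ring Λ] [Algebra K Λ]
  [HasDerivedCategory.{t} (Bimod K Λ)] (P : CompleteResolution (reg K Λ))
  [∀ i, Injective (P.complex.X i)]

/-- The unit of stable Hochschild cohomology given by a class with an inverse. -/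
def stableUnit {s : ℕ} (h : HHn (reg K Λ) s) (y : StableHHn P (-s))
    (hyx : y.comp (P.stableMap s h) (by simp) = ShiftedHom.mk₀ (0 : ℤ) rfl (𝟙 P.toHo))
    (hxy : (P.stableMap s h).comp y (by simp) = ShiftedHom.mk₀ (0 : ℤ) rfl (𝟙 P.toHo)) :
    (StableHH P)ˣ where
  val := stableAlgHom P (homog h)
  inv := DirectSum.of (fun n => StableHHn P n) (-s) y
  val_inv := by
    rw [stableAlgHom_homog, DirectSum.of_mul_of]
    exact of_eq_of_sigma_eq (fun n => StableHHn P n)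
      ((ho_comp_sigma y (P.stableMap s h) _ (by simp)).trans (congrArg (Sigma.mk (0 : ℤ)) hyx))
  inv_val := by
    rw [stableAlgHom_homog, DirectSum.of_mul_of]
    exact of_eq_of_sigma_eq (fun n => StableHHn P n)
      ((ho_comp_sigma (P.stableMap s h) y _ (by simp)).trans (congrArg (Sigma.mk (0 : ℤ)) hxy))

/-- A homogeneous element is moved into positive degree by a power of h; for sums, a common power
serves both terms. -/
lemma exists_stableAlgHom_eq_pow_mul {s : ℕ} (hs : 1 ≤ s) {h : HHn (reg K Λ) s}
    (u : (StableHH P)ˣ) (hu : stableAlgHom P (homog h) = u) (x : StableHH P) :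
    ∃ (n : ℕ) (a : HH K Λ), stableAlgHom P a = (u ^ n : (StableHH P)ˣ) * x := by
  have hu' : ∀ n : ℕ, ((u ^ n : (StableHH P)ˣ) : StableHH P) = stableAlgHom P (homog h ^ n) :=
    fun n => by rw [map_pow, hu, Units.val_pow_eq_pow_val]
  induction x using DirectSum.induction_on with
  | zero => exact ⟨0, 0, by rw [map_zero, mul_zero]⟩
  | of d x =>
    have hd := one_le_natAbs_mul_add hs d
    obtain ⟨_, a, -, ha⟩ := exists_stableAlgHom_eq P hd
      (homogeneous_mul (homogeneous_pow ⟨_, (stableAlgHom_homog P h).symm⟩ _) ⟨x, rfl⟩ rfl)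
    exact ⟨d.natAbs + 1, _, ha.trans (by rw [hu', map_pow])⟩
  | add x y hx hy =>
    obtain ⟨m, a, ha⟩ := hx
    obtain ⟨n, b, hb⟩ := hy
    refine ⟨m + n, homog h ^ n * a + homog h ^ m * b, ?_⟩
    rw [map_add, map_mul, map_mul, ha, hb, ← hu', ← hu', ← mul_assoc, ← mul_assoc, ← Units.val_mul,
      ← Units.val_mul, ← pow_add, ← pow_add, Nat.add_comm n m, ← mul_add]

lemma exists_stableCoefHom_eq_pow_smul {s : ℕ} (hs : 1 ≤ s) {h : HHn (reg K Λ) s}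
    (u : (StableHH P)ˣ) (hu : stableAlgHom P (homog h) = u) {M : Bimod K Λ} (x : StableHHCoef P M) :
    ∃ (n : ℕ) (a : HHCoef M),
      stableCoefHom P M a = MulOpposite.op ((u ^ n : (StableHH P)ˣ) : StableHH P) • x := by
  have hu' : ∀ n : ℕ, ((u ^ n : (StableHH P)ˣ) : StableHH P) = stableAlgHom P (homog h ^ n) :=
    fun n => by rw [map_pow, hu, Units.val_pow_eq_pow_val]
  induction x using StableHHCoef.induction with
  | zero => exact ⟨0, 0, by rw [map_zero, smul_zero]⟩
  | of d x =>
    have hd := (one_le_natAbs_mul_add hs d).trans_eq (Int.add_comm _ d)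
    obtain ⟨_, a, -, ha⟩ := exists_stableCoefHom_eq P hd (coefHomogeneous_smul ⟨x, rfl⟩
      (homogeneous_pow ⟨_, (stableAlgHom_homog P h).symm⟩ _) rfl)
    exact ⟨d.natAbs + 1, _, ha.trans (by rw [hu', map_pow])⟩
  | add x y hx hy =>
    obtain ⟨m, a, ha⟩ := hx
    obtain ⟨n, b, hb⟩ := hy
    refine ⟨m + n, MulOpposite.op (homog h ^ n) • a + MulOpposite.op (homog h ^ m) • b, ?_⟩
    rw [map_add, stableCoefHom_smul, stableCoefHom_smul, ha, hb, ← hu', ← hu', smul_smul, smul_smul,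
      ← MulOpposite.op_mul, ← MulOpposite.op_mul, ← Units.val_mul, ← Units.val_mul, ← pow_add,
      ← pow_add, Nat.add_comm n m, ← smul_add]

omit [HasDerivedCategory.{t} (Bimod K Λ)] [∀ i, Injective (P.complex.X i)] in
lemma inv_pow_mem_homogeneous {s : ℕ} (u : (StableHH P)ˣ) (hu' : ((u⁻¹ : (StableHH P)ˣ) : StableHH P) ∈ homogeneous P (-s)) (n : ℕ) :
    ((u⁻¹ ^ n : (StableHH P)ˣ) : StableHH P) ∈ homogeneous P (-(n * s)) := by
  rw [Units.val_pow_eq_pow_val]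
  have := homogeneous_pow hu' n
  rwa [mul_neg] at this

/-- Surjectivity onto degree d needs a single homogeneous numerator, obtained from
`exists_stableAlgHom_eq` with denominator h^(|d| + 1). -/
lemma isGradedRingIso_of_frac {s : ℕ} (hs : 1 ≤ s) {h : HHn (reg K Λ) s}
    (hc : ∀ a, Commute (homog h) a) (u : (StableHH P)ˣ) (hu : stableAlgHom P (homog h) = u)
    (hu' : ((u⁻¹ : (StableHH P)ˣ) : StableHH P) ∈ homogeneous P (-s))
    (Φ : LocRing (homog h) hc ≃ₐ[K] StableHH P)
    (hΦ : ∀ a n, Φ (LocRing.frac hc a n) = (u⁻¹ ^ n : (StableHH P)ˣ) * stableAlgHom P a) :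
    IsGradedRingIso P hc Φ := by
  intro d
  apply Set.Subset.antisymm
  · rintro _ ⟨_, ⟨i, n, a, hd, rfl⟩, rfl⟩
    rw [hΦ]
    exact homogeneous_mul (inv_pow_mem_homogeneous P u hu' n)
      ⟨_, (stableAlgHom_homog P a).symm⟩ (by lia)
  · intro x hx
    have hd := one_le_natAbs_mul_add hs d
    obtain ⟨i, a, hi, ha⟩ := exists_stableAlgHom_eq P hd
      (homogeneous_mul (homogeneous_pow ⟨_, (stableAlgHom_homog P h).symm⟩ _) hx rfl)
    refine ⟨_, ⟨i, d.natAbs + 1, a, by lia, rfl⟩, ?_⟩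
    rw [hΦ, ha, hu, ← Units.val_pow_eq_pow_val, inv_pow, Units.inv_mul_cancel_left]

lemma isGradedModuleIso_of_frac {s : ℕ} (hs : 1 ≤ s) {h : HHn (reg K Λ) s}
    (hc : ∀ a, Commute (homog h) a) (u : (StableHH P)ˣ) (hu : stableAlgHom P (homog h) = u)
    (hu' : ((u⁻¹ : (StableHH P)ˣ) : StableHH P) ∈ homogeneous P (-s))
    (Φ : LocRing (homog h) hc ≃ₐ[K] StableHH P)
    (hΦ : ∀ a n, Φ (LocRing.frac hc a n) = (u⁻¹ ^ n : (StableHH P)ˣ) * stableAlgHom P a)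
    {M : Bimod K Λ} (Ψ : LocModule (homog h) hc (HHCoef M) ≃+ StableHHCoef P M)
    (hΨ : ∀ x n, Ψ (LocModule.frac hc x n) =
      MulOpposite.op ((u⁻¹ ^ n : (StableHH P)ˣ) : StableHH P) • stableCoefHom P M x) :
    IsGradedModuleIso P hc Φ M Ψ := by
  refine ⟨fun x a m n => ?_, fun d => Set.Subset.antisymm ?_ ?_⟩
  · have hcomm : Commute ((u⁻¹ ^ (m + n) : (StableHH P)ˣ) : StableHH P)
        (stableAlgHom P a) := by
      have h₁ : Commute (u : StableHH P) (stableAlgHom P a) := hu ▸ (hc a).map (stableAlgHom P)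
      rw [Units.val_pow_eq_pow_val]
      exact h₁.units_inv_left.pow_left (m + n)
    rw [hΨ, hΨ, hΦ, stableCoefHom_smul, smul_smul, smul_smul, ← MulOpposite.op_mul,
      ← MulOpposite.op_mul, ← mul_assoc, ← Units.val_mul, ← pow_add, hcomm.eq]
  · rintro _ ⟨_, ⟨i, n, a, hd, rfl⟩, rfl⟩
    rw [hΨ, stableCoefHom_of]
    exact coefHomogeneous_smul ⟨_, rfl⟩ (inv_pow_mem_homogeneous P u hu' n) (by lia)
  · intro x hx
    have hd := (one_le_natAbs_mul_add hs d).trans_eq (Int.add_comm _ d)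
    obtain ⟨i, a, hi, ha⟩ := exists_stableCoefHom_eq P hd (coefHomogeneous_smul hx
      (homogeneous_pow ⟨_, (stableAlgHom_homog P h).symm⟩ _) rfl)
    refine ⟨_, ⟨i, d.natAbs + 1, a, by lia, rfl⟩, ?_⟩
    rw [hΨ, ha, hu, ← Units.val_pow_eq_pow_val, smul_smul, ← MulOpposite.op_mul, ← Units.val_mul,
      inv_pow, mul_inv_cancel, Units.val_one, MulOpposite.op_one, one_smul]

/-- Centrality passes to stable cohomology: each element is u⁻ⁿ times an image from HH, and u
commutes with both factors. -/
lemma commute_stableAlgHom_homog {s : ℕ} (hs : 1 ≤ s) {h : HHn (reg K Λ) s}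
    (hc : ∀ a, Commute (homog h) a) (u : (StableHH P)ˣ) (hu : stableAlgHom P (homog h) = u)
    (x : StableHH P) : Commute (stableAlgHom P (homog h)) x := by
  obtain ⟨n, a, ha⟩ := exists_stableAlgHom_eq_pow_mul P hs u hu x
  have h₁ : Commute (u : StableHH P) ((u ^ n : (StableHH P)ˣ) * x) :=
    ha ▸ hu ▸ (hc a).map (stableAlgHom P)
  have h₂ : Commute (u : StableHH P) ((u⁻¹ ^ n : (StableHH P)ˣ) : StableHH P) := by
    rw [Units.val_pow_eq_pow_val]
    exact (Commute.refl (u : StableHH P)).units_inv_right.pow_right n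
  have h₃ := h₂.mul_right h₁
  rwa [inv_pow, Units.inv_mul_cancel_left, ← hu] at h₃

lemma stableMap_comp_comm {s : ℕ} (h : HHn (reg K Λ) s)
    (hc : ∀ x, Commute (stableAlgHom P (homog h)) x) {j : ℤ} (b : StableHHn P j) :
    (P.stableMap s h).comp b (Int.add_comm j s) = ShiftedHom.comp b (P.stableMap s h) rfl := by
  have h₁ := (hc (DirectSum.of (fun n => StableHHn P n) j b)).eq
  rw [stableAlgHom_homog, DirectSum.of_mul_of, DirectSum.of_mul_of] at h₁
  refine DirectSum.of_injective (β := fun n => StableHHn P n) (s + j : ℤ) (Eq.trans ?_ h₁.symm)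
  exact of_eq_of_sigma_eq (fun n => StableHHn P n) (ho_comp_sigma _ _ _ _)

/-- A nilpotent unit exists only in the zero ring. Stable HH would then vanish, and h would be zero
by injectivity in degree m + 1. -/
lemma not_isNilpotent_homog [Nontrivial Λ] {m : ℕ} {h : HHn (reg K Λ) (m + 1)}
    (hh : IsRepresentedByIso h) (u : (StableHH P)ˣ) (hu : stableAlgHom P (homog h) = u) :
    ¬ IsNilpotent (homog h) := by
  intro hnil
  have h₁ := hnil.map (stableAlgHom P)
  rw [hu] at h₁
  have h₂ : Subsingleton (StableHH P) := by
    by_contra hns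
    rw [not_subsingleton_iff_nontrivial] at hns
    exact h₁.not_isUnit u.isUnit
  refine ne_zero_of_isRepresentedByIso hh ((P.bijective_stableMap (n := m + 1) (by lia)).1 ?_)
  refine DirectSum.of_injective (β := fun n => StableHHn P n) ((m + 1 : ℕ) : ℤ) ?_
  exact Subsingleton.elim (α := StableHH P) _ _

end Main

end

end HochschildLocalization

open HochschildLocalization in
theorem proposition2p14 {K Λ : Type u} [Field K] [Ring Λ] [Algebra K Λ] [FiniteDimensional K Λ]
    [Nontrivial Λ] (s : ℕ) (hs : IsPeriodicOfPeriod K Λ s)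
    (h : HHn (reg K Λ) s) (hh : IsRepresentedByIso h) :
    Nonempty (CompleteResolution (reg K Λ)) ∧
    ∀ P : CompleteResolution (reg K Λ),
      (∀ M : Bimod K Λ, CohomologyShiftIso P M s ∧ HomologyShiftIso P M s) ∧
      ¬ IsNilpotent (homog h) ∧
      ∃ (hc : ∀ a, Commute (homog h) a) (Φ : LocRing (homog h) hc ≃ₐ[K] StableHH P),
        IsGradedRingIso P hc Φ ∧
        ∀ M : Bimod K Λ, ∃ Ψ : LocModule (homog h) hc (HHCoef M) ≃+ StableHHCoef P M,
          IsGradedModuleIso P hc Φ M Ψ := by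
  obtain ⟨hs₀, R, -, ⟨φ⟩⟩ := hs.1
  obtain ⟨m, rfl⟩ : ∃ m, s = m + 1 := ⟨s - 1, by lia⟩
  have hinj := injective_of_projective_of_iso R φ
  refine ⟨nonempty_completeResolution φ, fun P => ?_⟩
  -- The derived category is auxiliary: a choice is fixed only to compare Ext with homotopy classes,
  -- and the conclusion does not mention it.
  let _ := HasDerivedCategory.standard (Bimod K Λ)
  have : ∀ i, Injective (P.complex.X i) := fun i => hinj _ (P.projective i)
  obtain ⟨y, hyx, hxy⟩ := P.exists_inverse_stableMap h (trW_of_isRepresentedByIso hinj P hh)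
  let u := stableUnit P h y hyx hxy
  have hu : stableAlgHom P (homog h) = u := rfl
  have hu' : ((u⁻¹ : (StableHH P)ˣ) : StableHH P) ∈ homogeneous P (-(m + 1 : ℕ)) := ⟨y, rfl⟩
  have hnil := not_isNilpotent_homog P hh u hu
  have hc := commute_homog h hnil
  have hcomm := fun j (b : StableHHn P j) =>
    stableMap_comp_comm P h (commute_stableAlgHom_homog P hs₀ hc u hu) b
  obtain ⟨Φ, hΦ⟩ := exists_locRing_equiv hc (stableAlgHom P) u hu
    (fun a ha => homog_mul_eq_zero P hs₀ h ha) (exists_stableAlgHom_eq_pow_mul P hs₀ u hu)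
  refine ⟨fun M => ⟨cohomologyShiftIso_of_inverse P M _ y hyx hxy hcomm,
    homologyShiftIso_of_inverse P M _ y hyx hxy hcomm⟩, hnil, hc, Φ,
    isGradedRingIso_of_frac P hs₀ hc u hu hu' Φ hΦ, fun M => ?_⟩
  obtain ⟨Ψ, hΨ⟩ := exists_locModule_equiv hc (stableAlgHom P) u hu (stableCoefHom P M)
    (stableCoefHom_smul P M) (fun x hx => op_homog_smul_eq_zero P hs₀ h hx)
    (exists_stableCoefHom_eq_pow_smul P hs₀ u hu)
  exact ⟨Ψ, isGradedModuleIso_of_frac P hs₀ hc u hu hu' Φ hΦ Ψ hΨ⟩
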